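/- Let $d\ge 2$ be an integer, $0<s<d$, $1\le p,q\le\infty$ and $z\in\mathbb C\setminus[0,\infty)$. Write $\widehat f(\xi)=\int_{\mathbb R^d} f(x)e^{-ix\cdot\xi}\,dx$ and let $((-\Delta)^{s/2}-z)^{-1}$ be the Fourier multiplier operator $$((-\Delta)^{s/2}-z)^{-1}f(x)=\frac1{(2\pi)^d}\int_{\mathbb R^d}e^{ix\cdot\xi}\,\frac{\widehat f(\xi)}{|\xi|^s-z}\,d\xi ,\qquad f\in\mathcal S(\mathbb R^d),$$ where $\mathcal S(\mathbb R^d)$ is the space of (complex-valued) Schwartz functions. Let $\|((-\Delta)^{s/2}-z)^{-1}\|_{p\to q}\in[0,\infty]$ be the infimum of the finite constants $C\ge 0$ such that $$\|((-\Delta)^{s/2}-z)^{-1}f\|_{L^q(\mathbb R^d)}\le C\,\|f\|_{L^p(\mathbb R^d)}\qquad\text{for all } f\in\mathcal S(\mathbb R^d)$$ ($\infty$ if there is no such $C$). Then $\|((-\Delta)^{s/2}-z)^{-1}\|_{p\to q}<\infty$ if and only if $(1/p,1/q)\in\mathcal R^s_0$, where $1/\infty=0$ and $$\mathcal R^s_0=\Big\{(x,y):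 0\le x,y\le 1,\ 0\le x-y\le \frac sd\Big\}\setminus\Big\{\Big(1,\frac{d-s}d\Big),\Big(\frac sd,0\Big)\Big\}.$$ -/

import Mathlib

open MeasureTheory FourierTransform
open scoped ENNReal NNReal

/-- The Fourier transform in angular frequency,
`f ↦ ∫ f(x) e^{-i x·ξ} dx`. -/
noncomputable def angularFourier {d : ℕ} (f : EuclideanSpace ℝ (Fin d) → ℂ)
    (ξ : EuclideanSpace ℝ (Fin d)) : ℂ :=
  ∫ x : EuclideanSpace ℝ (Fin d), f x * Complex.exp (-Complex.I * (inner ℝ x ξ : ℝ))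

/-- The inverse Fourier transform in angular frequency,
`g ↦ (2π)^{-d} ∫ g(ξ) e^{i x·ξ} dξ`. -/
noncomputable def angularFourierInv {d : ℕ} (g : EuclideanSpace ℝ (Fin d) → ℂ)
    (x : EuclideanSpace ℝ (Fin d)) : ℂ :=
  (((2 * Real.pi) ^ d)⁻¹ : ℝ) *
    ∫ ξ : EuclideanSpace ℝ (Fin d), g ξ * Complex.exp (Complex.I * (inner ℝ x ξ : ℝ))

/-- The Fourier multiplier operator `m(D)`: `f` is sent to the inverse Fourier transform of
`m` times the Fourier transform of `f`, frequencies being angular. -/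
noncomputable def multiplierOp {d : ℕ} (m : EuclideanSpace ℝ (Fin d) → ℂ)
    (f : EuclideanSpace ℝ (Fin d) → ℂ) : EuclideanSpace ℝ (Fin d) → ℂ :=
  angularFourierInv (fun ξ => m ξ * angularFourier f ξ)

/-- The symbol `|ξ|^s` of the fractional Laplacian `(-Δ)^{s/2}`. -/
noncomputable def fracLaplacianSymbol {d : ℕ} (s : ℝ) (ξ : EuclideanSpace ℝ (Fin d)) : ℂ :=
  ((‖ξ‖ ^ s : ℝ) : ℂ)

/-- The resolvent `((-Δ)^{s/2} - z)⁻¹` (for `z` off the half line `[0,∞)`), i.e. the Fourier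
multiplier operator with the bounded symbol `(|ξ|^s - z)⁻¹`. -/
noncomputable def fracResolvent {d : ℕ} (s : ℝ) (z : ℂ)
    (f : EuclideanSpace ℝ (Fin d) → ℂ) : EuclideanSpace ℝ (Fin d) → ℂ :=
  multiplierOp (fun ξ => (fracLaplacianSymbol s ξ - z)⁻¹) f

/-- The norm `‖T‖_{p → q} ∈ [0,∞]`: the infimum of the finite constants `C` such that
`‖T f‖_q ≤ C ‖f‖_p` for all Schwartz functions `f` (it is `∞` if there is none). -/
noncomputable def opNormLpLq {d : ℕ}
    (T : (EuclideanSpace ℝ (Fin d) → ℂ) → (EuclideanSpace ℝ (Fin d) → ℂ)) (p q : ℝ≥0∞) : ℝ≥0∞ :=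
  ⨅ (C : ℝ≥0) (_ : ∀ f : SchwartzMap (EuclideanSpace ℝ (Fin d)) ℂ,
    eLpNorm (T f) q volume ≤ C * eLpNorm f p volume), (C : ℝ≥0∞)

/-- The region of pairs `(x, y)` in the closed unit square with `0 ≤ x - y ≤ s/d`, without the
two points `(1, (d-s)/d)` and `(s/d, 0)`. -/
def resolventRegion (d : ℕ) (s : ℝ) : Set (ℝ × ℝ) :=
  {P : ℝ × ℝ | (0 ≤ P.1 ∧ P.1 ≤ 1) ∧ (0 ≤ P.2 ∧ P.2 ≤ 1) ∧ 0 ≤ P.1 - P.2 ∧ P.1 - P.2 ≤ s / d} \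
    {(1, (d - s) / d), (s / d, 0)}

/-- Comparison with Mathlib's Fourier transform. -/
theorem angularFourier_eq {d : ℕ} (f : EuclideanSpace ℝ (Fin d) → ℂ)
    (ξ : EuclideanSpace ℝ (Fin d)) : angularFourier f ((2 * Real.pi) • ξ) = 𝓕 f ξ := by
  rw [Real.fourier_eq', angularFourier]
  congr 1
  ext x
  rw [smul_eq_mul, mul_comm, inner_smul_right]
  congr 2
  push_cast
  ring

/-- Comparison of the multiplier operator with Mathlib's Fourier transform. -/
theorem multiplierOp_eq {d : ℕ} (m : EuclideanSpace ℝ (Fin d) → ℂ)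
    (f : EuclideanSpace ℝ (Fin d) → ℂ) (x : EuclideanSpace ℝ (Fin d)) :
    multiplierOp m f x = 𝓕⁻ (fun ξ => m ((2 * Real.pi) • ξ) * 𝓕 f ξ) x := by
  rw [Real.fourierInv_eq', multiplierOp, angularFourierInv]
  have h := Measure.integral_comp_smul (volume : Measure (EuclideanSpace ℝ (Fin d)))
    (fun ξ => m ξ * angularFourier f ξ * Complex.exp (Complex.I * (inner ℝ x ξ : ℝ)))
    (2 * Real.pi)
  rw [finrank_euclideanSpace_fin, abs_of_nonneg (by positivity), Complex.real_smul] at h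
  rw [← h]
  congr 1
  ext ξ
  rw [angularFourier_eq, smul_eq_mul, mul_comm, inner_smul_right, real_inner_comm]
  congr 2
  push_cast
  ring

/-!
The symbol of the resolvent, `m(ξ) = (|ξ|^s - z)⁻¹`, is nearly homogeneous of degree `-s` at high
frequencies and differs from the constant `-z⁻¹` by `O(|ξ|^s)` at low frequencies. In a
Littlewood–Paley decomposition, the pieces of `m` at frequency `2 ^ k` with `k > 0`, and those of
`m + z⁻¹` with `k ≤ 0`, are therefore `2 ^ (-s|k|)` times rescalings of profiles from a compact
family of smooth functions (`high_piece_eq`, `low_piece_eq`), and the resolvent is dominated by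
convolution with the positive kernel `dyadicKernel`, the sum of the `L¹`-normalized dilates of
`(1 + |x|)^(-N)` with weights `2 ^ (-s|k|)` (`exists_enorm_resolvent_le`).

*Sufficiency.* That kernel is integrable and `O(|x|^(s - d))`. Young's inequality then covers the
region below the line `1/p - 1/q = s/d`, the Hardy–Littlewood–Sobolev inequality
(`hardy_littlewood_sobolev`) the open segment on it; together they give
`exists_eLpNorm_le_of_le_riesz` and `fracResolvent_bounded`.

*Necessity.* By duality a bound from `Lᵖ` to `L^q` controls the integral of `m ψ₁ ψ₂` by the `Lᵖ`
norm of the Fourier transform of `ψ₁` and the norm of that of `ψ₂` in the dual space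
(`enorm_integral_resolventSymbol_mul_le`). For dilates of fixed bumps, frequencies tending to zero
give `1/q ≤ 1/p`, and frequencies tending to infinity give `1/p - 1/q ≤ s/d`, because the rescaled
symbol has a limit whose pairing with the bump does not vanish. At each of the two excluded points
one of the functions is a wide cutoff, whose Fourier transform has bounded `L¹` norm, and the
other is the sum `bumpSum` of `N` dyadic bumps weighted like `|ξ|^(s - d)`. The bumps contribute
asymptotically equal nonzero amounts to the pairing, which thus grows like `N`, whereas the
Fourier transform of `bumpSum` has `L^(d/s)` norm `O(N^(s/d))`
(`exists_eLpNorm_fourier_bumpSum_le`): a contradiction for `s < d`.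
-/

/-! ### Young's convolution inequality -/

section Haar

variable {E : Type*} [NormedAddCommGroup E] [NormedSpace ℝ E] [FiniteDimensional ℝ E]
  [MeasurableSpace E] [BorelSpace E] {μ : Measure E} [μ.IsAddHaarMeasure]

theorem lintegral_comp_pos_smul (f : E → ℝ≥0∞) {a : ℝ} (ha : 0 < a) :
    ∫⁻ x, f (a • x) ∂μ = ENNReal.ofReal (a ^ (-(Module.finrank ℝ E : ℝ))) * ∫⁻ x, f x ∂μ := by
  have h := (Homeomorph.smulOfNeZero a ha.ne').measurableEmbedding.lintegral_map (μ := μ) f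
  have h2 : Measure.map (Homeomorph.smulOfNeZero (α := E) a ha.ne') μ = _ :=
    Measure.map_addHaar_smul μ ha.ne'
  rw [h2, lintegral_smul_measure] at h
  simp only [Homeomorph.smulOfNeZero_apply] at h
  rw [← h, smul_eq_mul, abs_of_pos (by positivity), Real.rpow_neg ha.le, Real.rpow_natCast]
  rfl

/-- Hölder's inequality with three factors, for the splitting
`u v = (u ^ r v ^ p) ^ b (u ^ r) ^ (1 - a) (v ^ p) ^ (a - b)`. Young's inequality uses it with
`a = 1/p` and `b = 1/q`. -/
theorem lintegral_mul_le_holder_three {α : Type*} [MeasurableSpace α] {ν : Measure α}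
    {u v : α → ℝ≥0∞} (hu : AEMeasurable u ν) (hv : AEMeasurable v ν) {a b p r : ℝ}
    (hb : 0 ≤ b) (hba : b ≤ a) (ha : a ≤ 1) (hp : p * a = 1) (hr : r * (1 - a + b) = 1) :
    ∫⁻ x, u x * v x ∂ν ≤ (∫⁻ x, u x ^ r * v x ^ p ∂ν) ^ b * (∫⁻ x, u x ^ r ∂ν) ^ (1 - a)
      * (∫⁻ x, v x ^ p ∂ν) ^ (a - b) := by
  have hp0 : 0 ≤ p := by
    by_contra h
    nlinarith
  have hr0 : 0 ≤ r := by
    by_contra h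
    nlinarith
  have key := ENNReal.lintegral_prod_norm_pow_le (μ := ν) (Finset.univ : Finset (Fin 3))
    (f := ![fun x => u x ^ r * v x ^ p, fun x => u x ^ r, fun x => v x ^ p])
    (p := ![b, 1 - a, a - b])
    (by
      intro i _
      fin_cases i
      · exact (hu.pow_const r).mul (hv.pow_const p)
      · exact hu.pow_const r
      · exact hv.pow_const p)
    (by
      simp only [Fin.sum_univ_three, Matrix.cons_val_zero, Matrix.cons_val_one, Matrix.cons_val]
      ring)
    (by
      intro i _
      fin_cases i <;> simp <;> linarith)
  simp only [Fin.prod_univ_three, Matrix.cons_val_zero, Matrix.cons_val_one, Matrix.cons_val] at key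
  refine le_trans (le_of_eq (lintegral_congr fun x => ?_)) key
  rw [ENNReal.mul_rpow_of_nonneg _ _ hb, ← ENNReal.rpow_mul, ← ENNReal.rpow_mul,
    ← ENNReal.rpow_mul, ← ENNReal.rpow_mul]
  have e1 : u x ^ (r * b) * u x ^ (r * (1 - a)) = u x := by
    rw [← ENNReal.rpow_add_of_nonneg _ _ (by positivity) (mul_nonneg hr0 (by linarith))]
    rw [show r * b + r * (1 - a) = 1 by linarith, ENNReal.rpow_one]
  have e2 : v x ^ (p * b) * v x ^ (p * (a - b)) = v x := by
    rw [← ENNReal.rpow_add_of_nonneg _ _ (by positivity) (mul_nonneg hp0 (by linarith))]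
    rw [show p * b + p * (a - b) = 1 by linarith, ENNReal.rpow_one]
  calc u x * v x
      = (u x ^ (r * b) * u x ^ (r * (1 - a))) * (v x ^ (p * b) * v x ^ (p * (a - b))) := by
        rw [e1, e2]
    _ = _ := by ring

theorem lintegral_lintegral_conv_eq {k f : E → ℝ≥0∞} (hk : Measurable k) (hf : Measurable f) :
    ∫⁻ x, ∫⁻ y, k (x - y) * f y ∂μ ∂μ = (∫⁻ x, k x ∂μ) * ∫⁻ y, f y ∂μ := by
  rw [lintegral_lintegral_swap]
  · rw [← lintegral_const_mul _ hf]
    refine lintegral_congr fun y => ?_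
    rw [lintegral_mul_const (f := fun x => k (x - y)) _ (hk.comp (measurable_id.sub_const y)),
      lintegral_sub_right_eq_self k y]
  · exact ((hk.comp (measurable_fst.sub measurable_snd)).mul
      (hf.comp measurable_snd)).aemeasurable

theorem measurable_lintegral_conv {k f : E → ℝ≥0∞} (hk : Measurable k) (hf : Measurable f) :
    Measurable fun x => ∫⁻ y, k (x - y) * f y ∂μ :=
  Measurable.lintegral_prod_right
    ((hk.comp (measurable_fst.sub measurable_snd)).mul (hf.comp measurable_snd))

/-- The pointwise bound behind Young's inequality. For `b = 0` it is Hölder's inequality, which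
handles convolutions into `L^∞`. -/
theorem lintegral_conv_le_holder {k f : E → ℝ≥0∞} (hk : Measurable k) (hf : Measurable f)
    {a b p r : ℝ} (hb : 0 ≤ b) (hba : b ≤ a) (ha : a ≤ 1) (hp : p * a = 1)
    (hr : r * (1 - a + b) = 1) (x : E) :
    ∫⁻ y, k (x - y) * f y ∂μ ≤ (∫⁻ y, k (x - y) ^ r * f y ^ p ∂μ) ^ b *
      (∫⁻ y, k y ^ r ∂μ) ^ (1 - a) * (∫⁻ y, f y ^ p ∂μ) ^ (a - b) := by
  have h := lintegral_mul_le_holder_three (ν := μ) (u := fun y => k (x - y)) (v := f)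
    (hk.comp (measurable_id.const_sub _)).aemeasurable hf.aemeasurable hb hba ha hp hr
  rwa [lintegral_sub_left_eq_self (fun y => k y ^ r) x] at h

/-- Young's convolution inequality for nonnegative functions. -/
theorem lintegral_conv_rpow_le {k f : E → ℝ≥0∞} (hk : Measurable k) (hf : Measurable f)
    {p q r : ℝ} (hp : 1 ≤ p) (hpq : p ≤ q) (hr : r * (1 - 1 / p + 1 / q) = 1) :
    ∫⁻ x, (∫⁻ y, k (x - y) * f y ∂μ) ^ q ∂μ ≤
      ((∫⁻ x, k x ^ r ∂μ) ^ (1 / r) * (∫⁻ x, f x ^ p ∂μ) ^ (1 / p)) ^ q := by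
  have hp0 : 0 < p := by linarith
  have hq0 : 0 < q := by linarith
  have hqp : 1 / q ≤ 1 / p := one_div_le_one_div_of_le hp0 hpq
  have hp1 : 1 / p ≤ 1 := by rw [div_le_one hp0]; exact hp
  have hq1 : 0 < 1 / q := by positivity
  have hr0 : 1 / r = 1 - 1 / p + 1 / q := by
    rw [one_div]; exact (eq_inv_of_mul_eq_one_right hr).symm
  set A := ∫⁻ x, k x ^ r ∂μ
  set B := ∫⁻ x, f x ^ p ∂μ
  calc ∫⁻ x, (∫⁻ y, k (x - y) * f y ∂μ) ^ q ∂μ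
      ≤ ∫⁻ x, (∫⁻ y, k (x - y) ^ r * f y ^ p ∂μ) *
          (A ^ (1 - 1 / p) * B ^ (1 / p - 1 / q)) ^ q ∂μ := by
        refine lintegral_mono fun x => ?_
        have h := ENNReal.rpow_le_rpow (lintegral_conv_le_holder (μ := μ) hk hf hq1.le hqp hp1
          (by field_simp) hr x) hq0.le
        rw [mul_assoc, ENNReal.mul_rpow_of_nonneg _ _ hq0.le, ← ENNReal.rpow_mul, one_div,
          inv_mul_cancel₀ hq0.ne', ENNReal.rpow_one] at h
        simpa [one_div] using h
    _ = (A * B) * (A ^ (1 - 1 / p) * B ^ (1 / p - 1 / q)) ^ q := by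
        rw [lintegral_mul_const _ (measurable_lintegral_conv (hk.pow_const r) (hf.pow_const p)),
          lintegral_lintegral_conv_eq (hk.pow_const r) (hf.pow_const p)]
    _ = ((A * B) ^ (1 / q) * (A ^ (1 - 1 / p) * B ^ (1 / p - 1 / q))) ^ q := by
        rw [ENNReal.mul_rpow_of_nonneg ((A * B) ^ (1 / q)) _ hq0.le, ← ENNReal.rpow_mul,
          one_div_mul_cancel hq0.ne', ENNReal.rpow_one]
    _ = _ := by
        congr 1
        rw [ENNReal.mul_rpow_of_nonneg _ _ hq1.le, hr0,
          ENNReal.rpow_add_of_nonneg _ _ (by linarith) hq1.le]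
        conv_rhs => rw [show 1 / p = 1 / q + (1 / p - 1 / q) by ring]
        rw [ENNReal.rpow_add_of_nonneg _ _ hq1.le (by linarith),
          show 1 / q + (1 / p - 1 / q) = 1 / p by ring]
        ring

end Haar

/-! ### Integrals of powers of the norm -/

/-- The layer cake identity for a single value `g`, which may be infinite. -/
theorem lintegral_Ioi_layer {a : ℝ} (ha : 0 < a) (g : ℝ≥0∞) :
    ∫⁻ t in Set.Ioi (0 : ℝ), {t | ENNReal.ofReal t < g}.indicator
      (fun t => ENNReal.ofReal (t ^ (a - 1))) t = ENNReal.ofReal a⁻¹ * g ^ a := by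
  have fin : ∀ b : ℝ, 0 ≤ b →
      ∫⁻ t in Set.Ioi (0 : ℝ), {t | ENNReal.ofReal t < ENNReal.ofReal b}.indicator
        (fun t => ENNReal.ofReal (t ^ (a - 1))) t = ENNReal.ofReal a⁻¹ * ENNReal.ofReal b ^ a := by
    intro b hb
    rw [ENNReal.ofReal_rpow_of_nonneg hb ha.le, ← ENNReal.ofReal_mul (by positivity)]
    have e : {t : ℝ | ENNReal.ofReal t < ENNReal.ofReal b} ∩ Set.Ioi 0 = Set.Ioo 0 b := by
      ext t
      simp only [Set.mem_inter_iff, Set.mem_ofPred_eq, Set.mem_Ioi, Set.mem_Ioo]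
      constructor
      · rintro ⟨h1, h2⟩
        exact ⟨h2, (ENNReal.ofReal_lt_ofReal_iff_of_nonneg h2.le).1 h1⟩
      · rintro ⟨h1, h2⟩
        exact ⟨(ENNReal.ofReal_lt_ofReal_iff_of_nonneg h1.le).2 h2, h1⟩
    have hm : MeasurableSet {t : ℝ | ENNReal.ofReal t < ENNReal.ofReal b} :=
      measurableSet_lt ENNReal.measurable_ofReal measurable_const
    rw [lintegral_indicator hm, Measure.restrict_restrict hm, e]
    have hint : IntervalIntegrable (fun t : ℝ => t ^ (a - 1)) volume 0 b :=
      intervalIntegral.intervalIntegrable_rpow' (by linarith)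
    rw [← setLIntegral_congr Ioo_ae_eq_Ioc.symm, ← ofReal_integral_eq_lintegral_ofReal,
      ← intervalIntegral.integral_of_le hb, integral_rpow (Or.inl (by linarith))]
    · congr 1
      rw [sub_add_cancel, Real.zero_rpow ha.ne']
      ring
    · exact (intervalIntegrable_iff_integrableOn_Ioc_of_le hb).1 hint
    · filter_upwards [ae_restrict_mem measurableSet_Ioc] with t ht
      exact Real.rpow_nonneg ht.1.le _
  rcases eq_or_ne g ∞ with rfl | hg
  · rw [ENNReal.top_rpow_of_pos ha, ENNReal.mul_top (by simpa using ha)]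
    refine ENNReal.eq_top_of_forall_nnreal_le fun c => ?_
    have h := fin ((a * c) ^ a⁻¹) (by positivity)
    rw [ENNReal.ofReal_rpow_of_nonneg (by positivity) ha.le, ← ENNReal.ofReal_mul (by positivity),
      ← Real.rpow_mul (by positivity), inv_mul_cancel₀ ha.ne', Real.rpow_one,
      inv_mul_cancel_left₀ ha.ne', ENNReal.ofReal_coe_nnreal] at h
    rw [← h]
    refine lintegral_mono fun t => ?_
    have hsub : {t : ℝ | ENNReal.ofReal t < ENNReal.ofReal ((a * c) ^ a⁻¹)} ⊆
        {t : ℝ | ENNReal.ofReal t < ∞} := fun t _ => ENNReal.ofReal_lt_top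
    exact Set.indicator_le_indicator_of_subset hsub (fun _ => zero_le) t
  · have h := fin g.toReal ENNReal.toReal_nonneg
    rwa [ENNReal.ofReal_toReal hg] at h

/-- At `x = 0` the two sides may differ: for `α < 0` the left side is infinite, the right side
zero. -/
theorem enorm_rpow_eq_ofReal {F : Type*} [NormedAddCommGroup F] {x : F} (hx : x ≠ 0) (α : ℝ) :
    ‖x‖ₑ ^ α = ENNReal.ofReal (‖x‖ ^ α) := by
  rw [← ofReal_norm, ENNReal.ofReal_rpow_of_pos (norm_pos_iff.2 hx)]

section Haar

variable {E : Type*} [NormedAddCommGroup E] [NormedSpace ℝ E] [FiniteDimensional ℝ E]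
  [MeasurableSpace E] [BorelSpace E] {μ : Measure E} [μ.IsAddHaarMeasure]

/-- Homogeneity of the integral of a power of the norm over a radial set. -/
theorem lintegral_indicator_enorm_rpow_smul (S : Set ℝ) (α : ℝ) {R : ℝ} (hR : 0 < R) :
    ∫⁻ x, {x : E | ‖x‖ ∈ (R * ·) '' S}.indicator (fun x => ‖x‖ₑ ^ α) x ∂μ =
      ENNReal.ofReal (R ^ ((Module.finrank ℝ E : ℝ) + α)) *
        ∫⁻ x, {x : E | ‖x‖ ∈ S}.indicator (fun x => ‖x‖ₑ ^ α) x ∂μ := by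
  have h := lintegral_comp_pos_smul (μ := μ)
    ({x : E | ‖x‖ ∈ (R * ·) '' S}.indicator (fun x => ‖x‖ₑ ^ α)) hR
  have e : ∀ x : E, {x : E | ‖x‖ ∈ (R * ·) '' S}.indicator (fun x => ‖x‖ₑ ^ α) (R • x) =
      ENNReal.ofReal (R ^ α) * {x : E | ‖x‖ ∈ S}.indicator (fun x => ‖x‖ₑ ^ α) x := by
    intro x
    have hmem : R • x ∈ {x : E | ‖x‖ ∈ (R * ·) '' S} ↔ x ∈ {x : E | ‖x‖ ∈ S} := by
      simp [norm_smul, abs_of_pos hR, hR.ne']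
    by_cases hx : x ∈ {x : E | ‖x‖ ∈ S}
    · rw [Set.indicator_of_mem hx, Set.indicator_of_mem (hmem.2 hx), enorm_smul,
        Real.enorm_of_nonneg hR.le,
        ENNReal.mul_rpow_of_ne_top ENNReal.ofReal_ne_top enorm_ne_top,
        ENNReal.ofReal_rpow_of_pos hR]
    · rw [Set.indicator_of_notMem hx, Set.indicator_of_notMem (fun h => hx (hmem.1 h)), mul_zero]
  simp_rw [e] at h
  rw [lintegral_const_mul' _ _ ENNReal.ofReal_ne_top] at h
  rw [Real.rpow_add hR, ENNReal.ofReal_mul (by positivity), mul_assoc, h, ← mul_assoc,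
    ← ENNReal.ofReal_mul (by positivity), ← Real.rpow_add hR, add_neg_cancel, Real.rpow_zero,
    ENNReal.ofReal_one, one_mul]

theorem ae_ne_zero_of_finrank_pos (hn : 0 < Module.finrank ℝ E) : ∀ᵐ x ∂μ, x ≠ 0 := by
  have : Nontrivial E := Module.nontrivial_of_finrank_pos hn
  exact Measure.ae_ne μ 0

theorem setLIntegral_ball_enorm_rpow_lt_top (hn : 0 < Module.finrank ℝ E) {α : ℝ}
    (hα : -α < Module.finrank ℝ E) :
    ∫⁻ x in Metric.ball (0 : E) 1, ‖x‖ₑ ^ α ∂μ < ∞ := by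
  have h := integrableOn_ball_of_norm_le_rpow (μ := μ) (E := E) (f := fun x => ‖x‖ ^ α) (C := 1)
    (α := -α) (r := 1) hn hα (by
      refine Filter.Eventually.of_forall fun x => ?_
      rw [neg_neg, one_mul, Real.norm_of_nonneg (by positivity)])
    (by
      have : Measurable fun x : E => ‖x‖ ^ α := by fun_prop
      exact this.aestronglyMeasurable)
  refine lt_of_eq_of_lt (lintegral_congr_ae ?_) h.2
  filter_upwards [ae_restrict_of_ae (ae_ne_zero_of_finrank_pos hn)] with x hx
  rw [enorm_rpow_eq_ofReal hx, Real.enorm_of_nonneg (by positivity)]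

theorem lintegral_near_enorm_rpow (hn : 0 < Module.finrank ℝ E) {α : ℝ}
    (hα : -α < Module.finrank ℝ E) : ∃ c : ℝ, 0 < c ∧ ∀ R : ℝ, 0 < R →
    ∫⁻ x, {x : E | ‖x‖ < R}.indicator (fun x => ‖x‖ₑ ^ α) x ∂μ ≤
      ENNReal.ofReal (c * R ^ ((Module.finrank ℝ E : ℝ) + α)) := by
  have h1 := setLIntegral_ball_enorm_rpow_lt_top (μ := μ) hn hα
  set I := ∫⁻ x in Metric.ball (0 : E) 1, ‖x‖ₑ ^ α ∂μ with hI
  refine ⟨I.toReal + 1, by positivity, fun R hR => ?_⟩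
  have h := lintegral_indicator_enorm_rpow_smul (E := E) (μ := μ) (Set.Iio 1) α hR
  have e1 : {x : E | ‖x‖ ∈ (R * ·) '' Set.Iio 1} = {x : E | ‖x‖ < R} := by
    ext x
    rw [Set.image_mul_left_Iio hR, mul_one]; rfl
  have e2 : {x : E | ‖x‖ ∈ Set.Iio (1 : ℝ)} = Metric.ball (0 : E) 1 := by
    ext x; simp
  rw [e1, e2, lintegral_indicator measurableSet_ball] at h
  rw [h, mul_comm, ENNReal.ofReal_mul (by positivity)]
  gcongr
  rw [← hI]
  exact (ENNReal.le_ofReal_iff_toReal_le h1.ne (by positivity)).2 (by linarith)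

theorem lintegral_far_enorm_rpow {α : ℝ} (hα : (Module.finrank ℝ E : ℝ) < -α) :
    ∃ c : ℝ, 0 < c ∧ ∀ R : ℝ, 0 < R →
    ∫⁻ x, {x : E | R ≤ ‖x‖}.indicator (fun x => ‖x‖ₑ ^ α) x ∂μ ≤
      ENNReal.ofReal (c * R ^ ((Module.finrank ℝ E : ℝ) + α)) := by
  have h0 := finite_integral_one_add_norm (μ := μ) (E := E) hα
  set I := ∫⁻ x, {x : E | ‖x‖ ∈ Set.Ici (1 : ℝ)}.indicator (fun x => ‖x‖ₑ ^ α) x ∂μ with hI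
  have h1 : I < ∞ := by
    have : I ≤ ENNReal.ofReal (2 ^ (-α)) * ∫⁻ x : E, ENNReal.ofReal ((1 + ‖x‖) ^ (-(-α))) ∂μ := by
      rw [hI, ← lintegral_const_mul' _ _ ENNReal.ofReal_ne_top]
      refine lintegral_mono fun x => Set.indicator_apply_le' (fun hx => ?_) (fun _ => zero_le)
      have hx : 1 ≤ ‖x‖ := hx
      have hn : (0 : ℝ) ≤ Module.finrank ℝ E := by positivity
      rw [enorm_rpow_eq_ofReal (norm_pos_iff.1 (by linarith)), ← ENNReal.ofReal_mul (by positivity)]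
      apply ENNReal.ofReal_le_ofReal
      rw [neg_neg, Real.rpow_neg (by norm_num), ← div_eq_inv_mul, ← Real.div_rpow (by positivity)
        (by norm_num)]
      exact Real.rpow_le_rpow_of_nonpos (by positivity) (by linarith) (by linarith)
    exact this.trans_lt (ENNReal.mul_lt_top ENNReal.ofReal_lt_top h0)
  refine ⟨I.toReal + 1, by positivity, fun R hR => ?_⟩
  have h := lintegral_indicator_enorm_rpow_smul (E := E) (μ := μ) (Set.Ici 1) α hR
  have e1 : {x : E | ‖x‖ ∈ (R * ·) '' Set.Ici 1} = {x : E | R ≤ ‖x‖} := by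
    ext x
    rw [Set.image_mul_left_Ici hR, mul_one]; rfl
  rw [e1, ← hI] at h
  rw [h, mul_comm, ENNReal.ofReal_mul (by positivity)]
  gcongr
  exact (ENNReal.le_ofReal_iff_toReal_le h1.ne (by positivity)).2 (by linarith)

end Haar

/-! ### The Hardy–Littlewood–Sobolev inequality -/

section Haar

variable {E : Type*} [NormedAddCommGroup E] [NormedSpace ℝ E] [FiniteDimensional ℝ E]
  [MeasurableSpace E] [BorelSpace E] {μ : Measure E} [μ.IsAddHaarMeasure]

/-- A bound for the distribution function of a Riesz potential by the part of `f` above a height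
proportional to `t ^ (q / p)`. The kernel is cut at a radius depending on `t`, and `f` at that
height: the far part of the kernel contributes at most `t / 3` by Hölder's inequality, the near
part applied to the low part of `f` at most `t / 3` too, and what remains is estimated in `L¹`. -/
theorem riesz_distribution_bound (hn : 0 < Module.finrank ℝ E) {s p q : ℝ} (hs : 0 < s)
    (hp : 1 < p) (hq : 0 < q) (hpq : 1 / q = 1 / p - s / Module.finrank ℝ E) :
    ∃ κ : ℝ, 0 < κ ∧ ∀ f : E → ℝ≥0∞, Measurable f → ∫⁻ x, f x ^ p ∂μ ≤ 1 → ∀ t : ℝ, 0 < t →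
      μ {x | ENNReal.ofReal t < ∫⁻ y, ‖x - y‖ₑ ^ (s - Module.finrank ℝ E) * f y ∂μ} ≤
        ENNReal.ofReal (κ * t ^ (q / p))⁻¹ *
          ∫⁻ x, {x | ENNReal.ofReal (κ * t ^ (q / p)) < f x}.indicator f x ∂μ := by
  set n : ℝ := (Module.finrank ℝ E : ℝ) with hn'
  have hn0 : 0 < n := by rw [hn']; exact_mod_cast hn
  have hp0 : 0 < p := by linarith
  have hp1 : 1 / p < 1 := by rw [div_lt_one hp0]; exact hp
  have hq1 : 0 < 1 / q := by positivity
  -- the exponent dual to `p`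
  set r : ℝ := (1 - 1 / p)⁻¹ with hr
  have hr0 : 0 < r := inv_pos.2 (by linarith)
  have hr1 : r * (1 - 1 / p) = 1 := inv_mul_cancel₀ (by linarith)
  have hsn : (n - s) * r = n + n / q * r := by
    have : s = n * (1 / p - 1 / q) := by rw [hpq]; field_simp; ring
    have h2 : r = 1 + r * (1 / p) := by linarith
    rw [this]
    calc (n - n * (1 / p - 1 / q)) * r = n * (r * (1 - 1 / p)) + n / q * r := by ring
      _ = _ := by rw [hr1]; ring
  obtain ⟨c₁, hc₁, near⟩ := lintegral_near_enorm_rpow (E := E) (μ := μ) hn (α := s - n)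
    (by rw [← hn']; linarith)
  obtain ⟨c₀, hc₀, far⟩ := lintegral_far_enorm_rpow (E := E) (μ := μ) (α := (s - n) * r) (by
    have : 0 < n / q * r := by positivity
    rw [← hn']; nlinarith)
  rw [← hn'] at near far
  set c₂ := c₀ ^ (1 - 1 / p) with hc₂'
  have hc₂ : 0 < c₂ := by positivity
  set κ := ((3 * c₁) * (3 * c₂) ^ (q * s / n))⁻¹ with hκ
  refine ⟨κ, by positivity, fun f hf hfp t ht => ?_⟩
  set g : E → ℝ≥0∞ := fun x => ∫⁻ y, ‖x - y‖ₑ ^ (s - n) * f y ∂μ with hg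
  -- the radius at which the part of the kernel outside contributes at most `t / 3`
  set R := (t / (3 * c₂)) ^ (-(q / n)) with hR'
  have hR : 0 < R := by positivity
  -- the height below which the values of `f` contribute at most `t / 3` near the singularity
  set τ := κ * t ^ (q / p) with hτ'
  have hτ : 0 < τ := by positivity
  have hRs : R ^ s = (3 * c₂) ^ (q * s / n) * t ^ (-(q * s / n)) := by
    rw [hR', ← Real.rpow_mul (by positivity), Real.div_rpow ht.le (by positivity),
      show -(q / n) * s = -(q * s / n) by ring, Real.rpow_neg (x := 3 * c₂) (by positivity),
      div_inv_eq_mul, mul_comm]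
  have hτR : c₁ * R ^ s * τ = t / 3 := by
    rw [hτ', hRs, hκ]
    have : t ^ (-(q * s / n)) * t ^ (q / p) = t := by
      rw [← Real.rpow_add ht]
      conv_rhs => rw [← Real.rpow_one t]
      congr 1
      have : q * (1 / q) = 1 := by field_simp
      rw [hpq] at this
      linear_combination this
    calc _ = (t ^ (-(q * s / n)) * t ^ (q / p)) * (c₁ * ((3 * c₂) ^ (q * s / n)) /
        ((3 * c₁) * (3 * c₂) ^ (q * s / n))) := by ring
      _ = _ := by rw [this]; field_simp
  have hR2 : c₂ * R ^ (-(n / q)) = t / 3 := by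
    rw [hR', ← Real.rpow_mul (by positivity)]
    rw [show -(q / n) * -(n / q) = 1 by field_simp, Real.rpow_one]
    field_simp
  set k₁ : E → ℝ≥0∞ := {x : E | ‖x‖ < R}.indicator (fun x => ‖x‖ₑ ^ (s - n)) with hk₁
  set k₂ : E → ℝ≥0∞ := {x : E | R ≤ ‖x‖}.indicator (fun x => ‖x‖ₑ ^ (s - n)) with hk₂
  set f₁ : E → ℝ≥0∞ := {x | ENNReal.ofReal τ < f x}.indicator f with hf₁
  have hmk : Measurable fun x : E => ‖x‖ₑ ^ (s - n) := by fun_prop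
  have mk₁ : Measurable k₁ := hmk.indicator (measurableSet_lt measurable_norm measurable_const)
  have mk₂ : Measurable k₂ := hmk.indicator (measurableSet_le measurable_const measurable_norm)
  have mf₁ : Measurable f₁ := hf.indicator (measurableSet_lt measurable_const hf)
  have hk : ∀ x, ‖x‖ₑ ^ (s - n) = k₁ x + k₂ x := by
    intro x
    rcases lt_or_ge ‖x‖ R with h | h
    · simp [hk₁, hk₂, h]
    · simp [hk₁, hk₂, h]
  have hff : ∀ x, f x ≤ f₁ x + ENNReal.ofReal τ := by
    intro x
    rcases lt_or_ge (ENNReal.ofReal τ) (f x) with h | h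
    · simp [hf₁, h]
    · exact h.trans le_add_self
  have I₁ : ∫⁻ x, k₁ x ∂μ ≤ ENNReal.ofReal (c₁ * R ^ s) := by
    have := near R hR
    rwa [add_sub_cancel] at this
  have far' : ∀ x, ∫⁻ y, k₂ (x - y) * f y ∂μ ≤ ENNReal.ofReal (t / 3) := by
    intro x
    have h := lintegral_conv_le_holder (μ := μ) mk₂ hf (a := 1 / p) (b := 0) (p := p) (r := r)
      le_rfl (by positivity) hp1.le (by field_simp) (by simpa using hr1) x
    rw [ENNReal.rpow_zero, one_mul, sub_zero] at h
    refine h.trans ?_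
    have e : ∀ y, k₂ y ^ r = {x : E | R ≤ ‖x‖}.indicator (fun x => ‖x‖ₑ ^ ((s - n) * r)) y := by
      intro y
      by_cases hy : R ≤ ‖y‖
      · simp [hk₂, hy, ENNReal.rpow_mul]
      · simp [hk₂, hy, hr0]
    simp_rw [e]
    calc _ ≤ ENNReal.ofReal (c₀ * R ^ (n + (s - n) * r)) ^ (1 - 1 / p) * 1 := by
          gcongr
          · exact far R hR
          · exact ENNReal.rpow_le_one hfp (by positivity)
      _ = ENNReal.ofReal (t / 3) := by
          rw [mul_one, ENNReal.ofReal_rpow_of_nonneg (by positivity) (by linarith), ← hR2, hc₂',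
            Real.mul_rpow (by positivity) (by positivity), ← Real.rpow_mul hR.le]
          congr 3
          have : (n + (s - n) * r) = -(n / q * r) := by linarith
          rw [this]
          calc -(n / q * r) * (1 - 1 / p) = -(n / q) * (r * (1 - 1 / p)) := by ring
            _ = _ := by rw [hr1, mul_one]
  have low : ∀ x, ∫⁻ y, k₁ (x - y) * ENNReal.ofReal τ ∂μ ≤ ENNReal.ofReal (t / 3) := by
    intro x
    rw [lintegral_mul_const (f := fun y => k₁ (x - y)) _ (mk₁.comp (measurable_id.const_sub x)),
      lintegral_sub_left_eq_self k₁ x, ← hτR,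
      ENNReal.ofReal_mul (p := c₁ * R ^ s) (by positivity)]
    exact mul_le_mul' I₁ le_rfl
  have sub : {x | ENNReal.ofReal t < g x} ⊆
      {x | ENNReal.ofReal (t / 3) ≤ ∫⁻ y, k₁ (x - y) * f₁ y ∂μ} := by
    intro x hx
    rw [Set.mem_ofPred_eq] at hx ⊢
    by_contra! hlt
    have hle : g x ≤ (∫⁻ y, k₁ (x - y) * f₁ y ∂μ) + (∫⁻ y, k₁ (x - y) * ENNReal.ofReal τ ∂μ)
        + ∫⁻ y, k₂ (x - y) * f y ∂μ := by
      have m1 : Measurable fun y => k₁ (x - y) := mk₁.comp (measurable_id.const_sub x)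
      have m2 : Measurable fun y => k₂ (x - y) := mk₂.comp (measurable_id.const_sub x)
      rw [← lintegral_add_left (f := fun y => k₁ (x - y) * f₁ y) (m1.mul mf₁),
        ← lintegral_add_right (g := fun y => k₂ (x - y) * f y) _ (m2.mul hf)]
      refine lintegral_mono fun y => ?_
      simp only [hk (x - y), add_mul]
      gcongr
      rw [← mul_add]
      gcongr
      exact hff y
    have h3 : ENNReal.ofReal t = ENNReal.ofReal (t / 3) + ENNReal.ofReal (t / 3) +
        ENNReal.ofReal (t / 3) := by
      rw [← ENNReal.ofReal_add (by positivity) (by positivity),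
        ← ENNReal.ofReal_add (by positivity) (by positivity)]
      congr 1
      ring
    refine absurd hx (not_lt.2 (hle.trans ?_))
    rw [h3]
    gcongr
    · exact low x
    · exact far' x
  calc μ {x | ENNReal.ofReal t < g x}
      ≤ (∫⁻ x, ∫⁻ y, k₁ (x - y) * f₁ y ∂μ ∂μ) / ENNReal.ofReal (t / 3) :=
        (measure_mono sub).trans (meas_ge_le_lintegral_div
          (measurable_lintegral_conv mk₁ mf₁).aemeasurable (by simpa using ht)
          ENNReal.ofReal_ne_top)
    _ ≤ (ENNReal.ofReal (c₁ * R ^ s) * ∫⁻ x, f₁ x ∂μ) / ENNReal.ofReal (t / 3) := by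
        rw [lintegral_lintegral_conv_eq mk₁ mf₁]
        gcongr
    _ = ENNReal.ofReal τ⁻¹ * ∫⁻ x, f₁ x ∂μ := by
        rw [mul_comm (ENNReal.ofReal _), mul_div_assoc, mul_comm,
          ← ENNReal.ofReal_div_of_pos (by positivity), ← hτR]
        congr 2
        field_simp

/-- The distributional bound integrated against `t ^ (q - 1)`; by Tonelli's theorem the layers of
`f` add up to `f ^ p`. -/
theorem riesz_normalized_bound (hn : 0 < Module.finrank ℝ E) {s p q : ℝ} (hs : 0 < s)
    (hp : 1 < p) (hq : 0 < q) (hpq : 1 / q = 1 / p - s / Module.finrank ℝ E) :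
    ∃ C : ℝ≥0∞, C ≠ 0 ∧ C ≠ ∞ ∧ ∀ f : E → ℝ≥0∞, Measurable f → ∫⁻ x, f x ^ p ∂μ ≤ 1 →
      ∫⁻ x, (∫⁻ y, ‖x - y‖ₑ ^ (s - Module.finrank ℝ E) * f y ∂μ) ^ q ∂μ ≤
        C * ∫⁻ x, f x ^ p ∂μ := by
  obtain ⟨κ, hκ, hdist⟩ := riesz_distribution_bound (μ := μ) hn hs hp hq hpq
  set n : ℝ := (Module.finrank ℝ E : ℝ) with hn'
  have hp0 : 0 < p := by linarith
  set w := q / p with hw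
  have hw0 : 0 < w := by positivity
  have hp1 : 1 / p < 1 := by rw [div_lt_one hp0]; exact hp
  have ha : 0 < q - w := by
    have : w = q * (1 / p) := by rw [hw]; ring
    nlinarith
  have haw : (q - w) / w = p - 1 := by rw [hw]; field_simp
  set a := q - w with ha'
  refine ⟨ENNReal.ofReal (q * κ⁻¹ * a⁻¹ * κ⁻¹ ^ (p - 1)), by simp; positivity,
    ENNReal.ofReal_ne_top, fun f hf hfp => ?_⟩
  have hmk : Measurable fun x : E => ‖x‖ₑ ^ (s - n) := by fun_prop
  set g : E → ℝ≥0∞ := fun x => ∫⁻ y, ‖x - y‖ₑ ^ (s - n) * f y ∂μ with hg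
  have mg : Measurable g := measurable_lintegral_conv hmk hf
  have cake : ∀ x, g x ^ q = ENNReal.ofReal q * ∫⁻ t in Set.Ioi (0 : ℝ),
      {t | ENNReal.ofReal t < g x}.indicator (fun t => ENNReal.ofReal (t ^ (q - 1))) t := by
    intro x
    rw [lintegral_Ioi_layer hq, ← mul_assoc, ← ENNReal.ofReal_mul hq.le, mul_inv_cancel₀ hq.ne',
      ENNReal.ofReal_one, one_mul]
  have mpow : ∀ b : ℝ, Measurable fun t : ℝ => ENNReal.ofReal (t ^ b) := fun b => by fun_prop
  calc ∫⁻ x, g x ^ q ∂μ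
      = ENNReal.ofReal q * ∫⁻ x, (∫⁻ t in Set.Ioi (0 : ℝ),
          {t | ENNReal.ofReal t < g x}.indicator (fun t => ENNReal.ofReal (t ^ (q - 1))) t) ∂μ := by
        simp_rw [cake]
        rw [lintegral_const_mul' _ _ ENNReal.ofReal_ne_top]
    _ = ENNReal.ofReal q * ∫⁻ t in Set.Ioi (0 : ℝ), ∫⁻ x, {t | ENNReal.ofReal t < g x}.indicator
          (fun t => ENNReal.ofReal (t ^ (q - 1))) t ∂μ := by
        rw [lintegral_lintegral_swap]
        have : Measurable ({z : E × ℝ | ENNReal.ofReal z.2 < g z.1}.indicator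
            fun z => ENNReal.ofReal (z.2 ^ (q - 1))) :=
          ((mpow (q - 1)).comp measurable_snd).indicator (measurableSet_lt
            (ENNReal.measurable_ofReal.comp measurable_snd) (mg.comp measurable_fst))
        exact this.aemeasurable
    _ ≤ ENNReal.ofReal q * ∫⁻ t in Set.Ioi (0 : ℝ), ∫⁻ x, ENNReal.ofReal κ⁻¹ *
          (ENNReal.ofReal (t ^ (a - 1)) *
            {x | ENNReal.ofReal (κ * t ^ w) < f x}.indicator f x) ∂μ := by
        gcongr ENNReal.ofReal q * ?_
        refine setLIntegral_mono' measurableSet_Ioi fun t (ht : 0 < t) => ?_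
        have e : (fun x => {t | ENNReal.ofReal t < g x}.indicator
            (fun t => ENNReal.ofReal (t ^ (q - 1))) t) =
            {x | ENNReal.ofReal t < g x}.indicator fun _ => ENNReal.ofReal (t ^ (q - 1)) := by
          ext x
          by_cases h : ENNReal.ofReal t < g x <;> simp [h]
        rw [e, lintegral_indicator_const (measurableSet_lt measurable_const mg),
          lintegral_const_mul' _ _ ENNReal.ofReal_ne_top,
          lintegral_const_mul' _ _ ENNReal.ofReal_ne_top]
        calc _ ≤ ENNReal.ofReal (t ^ (q - 1)) * (ENNReal.ofReal (κ * t ^ w)⁻¹ *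
                ∫⁻ x, {x | ENNReal.ofReal (κ * t ^ w) < f x}.indicator f x ∂μ) := by
              gcongr
              exact hdist f hf hfp t ht
          _ = _ := by
              rw [← mul_assoc, ← mul_assoc, ← ENNReal.ofReal_mul (by positivity),
                ← ENNReal.ofReal_mul (by positivity)]
              congr 2
              rw [mul_inv, ← Real.rpow_neg ht.le, mul_left_comm, ← Real.rpow_add ht, ha']
              congr 2
              ring
    _ = ENNReal.ofReal q * ∫⁻ x, (∫⁻ t in Set.Ioi (0 : ℝ), ENNReal.ofReal κ⁻¹ *
          (ENNReal.ofReal (t ^ (a - 1)) *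
            {x | ENNReal.ofReal (κ * t ^ w) < f x}.indicator f x)) ∂μ := by
        rw [lintegral_lintegral_swap]
        have : Measurable ({z : ℝ × E | ENNReal.ofReal (κ * z.1 ^ w) < f z.2}.indicator
            fun z => f z.2) :=
          (hf.comp measurable_snd).indicator (measurableSet_lt
            (Measurable.comp (g := fun t : ℝ => ENNReal.ofReal (κ * t ^ w)) (by fun_prop)
              measurable_fst) (hf.comp measurable_snd))
        exact ((((mpow (a - 1)).comp measurable_fst).mul this).const_mul _).aemeasurable
    _ = ENNReal.ofReal q * ∫⁻ x, ENNReal.ofReal κ⁻¹ * (ENNReal.ofReal a⁻¹ *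
          ENNReal.ofReal κ⁻¹ ^ (p - 1)) * f x ^ p ∂μ := by
        congr 1
        refine lintegral_congr fun x => ?_
        rw [lintegral_const_mul' _ _ ENNReal.ofReal_ne_top, mul_assoc]
        congr 1
        set b : ℝ≥0∞ := (ENNReal.ofReal κ⁻¹ * f x) ^ (1 / w) with hb
        have hiff : ∀ t : ℝ, 0 < t → (ENNReal.ofReal (κ * t ^ w) < f x ↔ ENNReal.ofReal t < b) := by
          intro t ht
          rw [hb, one_div, ENNReal.lt_rpow_inv_iff hw0, ENNReal.ofReal_rpow_of_pos ht,
            ENNReal.ofReal_mul hκ.le, ENNReal.ofReal_inv_of_pos hκ, mul_comm (_)⁻¹,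
            ← div_eq_mul_inv, ENNReal.lt_div_iff_mul_lt (by simp [hκ]) (by simp), mul_comm]
        have e : ∫⁻ t in Set.Ioi (0 : ℝ), (ENNReal.ofReal (t ^ (a - 1)) *
            {x | ENNReal.ofReal (κ * t ^ w) < f x}.indicator f x) =
            ∫⁻ t in Set.Ioi (0 : ℝ), {t | ENNReal.ofReal t < b}.indicator
              (fun t => ENNReal.ofReal (t ^ (a - 1))) t * f x := by
          refine setLIntegral_congr_fun measurableSet_Ioi fun t (ht : 0 < t) => ?_
          by_cases h : ENNReal.ofReal t < b
          · simp [h, (hiff t ht).2 h]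
          · simp [h, mt (hiff t ht).1 h]
        have mi : Measurable ({t | ENNReal.ofReal t < b}.indicator
            (fun t : ℝ => ENNReal.ofReal (t ^ (a - 1)))) :=
          (mpow (a - 1)).indicator (measurableSet_lt ENNReal.measurable_ofReal measurable_const)
        rw [e, lintegral_mul_const _ mi, lintegral_Ioi_layer ha, hb, ← ENNReal.rpow_mul,
          one_div_mul_eq_div, haw, ENNReal.mul_rpow_of_nonneg _ _ (by linarith)]
        have : f x ^ p = f x ^ (p - 1) * f x := by
          conv_rhs => rw [← ENNReal.rpow_one (f x), ← ENNReal.rpow_mul, one_mul]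
          rw [← ENNReal.rpow_add_of_nonneg _ _ (by linarith) zero_le_one, sub_add_cancel]
        rw [this]
        ring
    _ = _ := by
        rw [lintegral_const_mul _ (hf.pow_const p), ← mul_assoc]
        congr 1
        rw [ENNReal.ofReal_rpow_of_pos (by positivity), ← ENNReal.ofReal_mul (by positivity),
          ← ENNReal.ofReal_mul (by positivity), ← ENNReal.ofReal_mul (by positivity)]
        congr 1
        ring

/-- The Hardy–Littlewood–Sobolev inequality for nonnegative functions. -/
theorem hardy_littlewood_sobolev (hn : 0 < Module.finrank ℝ E) {s p q : ℝ} (hs : 0 < s)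
    (hp : 1 < p) (hq : 0 < q) (hpq : 1 / q = 1 / p - s / Module.finrank ℝ E) :
    ∃ C : ℝ≥0∞, C ≠ ∞ ∧ ∀ f : E → ℝ≥0∞, Measurable f →
      ∫⁻ x, (∫⁻ y, ‖x - y‖ₑ ^ (s - Module.finrank ℝ E) * f y ∂μ) ^ q ∂μ ≤
        (C * (∫⁻ x, f x ^ p ∂μ) ^ (1 / p)) ^ q := by
  obtain ⟨C, hC0, hC, hb⟩ := riesz_normalized_bound (μ := μ) hn hs hp hq hpq
  have hp0 : 0 < p := by linarith
  refine ⟨C ^ (1 / q), ENNReal.rpow_ne_top_of_nonneg (by positivity) hC, fun f hf => ?_⟩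
  set B := ∫⁻ x, f x ^ p ∂μ with hB
  rcases eq_or_ne B 0 with h0 | h0
  · have hf0 : f =ᵐ[μ] 0 := by
      have := (lintegral_eq_zero_iff (hf.pow_const p)).1 h0
      filter_upwards [this] with x hx
      simpa [hp0, hp0.le, not_lt.2 hp0.le] using hx
    have : ∀ x, ∫⁻ y, ‖x - y‖ₑ ^ (s - Module.finrank ℝ E) * f y ∂μ = 0 := by
      intro x
      have : ∫⁻ y, ‖x - y‖ₑ ^ (s - Module.finrank ℝ E) * f y ∂μ = ∫⁻ y, 0 ∂μ := by
        refine lintegral_congr_ae ?_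
        filter_upwards [hf0] with y hy
        rw [hy]; simp
      simpa using this
    simp [this, hq]
  rcases eq_or_ne B ∞ with h1 | h1
  · rw [h1, ENNReal.top_rpow_of_pos (by positivity), ENNReal.mul_top, ENNReal.top_rpow_of_pos hq]
    · exact le_top
    · simp [hC0, hC]
  have hB0 : B ^ (1 / p) ≠ 0 := by simp [h0, h1]
  have hB1 : B ^ (1 / p) ≠ ∞ := ENNReal.rpow_ne_top_of_nonneg (by positivity) h1
  -- rescaling `f` to norm one
  set D := (B ^ (1 / p))⁻¹ with hD
  have hDtop : D ≠ ∞ := ENNReal.inv_ne_top.2 hB0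
  have hDB : D ^ p * B = 1 := by
    rw [hD, ENNReal.inv_rpow, ← ENNReal.rpow_mul, one_div_mul_cancel hp0.ne', ENNReal.rpow_one,
      ENNReal.inv_mul_cancel h0 h1]
  have hn1 : ∫⁻ x, (D * f x) ^ p ∂μ = 1 := by
    simp_rw [ENNReal.mul_rpow_of_nonneg _ _ hp0.le]
    rw [lintegral_const_mul _ (hf.pow_const p), ← hB, hDB]
  have key := hb (fun x => D * f x) (hf.const_mul D) hn1.le
  rw [hn1, mul_one] at key
  have e : ∀ x, ∫⁻ y, ‖x - y‖ₑ ^ (s - Module.finrank ℝ E) * (D * f y) ∂μ =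
      D * ∫⁻ y, ‖x - y‖ₑ ^ (s - Module.finrank ℝ E) * f y ∂μ := by
    intro x
    rw [← lintegral_const_mul' _ _ hDtop]
    exact lintegral_congr fun y => by ring
  simp_rw [e, ENNReal.mul_rpow_of_nonneg _ _ hq.le] at key
  rw [lintegral_const_mul' _ _ (ENNReal.rpow_ne_top_of_nonneg hq.le hDtop)] at key
  rw [ENNReal.mul_rpow_of_nonneg _ _ hq.le, ← ENNReal.rpow_mul, one_div_mul_cancel hq.ne',
    ENNReal.rpow_one]
  have hDq : (B ^ (1 / p)) ^ q * D ^ q = 1 := by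
    rw [← ENNReal.mul_rpow_of_nonneg _ _ hq.le, hD, ENNReal.mul_inv_cancel hB0 hB1,
      ENNReal.one_rpow]
  calc _ = (B ^ (1 / p)) ^ q * (D ^ q *
        ∫⁻ x, (∫⁻ y, ‖x - y‖ₑ ^ (s - Module.finrank ℝ E) * f y ∂μ) ^ q ∂μ) := by
        rw [← mul_assoc, hDq, one_mul]
    _ ≤ (B ^ (1 / p)) ^ q * C := by gcongr
    _ = _ := mul_comm _ _

end Haar

/-! ### Dyadic kernels and operators dominated by them -/

theorem summable_two_rpow_neg_abs {δ : ℝ} (hδ : 0 < δ) :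
    Summable fun i : ℤ => (2 : ℝ) ^ (-(δ * |(i : ℝ)|)) := by
  have h : Summable fun n : ℕ => (2 : ℝ) ^ (-(δ * n)) := by
    have : (fun n : ℕ => (2 : ℝ) ^ (-(δ * n))) = fun n : ℕ => ((2 : ℝ) ^ (-δ)) ^ n := by
      ext n
      rw [← Real.rpow_natCast, ← Real.rpow_mul (by norm_num), neg_mul]
    rw [this]
    exact summable_geometric_of_lt_one (by positivity)
      (Real.rpow_lt_one_of_one_lt_of_neg one_lt_two (by linarith))
  refine Summable.of_nat_of_neg ?_ ?_ <;> simpa using h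

/-- A two-sided lacunary sum is comparable to its largest term, the one at the scale
`2 ^ k ≈ ρ⁻¹`: the terms decay geometrically on both sides of it. -/
theorem exists_tsum_lacunary_le {a N : ℝ} (ha : 0 < a) (haN : a < N) :
    ∃ C : ℝ≥0∞, C ≠ 0 ∧ C ≠ ∞ ∧ ∀ ρ : ℝ, 0 < ρ →
      ∑' k : ℤ, ENNReal.ofReal (2 ^ (a * k) * (1 + 2 ^ (k : ℝ) * ρ) ^ (-N)) ≤
        C * ENNReal.ofReal (ρ ^ (-a)) := by
  set δ := min a (N - a) with hδ
  have hδ0 : 0 < δ := lt_min ha (by linarith)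
  set S := ∑' i : ℤ, ENNReal.ofReal ((2 : ℝ) ^ (-(δ * |(i : ℝ)|))) with hS
  have hSt : S ≠ ∞ := (summable_two_rpow_neg_abs hδ0).tsum_ofReal_ne_top
  refine ⟨ENNReal.ofReal (2 ^ a) * (S + 1), by simp; positivity,
    ENNReal.mul_ne_top ENNReal.ofReal_ne_top (by simp [hSt]), fun ρ hρ => ?_⟩
  obtain ⟨m, hm1, hm2⟩ := exists_mem_Ico_zpow hρ one_lt_two
  rw [← Real.rpow_intCast] at hm1 hm2
  -- shift the index so that the scale `2 ^ k` is measured relative to `ρ⁻¹`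
  rw [← (Equiv.subRight m).tsum_eq]
  have hterm : ∀ i : ℤ, ENNReal.ofReal (2 ^ (a * ((Equiv.subRight m i : ℤ) : ℝ)) *
      (1 + 2 ^ ((Equiv.subRight m i : ℤ) : ℝ) * ρ) ^ (-N)) ≤
      ENNReal.ofReal (2 ^ a) * ENNReal.ofReal (ρ ^ (-a)) *
        ENNReal.ofReal ((2 : ℝ) ^ (-(δ * |(i : ℝ)|))) := by
    intro i
    rw [← ENNReal.ofReal_mul (by positivity), ← ENNReal.ofReal_mul (by positivity)]
    apply ENNReal.ofReal_le_ofReal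
    simp only [Equiv.subRight_apply, Int.cast_sub]
    have h1 : (2 : ℝ) ^ (-(a * m)) ≤ 2 ^ a * ρ ^ (-a) := by
      have : ((2 : ℝ) ^ (((m + 1 : ℤ) : ℝ))) ^ (-a) ≤ ρ ^ (-a) :=
        Real.rpow_le_rpow_of_nonpos hρ hm2.le (by linarith)
      rw [← Real.rpow_mul (by norm_num)] at this
      calc (2 : ℝ) ^ (-(a * m)) = 2 ^ a * 2 ^ (((m + 1 : ℤ) : ℝ) * -a) := by
            rw [← Real.rpow_add (by norm_num)]
            congr 1
            push_cast
            ring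
        _ ≤ _ := by gcongr
    have h2 : (2 : ℝ) ^ (i : ℝ) ≤ 2 ^ ((i : ℝ) - m) * ρ := by
      rw [Real.rpow_sub (by norm_num), div_mul_eq_mul_div, le_div_iff₀ (by positivity)]
      gcongr
    have h3 : (2 : ℝ) ^ (a * i) * (1 + 2 ^ ((i : ℝ) - m) * ρ) ^ (-N) ≤ 2 ^ (-(δ * |(i : ℝ)|)) := by
      have hN : 0 < N := by linarith
      rcases le_total 0 i with hi | hi
      · have hi' : (0 : ℝ) ≤ i := by exact_mod_cast hi
        have : (1 + 2 ^ ((i : ℝ) - m) * ρ) ^ (-N) ≤ ((2 : ℝ) ^ (i : ℝ)) ^ (-N) :=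
          Real.rpow_le_rpow_of_nonpos (by positivity) (by linarith) (by linarith)
        refine (mul_le_mul_of_nonneg_left this (by positivity)).trans ?_
        rw [← Real.rpow_mul (by norm_num), ← Real.rpow_add (by norm_num), abs_of_nonneg hi']
        apply Real.rpow_le_rpow_of_exponent_le one_le_two
        have : δ ≤ N - a := min_le_right _ _
        nlinarith
      · have hi' : (i : ℝ) ≤ 0 := by exact_mod_cast hi
        have hpos : 0 < 2 ^ ((i : ℝ) - m) * ρ := by positivity
        have : (1 + 2 ^ ((i : ℝ) - m) * ρ) ^ (-N) ≤ 1 :=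
          Real.rpow_le_one_of_one_le_of_nonpos (by linarith) (by linarith)
        refine (mul_le_mul_of_nonneg_left this (by positivity)).trans ?_
        rw [mul_one, abs_of_nonpos hi']
        apply Real.rpow_le_rpow_of_exponent_le one_le_two
        have : δ ≤ a := min_le_left _ _
        nlinarith
    calc (2 : ℝ) ^ (a * ((i : ℝ) - m)) * (1 + 2 ^ ((i : ℝ) - m) * ρ) ^ (-N)
        = 2 ^ (-(a * m)) * (2 ^ (a * i) * (1 + 2 ^ ((i : ℝ) - m) * ρ) ^ (-N)) := by
          rw [mul_sub, sub_eq_add_neg, Real.rpow_add (by norm_num)]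
          ring
      _ ≤ _ := by gcongr
  calc _ ≤ ∑' i : ℤ, ENNReal.ofReal (2 ^ a) * ENNReal.ofReal (ρ ^ (-a)) *
        ENNReal.ofReal ((2 : ℝ) ^ (-(δ * |(i : ℝ)|))) := ENNReal.tsum_le_tsum hterm
    _ = ENNReal.ofReal (2 ^ a) * ENNReal.ofReal (ρ ^ (-a)) * S := ENNReal.tsum_mul_left
    _ ≤ ENNReal.ofReal (2 ^ a) * ENNReal.ofReal (ρ ^ (-a)) * (S + 1) := by
        gcongr
        exact le_self_add
    _ = _ := by ring

theorem exists_tsum_lacunary_norm_le {F : Type*} [NormedAddCommGroup F] {a N : ℝ} (ha : 0 < a)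
    (haN : a < N) : ∃ C : ℝ≥0∞, C ≠ ∞ ∧ ∀ x : F,
      ∑' k : ℤ, ENNReal.ofReal (2 ^ (a * k) * (1 + 2 ^ (k : ℝ) * ‖x‖) ^ (-N)) ≤
        C * ‖x‖ₑ ^ (-a) := by
  obtain ⟨C, hC0, hC, h⟩ := exists_tsum_lacunary_le ha haN
  refine ⟨C, hC, fun x => ?_⟩
  rcases eq_or_ne x 0 with rfl | hx
  · rw [enorm_zero, ENNReal.zero_rpow_of_neg (by linarith), ENNReal.mul_top hC0]
    exact le_top
  · rw [enorm_rpow_eq_ofReal hx]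
    exact h _ (norm_pos_iff.2 hx)

/-- A superposition of dyadic dilates, normalized in `L¹` and with weights `2 ^ (-s|k|)`, of the
profile `(1 + ‖x‖) ^ (-N)`. -/
noncomputable def dyadicKernel (E : Type*) [NormedAddCommGroup E] [NormedSpace ℝ E]
    (s N : ℝ) (x : E) : ℝ≥0∞ :=
  ∑' k : ℤ, ENNReal.ofReal (2 ^ (-(s * |(k : ℝ)|)) * 2 ^ ((Module.finrank ℝ E : ℝ) * k) *
    (1 + 2 ^ (k : ℝ) * ‖x‖) ^ (-N))

theorem measurable_dyadicKernel {E : Type*} [NormedAddCommGroup E] [NormedSpace ℝ E]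
    [MeasurableSpace E] [BorelSpace E] (s N : ℝ) : Measurable (dyadicKernel E s N) := by
  unfold dyadicKernel
  refine Measurable.tsum fun k => ?_
  fun_prop

theorem exists_dyadicKernel_le {E : Type*} [NormedAddCommGroup E] [NormedSpace ℝ E]
    {s N : ℝ} (hs : 0 < s) (hsn : s < Module.finrank ℝ E)
    (hN : (Module.finrank ℝ E : ℝ) < N) : ∃ C : ℝ≥0∞, C ≠ ∞ ∧ ∀ x : E,
      dyadicKernel E s N x ≤ C * ‖x‖ₑ ^ (s - Module.finrank ℝ E) := by
  obtain ⟨C, hC, h⟩ := exists_tsum_lacunary_norm_le (F := E)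
    (a := (Module.finrank ℝ E : ℝ) - s) (N := N) (by linarith) (by linarith)
  refine ⟨C, hC, fun x => ?_⟩
  rw [← neg_sub (Module.finrank ℝ E : ℝ) s]
  refine le_trans (ENNReal.tsum_le_tsum fun k => ?_) (h x)
  apply ENNReal.ofReal_le_ofReal
  gcongr
  rw [← Real.rpow_add (by norm_num)]
  apply Real.rpow_le_rpow_of_exponent_le one_le_two
  have := neg_abs_le (k : ℝ)
  have := le_abs_self (k : ℝ)
  nlinarith

section Haar

variable {E : Type*} [NormedAddCommGroup E] [NormedSpace ℝ E] [FiniteDimensional ℝ E]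
  [MeasurableSpace E] [BorelSpace E] {μ : Measure E} [μ.IsAddHaarMeasure]

theorem lintegral_dyadicKernel_lt_top {s N : ℝ} (hs : 0 < s) (hN : (Module.finrank ℝ E : ℝ) < N) :
    ∫⁻ x, dyadicKernel E s N x ∂μ < ∞ := by
  unfold dyadicKernel
  rw [lintegral_tsum (fun k => Measurable.aemeasurable (by fun_prop))]
  have hI := finite_integral_one_add_norm (μ := μ) (E := E) hN
  have e : ∀ k : ℤ, ∫⁻ x : E, ENNReal.ofReal (2 ^ (-(s * |(k : ℝ)|)) *
      2 ^ ((Module.finrank ℝ E : ℝ) * k) * (1 + 2 ^ (k : ℝ) * ‖x‖) ^ (-N)) ∂μ =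
      ENNReal.ofReal (2 ^ (-(s * |(k : ℝ)|))) *
        ∫⁻ x : E, ENNReal.ofReal ((1 + ‖x‖) ^ (-N)) ∂μ := by
    intro k
    have h2 : (0 : ℝ) < 2 ^ (k : ℝ) := by positivity
    have h := lintegral_comp_pos_smul (μ := μ)
      (fun x : E => ENNReal.ofReal ((1 + ‖x‖) ^ (-N))) h2
    simp_rw [norm_smul, Real.norm_of_nonneg h2.le] at h
    simp_rw [ENNReal.ofReal_mul (p := 2 ^ (-(s * |(k : ℝ)|)) * 2 ^ ((Module.finrank ℝ E : ℝ) * k))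
      (show (0 : ℝ) ≤ 2 ^ (-(s * |(k : ℝ)|)) * 2 ^ ((Module.finrank ℝ E : ℝ) * k) by positivity)]
    rw [lintegral_const_mul' _ _ ENNReal.ofReal_ne_top, h, ← mul_assoc,
      ← ENNReal.ofReal_mul (by positivity), ← Real.rpow_mul (by norm_num), mul_assoc,
      ← Real.rpow_add (by norm_num)]
    congr 2
    rw [show (Module.finrank ℝ E : ℝ) * k + k * -(Module.finrank ℝ E : ℝ) = 0 by ring,
      Real.rpow_zero, mul_one]
  simp_rw [e]
  rw [ENNReal.tsum_mul_right]
  exact ENNReal.mul_lt_top (summable_two_rpow_neg_abs hs).tsum_ofReal_ne_top.lt_top hI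

/-- The Riesz bound gives integrability of `L ^ r` near the origin. Away from it `L` is bounded, and
integrability of `L` suffices. -/
theorem lintegral_rpow_lt_top_of_le_riesz (hn : 0 < Module.finrank ℝ E) {s r : ℝ}
    (hsn : s ≤ Module.finrank ℝ E) (hr : 1 ≤ r)
    (hrs : ((Module.finrank ℝ E : ℝ) - s) * r < Module.finrank ℝ E) {L : E → ℝ≥0∞}
    (hL : ∫⁻ x, L x ∂μ < ∞) {C : ℝ≥0∞} (hC : C ≠ ∞)
    (hLC : ∀ x, L x ≤ C * ‖x‖ₑ ^ (s - Module.finrank ℝ E)) :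
    ∫⁻ x, L x ^ r ∂μ < ∞ := by
  rw [← lintegral_add_compl _ (measurableSet_ball (x := (0 : E)) (ε := 1))]
  refine ENNReal.add_lt_top.2 ⟨?_, ?_⟩
  · calc _ ≤ ∫⁻ x in Metric.ball (0 : E) 1, C ^ r * ‖x‖ₑ ^ ((s - Module.finrank ℝ E) * r) ∂μ := by
          refine lintegral_mono fun x => ?_
          refine (ENNReal.rpow_le_rpow (hLC x) (by linarith)).trans ?_
          rw [ENNReal.mul_rpow_of_nonneg _ _ (by linarith), ← ENNReal.rpow_mul]
      _ < ∞ := by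
          have hCr : C ^ r ≠ ∞ := ENNReal.rpow_ne_top_of_nonneg (by linarith) hC
          rw [lintegral_const_mul' _ _ hCr]
          refine ENNReal.mul_lt_top hCr.lt_top (setLIntegral_ball_enorm_rpow_lt_top hn ?_)
          linarith
  · calc _ ≤ ∫⁻ x in (Metric.ball (0 : E) 1)ᶜ, C ^ (r - 1) * L x ∂μ := by
          refine setLIntegral_mono' measurableSet_ball.compl fun x hx => ?_
          have hx1 : 1 ≤ ‖x‖ := by simpa using hx
          have hLx : L x ≤ C := by
            refine (hLC x).trans (mul_le_of_le_one_right' ?_)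
            rw [enorm_rpow_eq_ofReal (norm_pos_iff.1 (by linarith)), ENNReal.ofReal_le_one]
            exact Real.rpow_le_one_of_one_le_of_nonpos hx1 (by linarith)
          calc L x ^ r = L x ^ (r - 1) * L x ^ (1 : ℝ) := by
                rw [← ENNReal.rpow_add_of_nonneg _ _ (by linarith) zero_le_one, sub_add_cancel]
            _ ≤ C ^ (r - 1) * L x := by
                rw [ENNReal.rpow_one]
                gcongr
      _ < ∞ := by
          have hCr : C ^ (r - 1) ≠ ∞ := ENNReal.rpow_ne_top_of_nonneg (by linarith) hC
          rw [lintegral_const_mul' _ _ hCr]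
          exact ENNReal.mul_lt_top hCr.lt_top ((setLIntegral_le_lintegral _ _).trans_lt hL)

theorem inv_toReal_eq_one_div (p : ℝ≥0∞) : p⁻¹.toReal = 1 / p.toReal := by
  rw [ENNReal.toReal_inv, one_div]

/-- An operator dominated by convolution with an integrable kernel that is at most a multiple of the
Riesz kernel `‖x‖ ^ (s - n)` is bounded from `Lᵖ` to `L^q` in the range
`0 ≤ 1/p - 1/q ≤ s/n`, except at the two endpoints on the line `1/p - 1/q = s/n`. -/
theorem exists_eLpNorm_le_of_le_riesz (hn : 0 < Module.finrank ℝ E) {s : ℝ} (hs : 0 < s)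
    (hsn : s ≤ Module.finrank ℝ E) {L : E → ℝ≥0∞} (hLm : Measurable L)
    (hL : ∫⁻ x, L x ∂μ < ∞) {C : ℝ≥0∞} (hC : C ≠ ∞)
    (hLC : ∀ x, L x ≤ C * ‖x‖ₑ ^ (s - Module.finrank ℝ E)) {p q : ℝ≥0∞} (hp : 1 ≤ p) (hq : 1 ≤ q)
    (hqp : q⁻¹.toReal ≤ p⁻¹.toReal)
    (hpq : p⁻¹.toReal - q⁻¹.toReal ≤ s / Module.finrank ℝ E)
    (hend : p⁻¹.toReal - q⁻¹.toReal = s / Module.finrank ℝ E → 1 < p ∧ q ≠ ∞) :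
    ∃ D : ℝ≥0, ∀ f g : E → ℂ, Measurable f →
      (∀ x, ‖g x‖ₑ ≤ ∫⁻ y, L (x - y) * ‖f y‖ₑ ∂μ) →
      eLpNorm g q μ ≤ D * eLpNorm f p μ := by
  set n : ℝ := (Module.finrank ℝ E : ℝ) with hn'
  have hn0 : 0 < n := by rw [hn']; exact_mod_cast hn
  suffices H : ∃ D : ℝ≥0∞, D ≠ ∞ ∧ ∀ f g : E → ℂ, Measurable f →
      (∀ x, ‖g x‖ₑ ≤ ∫⁻ y, L (x - y) * ‖f y‖ₑ ∂μ) → eLpNorm g q μ ≤ D * eLpNorm f p μ by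
    obtain ⟨D, hD, h⟩ := H
    lift D to ℝ≥0 using hD
    exact ⟨D, h⟩
  have hp0 : p ≠ 0 := (zero_lt_one.trans_le hp).ne'
  have hq0 : q ≠ 0 := (zero_lt_one.trans_le hq).ne'
  rcases eq_or_ne p ∞ with rfl | hpt
  · have hqt : q = ∞ := by
      have h0 : q⁻¹.toReal = 0 := le_antisymm (by simpa using hqp) ENNReal.toReal_nonneg
      rcases (ENNReal.toReal_eq_zero_iff _).1 h0 with h | h
      · exact ENNReal.inv_eq_zero.1 h
      · exact absurd (ENNReal.inv_eq_top.1 h) hq0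
    subst hqt
    refine ⟨∫⁻ x, L x ∂μ, hL.ne, fun f g hf hg => ?_⟩
    rw [eLpNorm_exponent_top, eLpNorm_exponent_top]
    refine eLpNormEssSup_le_of_ae_enorm_bound (Filter.Eventually.of_forall fun x => ?_)
    refine (hg x).trans ?_
    rw [← lintegral_sub_left_eq_self L x,
      ← lintegral_mul_const (f := fun y => L (x - y)) _ (hLm.comp (measurable_id.const_sub x))]
    refine lintegral_mono_ae ?_
    filter_upwards [enorm_ae_le_eLpNormEssSup f μ] with y hy
    gcongr
  have hpr : 1 ≤ p.toReal := by
    rw [← ENNReal.toReal_one]; exact ENNReal.toReal_mono hpt hp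
  have hpr0 : 0 < p.toReal := by linarith
  rw [inv_toReal_eq_one_div, inv_toReal_eq_one_div] at hqp hpq hend
  have hp1 : 1 / p.toReal ≤ 1 := by rw [div_le_one hpr0]; exact hpr
  have hq1 : 0 ≤ 1 / q.toReal := by positivity
  -- the exponent for which Young's inequality applies, when it is below the critical one
  have young : 1 / p.toReal - 1 / q.toReal < s / n →
      ∃ r : ℝ, 1 ≤ r ∧ r * (1 - 1 / p.toReal + 1 / q.toReal) = 1 ∧ ∫⁻ x, L x ^ r ∂μ < ∞ := by
    intro hlt
    have hlt' : n * (1 / p.toReal - 1 / q.toReal) < s := by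
      rwa [lt_div_iff₀ hn0, mul_comm] at hlt
    have hpos : 0 < 1 - 1 / p.toReal + 1 / q.toReal := by
      by_contra! hle
      nlinarith
    refine ⟨(1 - 1 / p.toReal + 1 / q.toReal)⁻¹, (one_le_inv₀ hpos).2 (by linarith),
      inv_mul_cancel₀ hpos.ne', ?_⟩
    refine lintegral_rpow_lt_top_of_le_riesz hn hsn ((one_le_inv₀ hpos).2 (by linarith)) ?_ hL hC
      hLC
    rw [← hn', ← div_eq_mul_inv, div_lt_iff₀ hpos]
    linarith
  rcases eq_or_ne q ∞ with rfl | hqt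
  · obtain ⟨r, hr1, hr, hLr⟩ := young (lt_of_le_of_ne hpq fun h => (hend h).2 rfl)
    refine ⟨(∫⁻ x, L x ^ r ∂μ) ^ (1 - 1 / p.toReal),
      ENNReal.rpow_ne_top_of_nonneg (by linarith) hLr.ne, fun f g hf hg => ?_⟩
    rw [eLpNorm_exponent_top, eLpNorm_eq_lintegral_rpow_enorm_toReal hp0 hpt]
    refine eLpNormEssSup_le_of_ae_enorm_bound (Filter.Eventually.of_forall fun x => ?_)
    refine (hg x).trans ?_
    have h := lintegral_conv_le_holder (μ := μ) hLm hf.enorm (a := 1 / p.toReal) (b := 0)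
      (p := p.toReal) (r := r) le_rfl (by positivity) hp1 (by field_simp) (by simpa using hr) x
    simpa using h
  have hqr : 1 ≤ q.toReal := by
    rw [← ENNReal.toReal_one]; exact ENNReal.toReal_mono hqt hq
  have hqr0 : 0 < q.toReal := by linarith
  have reduce : ∀ D : ℝ≥0∞, ∀ f g : E → ℂ,
      (∀ x, ‖g x‖ₑ ≤ ∫⁻ y, L (x - y) * ‖f y‖ₑ ∂μ) →
      ∫⁻ x, (∫⁻ y, L (x - y) * ‖f y‖ₑ ∂μ) ^ q.toReal ∂μ ≤
        (D * (∫⁻ x, ‖f x‖ₑ ^ p.toReal ∂μ) ^ (1 / p.toReal)) ^ q.toReal →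
      eLpNorm g q μ ≤ D * eLpNorm f p μ := by
    intro D f g hg h
    rw [eLpNorm_eq_lintegral_rpow_enorm_toReal hp0 hpt,
      eLpNorm_eq_lintegral_rpow_enorm_toReal hq0 hqt, one_div q.toReal,
      ENNReal.rpow_inv_le_iff hqr0]
    exact (lintegral_mono fun x => ENNReal.rpow_le_rpow (hg x) hqr0.le).trans h
  rcases hpq.lt_or_eq with hlt | heq
  · obtain ⟨r, hr1, hr, hLr⟩ := young hlt
    refine ⟨(∫⁻ x, L x ^ r ∂μ) ^ (1 / r),
      ENNReal.rpow_ne_top_of_nonneg (by positivity) hLr.ne, fun f g hf hg => reduce _ f g hg ?_⟩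
    exact lintegral_conv_rpow_le hLm hf.enorm hpr ((one_div_le_one_div hqr0 hpr0).1 hqp) hr
  · have hp1' : 1 < p.toReal := by
      rw [← ENNReal.toReal_one]
      exact (ENNReal.toReal_lt_toReal ENNReal.one_ne_top hpt).2 (hend heq).1
    obtain ⟨D, hD, hb⟩ := hardy_littlewood_sobolev (μ := μ) hn hs hp1' hqr0
      (by rw [← hn', ← heq]; ring)
    refine ⟨C * D, ENNReal.mul_ne_top hC hD, fun f g hf hg => reduce _ f g hg ?_⟩
    have h := hb (fun x => ‖f x‖ₑ) hf.enorm
    calc _ ≤ ∫⁻ x, (C * ∫⁻ y, ‖x - y‖ₑ ^ (s - n) * ‖f y‖ₑ ∂μ) ^ q.toReal ∂μ := by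
          gcongr with x
          rw [← lintegral_const_mul' _ _ hC]
          refine lintegral_mono fun y => ?_
          rw [← mul_assoc]
          gcongr
          exact hLC _
      _ ≤ _ := by
          simp_rw [ENNReal.mul_rpow_of_nonneg _ _ hqr0.le, mul_assoc]
          rw [lintegral_const_mul' _ _ (ENNReal.rpow_ne_top_of_nonneg hqr0.le hC)]
          rw [ENNReal.mul_rpow_of_nonneg _ _ hqr0.le] at h
          gcongr

end Haar

/-! ### Fourier transforms of rescaled functions -/

section Fourier

open scoped ContDiff

variable {V : Type*} [NormedAddCommGroup V] [InnerProductSpace ℝ V] [FiniteDimensional ℝ V]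
  [MeasurableSpace V] [BorelSpace V]

theorem continuous_fourier_of_integrable {F : V → ℂ} (hF : Integrable F) : Continuous (𝓕 F) :=
  VectorFourier.fourierIntegral_continuous Real.continuous_fourierChar
    (by exact continuous_inner) hF

theorem fourier_const_mul (c : ℂ) (F : V → ℂ) (x : V) :
    𝓕 (fun ξ => c * F ξ) x = c * 𝓕 F x := by
  rw [Real.fourier_eq, Real.fourier_eq, ← integral_const_mul]
  refine integral_congr_ae (Filter.Eventually.of_forall fun v => ?_)
  simp only [Circle.smul_def, smul_eq_mul]
  ring

theorem fourier_add_apply {F G : V → ℂ} (hF : Integrable F) (hG : Integrable G) (x : V) :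
    𝓕 (fun ξ => F ξ + G ξ) x = 𝓕 F x + 𝓕 G x := by
  simp only [Real.fourier_eq, smul_add]
  exact integral_add ((Real.fourierIntegral_convergent_iff x).2 hF)
    ((Real.fourierIntegral_convergent_iff x).2 hG)

theorem fourier_finset_sum_apply {ι : Type*} (s : Finset ι) {F : ι → V → ℂ}
    (hF : ∀ i ∈ s, Integrable (F i)) (x : V) :
    𝓕 (fun ξ => ∑ i ∈ s, F i ξ) x = ∑ i ∈ s, 𝓕 (F i) x := by
  simp only [Real.fourier_eq, Finset.smul_sum]
  exact integral_finsetSum s fun i hi => (Real.fourierIntegral_convergent_iff x).2 (hF i hi)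

theorem fourier_comp_pos_smul (F : V → ℂ) {a : ℝ} (ha : 0 < a) (x : V) :
    𝓕 (fun ξ => F (a • ξ)) x =
      (a ^ (-(Module.finrank ℝ V : ℝ)) : ℝ) * 𝓕 F (a⁻¹ • x) := by
  have h := Measure.integral_comp_smul (volume : Measure V)
    (fun v => Real.fourierChar (-inner ℝ v (a⁻¹ • x)) • F v) a
  rw [Real.fourier_eq, Real.fourier_eq, ← Complex.real_smul, Real.rpow_neg ha.le,
    Real.rpow_natCast, ← abs_of_pos (inv_pos.2 (pow_pos ha _)), ← h]
  simp only [inner_smul_left, inner_smul_right]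
  congr 1
  ext v
  congr 3
  simp
  field_simp

/-- A Fourier multiplier with integrable symbol `S` is a convolution with kernel `x ↦ 𝓕 S (-x)`. -/
theorem fourierInv_mul_fourier_eq {S f : V → ℂ} (hS : Integrable S) (hf : Integrable f) (x : V) :
    𝓕⁻ (fun ξ => S ξ * 𝓕 f ξ) x = ∫ y, f y * 𝓕 S (y - x) := by
  set g : V → ℂ := fun ξ => (Real.fourierChar (inner ℝ ξ x) : ℂ) * S ξ with hg
  have hgi : Integrable g := by
    have := (Real.fourierIntegral_convergent_iff (μ := volume) (f := S) (-x)).2 hS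
    simpa [hg, Circle.smul_def] using this
  have h := VectorFourier.integral_fourierIntegral_smul_eq_flip (μ := volume) (ν := volume)
    (L := innerₗ V) (f := f) (g := g) Real.continuous_fourierChar
    (by exact continuous_inner) hf hgi
  rw [flip_innerₗ] at h
  rw [Real.fourierInv_eq]
  calc _ = ∫ ξ, VectorFourier.fourierIntegral Real.fourierChar volume (innerₗ V) f ξ • g ξ := by
        refine integral_congr_ae (Filter.Eventually.of_forall fun ξ => ?_)
        simp only [hg, Circle.smul_def, smul_eq_mul]
        change _ * (S ξ * VectorFourier.fourierIntegral Real.fourierChar volume (innerₗ V) f ξ) = _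
        ring
    _ = _ := by
        rw [h]
        refine integral_congr_ae (Filter.Eventually.of_forall fun y => ?_)
        simp only [smul_eq_mul]
        congr 1
        change 𝓕 g y = _
        rw [Real.fourier_eq, Real.fourier_eq]
        refine integral_congr_ae (Filter.Eventually.of_forall fun ξ => ?_)
        simp only [hg, Circle.smul_def, smul_eq_mul]
        rw [← mul_assoc, ← Circle.coe_mul, ← AddChar.map_add_eq_mul, inner_sub_right]
        congr 3
        ring

theorem integral_fourierInv_mul_eq_flip {u w : V → ℂ} (hu : Integrable u) (hw : Integrable w) :
    ∫ x, 𝓕⁻ u x * w x = ∫ ξ, u ξ * 𝓕⁻ w ξ := by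
  have h := VectorFourier.integral_fourierIntegral_smul_eq_flip (μ := volume) (ν := volume)
    (L := -innerₗ V) (f := u) (g := w) Real.continuous_fourierChar
    (by exact (continuous_inner (𝕜 := ℝ) (E := V)).neg) hu hw
  have e : (-innerₗ V).flip = -innerₗ V := by
    ext x y
    simp [real_inner_comm]
  rw [e] at h
  exact h

/-- Rapid decay of the Fourier transforms of the slices of a smooth function, uniformly in a
compact parameter range. -/
theorem exists_fourier_decay {Φ : ℝ × V → ℂ} (hΦ : ContDiff ℝ ∞ Φ) {R : ℝ}
    (hR : ∀ τ η, R < ‖η‖ → Φ (τ, η) = 0) (N : ℕ) :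
    ∃ C : ℝ, 0 ≤ C ∧ ∀ τ ∈ Set.Icc (0 : ℝ) 1, ∀ x : V,
      ‖𝓕 (fun η => Φ (τ, η)) x‖ ≤ C * (1 + ‖x‖) ^ (-(N : ℝ)) := by
  have hcomp : ∀ τ, (fun η => Φ (τ, η)) =
      (fun v => Φ (v + (τ, 0))) ∘ ContinuousLinearMap.inr ℝ ℝ V := by
    intro τ; ext η; simp
  have hsm : ∀ τ, ContDiff ℝ ∞ fun η => Φ (τ, η) := fun τ => hΦ.comp (by fun_prop)
  have hts : ∀ τ, tsupport (fun η => Φ (τ, η)) ⊆ Metric.closedBall 0 R := by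
    intro τ
    refine closure_minimal (fun η hη => ?_) Metric.isClosed_closedBall
    rw [mem_closedBall_zero_iff]
    by_contra! h
    exact hη (hR τ η h)
  have hcs : ∀ τ, HasCompactSupport fun η => Φ (τ, η) := fun τ =>
    HasCompactSupport.of_support_subset_isCompact (isCompact_closedBall 0 R)
      ((subset_tsupport _).trans (hts τ))
  -- derivatives of the slices are bounded uniformly in the parameter
  have hder : ∀ n : ℕ, ∃ B : ℝ, 0 ≤ B ∧ ∀ τ ∈ Set.Icc (0 : ℝ) 1, ∀ η : V,
      ‖iteratedFDeriv ℝ n (fun η => Φ (τ, η)) η‖ ≤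
        (Metric.closedBall (0 : V) R).indicator (fun _ => B) η := by
    intro n
    obtain ⟨B, hB⟩ := ((isCompact_Icc (a := (0 : ℝ)) (b := 1)).prod
      (isCompact_closedBall (0 : V) R)).exists_bound_of_continuousOn
      (hΦ.continuous_iteratedFDeriv (m := n) (by exact_mod_cast le_top)).continuousOn
    refine ⟨max B 0, le_max_right _ _, fun τ hτ η => ?_⟩
    by_cases hη : η ∈ Metric.closedBall (0 : V) R
    · have hΦτ : ContDiff ℝ ∞ fun v : ℝ × V => Φ (v + (τ, 0)) := hΦ.comp (by fun_prop)
      rw [Set.indicator_of_mem hη, hcomp τ, ContinuousLinearMap.iteratedFDeriv_comp_right _ hΦτ _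
        (by exact_mod_cast le_top)]
      refine (ContinuousMultilinearMap.norm_compContinuousLinearMap_le _ _).trans ?_
      rw [iteratedFDeriv_comp_add_right]
      have h1 : ∏ _i : Fin n, ‖ContinuousLinearMap.inr ℝ ℝ V‖ ≤ 1 :=
        Finset.prod_le_one (fun _ _ => norm_nonneg (ContinuousLinearMap.inr ℝ ℝ V))
          fun _ _ => ContinuousLinearMap.norm_inr_le_one ℝ ℝ V
      have h2 := hB (τ, η) ⟨hτ, hη⟩
      have h3 : (ContinuousLinearMap.inr ℝ ℝ V) η + (τ, 0) = (τ, η) := by simp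
      rw [h3]
      calc _ ≤ B * 1 := mul_le_mul h2 h1 (by positivity) ((norm_nonneg _).trans h2)
        _ ≤ _ := by rw [mul_one]; exact le_max_left _ _
    · rw [Set.indicator_of_notMem hη]
      have : η ∉ Function.support (iteratedFDeriv ℝ n fun η => Φ (τ, η)) := fun h =>
        hη (hts τ (support_iteratedFDeriv_subset n h))
      rw [Function.notMem_support.1 this, norm_zero]
  choose B hB0 hB using hder
  set v := (volume : Measure V).real (Metric.closedBall 0 R) with hv
  set D : ℕ → ℝ := fun n => 2 ^ n * ∑ i ∈ Finset.range (n + 1), v * B i with hD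
  have hDn : ∀ n, 0 ≤ D n := fun n => mul_nonneg (by positivity)
    (Finset.sum_nonneg fun i _ => mul_nonneg measureReal_nonneg (hB0 i))
  have key : ∀ n : ℕ, ∀ τ ∈ Set.Icc (0 : ℝ) 1, ∀ x : V,
      ‖x‖ ^ n * ‖𝓕 (fun η => Φ (τ, η)) x‖ ≤ D n := by
    intro n τ hτ x
    have h := Real.pow_mul_norm_iteratedFDeriv_fourier_le (f := fun η => Φ (τ, η)) (K := ⊤) (N := ⊤)
      (hsm τ) (fun k m _ _ =>
        ((by fun_prop : Continuous fun v : V => ‖v‖ ^ k).mul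
          ((hsm τ).continuous_iteratedFDeriv (m := m)
            (by exact_mod_cast le_top)).norm).integrable_of_hasCompactSupport
          (((hcs τ).iteratedFDeriv m).norm.mul_left)) (k := 0) (n := n) le_top le_top x
    rw [norm_iteratedFDeriv_zero] at h
    refine h.trans ?_
    simp only [pow_zero, one_mul, Nat.cast_zero, mul_zero, zero_add, Finset.range_one,
      Finset.singleton_product, Finset.sum_map, Function.Embedding.coeFn_mk, hD]
    gcongr with i hi
    calc ∫ η, ‖iteratedFDeriv ℝ i (fun η => Φ (τ, η)) η‖
        ≤ ∫ η, (Metric.closedBall (0 : V) R).indicator (fun _ => B i) η := by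
          refine integral_mono_of_nonneg (Filter.Eventually.of_forall fun _ => norm_nonneg _) ?_
            (Filter.Eventually.of_forall fun η => hB i τ hτ η)
          exact (integrable_indicator_iff Metric.isClosed_closedBall.measurableSet).2
            (integrableOn_const (isCompact_closedBall (0 : V) R).measure_lt_top.ne)
      _ = v * B i := by
          rw [integral_indicator Metric.isClosed_closedBall.measurableSet, setIntegral_const,
            smul_eq_mul]
  refine ⟨2 ^ (N - 1) * (D 0 + D N), by have := hDn 0; have := hDn N; positivity,
    fun τ hτ x => ?_⟩
  rw [Real.rpow_neg (by positivity), ← div_eq_mul_inv, le_div_iff₀ (by positivity),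
    Real.rpow_natCast]
  have h0 := key 0 τ hτ x
  have hN := key N τ hτ x
  rw [pow_zero, one_mul] at h0
  calc _ ≤ ‖𝓕 (fun η => Φ (τ, η)) x‖ * (2 ^ (N - 1) * (1 ^ N + ‖x‖ ^ N)) := by
        gcongr
        exact add_pow_le zero_le_one (norm_nonneg x) N
    _ = 2 ^ (N - 1) * (‖𝓕 (fun η => Φ (τ, η)) x‖ + ‖x‖ ^ N * ‖𝓕 (fun η => Φ (τ, η)) x‖) := by
        rw [one_pow]; ring
    _ ≤ _ := by gcongr

end Fourier

/-! ### The resolvent symbol and its dyadic decomposition -/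

/-- The distance of `z` to the half line gives a lower bound that is homogeneous in `(a, b)`, and so
valid up to `b = 0`. -/
theorem exists_norm_sub_ge {z : ℂ} (hz : z ∉ (fun t : ℝ => (t : ℂ)) '' Set.Ici (0 : ℝ)) :
    ∃ κ : ℝ, 0 < κ ∧ ∀ a b : ℝ, 0 ≤ a → 0 ≤ b → κ * (a + b) ≤ ‖(a : ℂ) - b * z‖ := by
  have hcl : IsClosed ((fun t : ℝ => (t : ℂ)) '' Set.Ici (0 : ℝ)) :=
    Complex.isometry_ofReal.isClosedEmbedding.isClosedMap _ isClosed_Ici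
  obtain ⟨δ, hδ, hball⟩ := Metric.isOpen_iff.1 hcl.isOpen_compl z hz
  have hdist : ∀ t : ℝ, 0 ≤ t → δ ≤ ‖(t : ℂ) - z‖ := by
    intro t ht
    by_contra! h
    exact hball (by rwa [mem_ball_iff_norm]) ⟨t, ht, rfl⟩
  have hone : ∀ t : ℝ, 0 ≤ t → δ / (1 + ‖z‖ + δ) * (t + 1) ≤ ‖(t : ℂ) - z‖ := by
    intro t ht
    have h1 := hdist t ht
    have h2 : t - ‖z‖ ≤ ‖(t : ℂ) - z‖ := by
      have := norm_sub_norm_le (t : ℂ) z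
      rwa [Complex.norm_real, Real.norm_of_nonneg ht] at this
    have hz0 := norm_nonneg z
    rw [div_mul_eq_mul_div, div_le_iff₀ (by positivity)]
    nlinarith
  refine ⟨min (δ / (1 + ‖z‖ + δ)) 1, by positivity, fun a b ha hb => ?_⟩
  rcases hb.eq_or_lt with rfl | hb
  · simp only [add_zero, Complex.ofReal_zero, zero_mul, sub_zero, Complex.norm_real,
      Real.norm_of_nonneg ha]
    exact mul_le_of_le_one_left ha (min_le_right _ _)
  · have h := hone (a / b) (by positivity)
    have e : (a : ℂ) - b * z = b * (((a / b : ℝ) : ℂ) - z) := by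
      push_cast
      field_simp [hb.ne']
    rw [e, norm_mul, Complex.norm_real, Real.norm_of_nonneg hb.le]
    calc _ ≤ δ / (1 + ‖z‖ + δ) * (a + b) := by gcongr; exact min_le_left _ _
      _ = b * (δ / (1 + ‖z‖ + δ) * (a / b + 1)) := by field_simp
      _ ≤ _ := by gcongr

theorem ofReal_sub_mul_ne_zero {z : ℂ} (hz : z ∉ (fun t : ℝ => (t : ℂ)) '' Set.Ici (0 : ℝ))
    {a b : ℝ} (ha : 0 ≤ a) (hb : 0 ≤ b) (hab : 0 < a + b) : (a : ℂ) - b * z ≠ 0 := by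
  obtain ⟨κ, hκ, h⟩ := exists_norm_sub_ge hz
  exact norm_pos_iff.1 ((mul_pos hκ hab).trans_le (h a b ha hb))

/-- The symbol of the resolvent of the fractional Laplacian in the frequency normalization of `𝓕`,
that is, `(|2πξ|^s - z)⁻¹`. -/
noncomputable def resolventSymbol {V : Type*} [NormedAddCommGroup V] (s : ℝ) (z : ℂ) (ξ : V) : ℂ :=
  ((((2 * Real.pi) ^ s * ‖ξ‖ ^ s : ℝ) : ℂ) - z)⁻¹

theorem norm_resolventSymbol_le {V : Type*} [NormedAddCommGroup V] {s : ℝ} {z : ℂ}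
    (hz : z ∉ (fun t : ℝ => (t : ℂ)) '' Set.Ici (0 : ℝ)) :
    ∃ B : ℝ, ∀ ξ : V, ‖resolventSymbol s z ξ‖ ≤ B := by
  obtain ⟨κ, hκ, h⟩ := exists_norm_sub_ge hz
  refine ⟨κ⁻¹, fun ξ => ?_⟩
  rw [resolventSymbol, norm_inv]
  refine inv_anti₀ hκ ?_
  have := h ((2 * Real.pi) ^ s * ‖ξ‖ ^ s) 1 (by positivity) zero_le_one
  rw [Complex.ofReal_one, one_mul] at this
  refine le_trans ?_ this
  have : 0 ≤ (2 * Real.pi) ^ s * ‖ξ‖ ^ s := by positivity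
  nlinarith

theorem continuous_resolventSymbol {V : Type*} [NormedAddCommGroup V] {s : ℝ} {z : ℂ} (hs : 0 < s)
    (hz : z ∉ (fun t : ℝ => (t : ℂ)) '' Set.Ici (0 : ℝ)) :
    Continuous (resolventSymbol s z : V → ℂ) := by
  unfold resolventSymbol
  refine Continuous.inv₀ ?_ fun ξ => ?_
  · have : Continuous fun ξ : V => ‖ξ‖ ^ s := continuous_norm.rpow_const fun _ => Or.inr hs.le
    fun_prop
  · have := ofReal_sub_mul_ne_zero hz (a := (2 * Real.pi) ^ s * ‖ξ‖ ^ s) (b := 1)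
      (by positivity) zero_le_one (by positivity)
    rwa [Complex.ofReal_one, one_mul] at this

section Symbol

open scoped ContDiff

variable {V : Type*} [NormedAddCommGroup V] [InnerProductSpace ℝ V]

/-- A smooth cutoff equal to `1` on the unit ball and vanishing outside the ball of radius `2`. -/
noncomputable def lowCutoff (V : Type*) [NormedAddCommGroup V] [InnerProductSpace ℝ V] :
    ContDiffBump (0 : V) where
  rIn := 1
  rOut := 2
  rIn_pos := one_pos
  rIn_lt_rOut := one_lt_two

/-- The Littlewood–Paley cutoff to the annulus `1/2 ≤ |ξ| ≤ 2`. -/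
noncomputable def annulusCutoff (ξ : V) : ℝ := lowCutoff V ξ - lowCutoff V ((2 : ℝ) • ξ)

theorem lowCutoff_eq_one {ξ : V} (h : ‖ξ‖ ≤ 1) : lowCutoff V ξ = 1 :=
  (lowCutoff V).one_of_mem_closedBall (by rw [mem_closedBall_zero_iff]; exact h)

theorem lowCutoff_eq_zero {ξ : V} (h : 2 ≤ ‖ξ‖) : lowCutoff V ξ = 0 :=
  (lowCutoff V).zero_of_le_dist (by rw [dist_zero_right]; exact h)

theorem annulusCutoff_eq_zero_of_le {ξ : V} (h : ‖ξ‖ ≤ 1 / 2) : annulusCutoff ξ = 0 := by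
  rw [annulusCutoff, lowCutoff_eq_one (by linarith), lowCutoff_eq_one, sub_self]
  rw [norm_smul, Real.norm_of_nonneg zero_le_two]
  linarith

theorem annulusCutoff_eq_zero_of_ge {ξ : V} (h : 2 ≤ ‖ξ‖) : annulusCutoff ξ = 0 := by
  rw [annulusCutoff, lowCutoff_eq_zero h, lowCutoff_eq_zero, sub_self]
  rw [norm_smul, Real.norm_of_nonneg zero_le_two]
  linarith

theorem contDiff_annulusCutoff : ContDiff ℝ ∞ (annulusCutoff : V → ℝ) :=
  (lowCutoff V).contDiff.sub ((lowCutoff V).contDiff.comp (contDiff_const_smul _))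

/-- Cutting off to the annulus removes a singularity at the origin. -/
theorem contDiff_annulusCutoff_mul {H : ℝ × V → ℂ}
    (hH : ∀ τ η, η ≠ 0 → ContDiffAt ℝ ∞ H (τ, η)) :
    ContDiff ℝ ∞ fun p : ℝ × V => (annulusCutoff p.2 : ℂ) * H p := by
  rw [contDiff_iff_contDiffAt]
  rintro ⟨τ, η⟩
  rcases eq_or_ne η 0 with rfl | hη
  · refine (contDiffAt_const (c := (0 : ℂ))).congr_of_eventuallyEq ?_
    have hnhds : ∀ᶠ p : ℝ × V in nhds (τ, 0), ‖p.2‖ < 1 / 2 := by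
      have hc : ContinuousAt (fun p : ℝ × V => ‖p.2‖) (τ, 0) := by fun_prop
      exact hc.eventually_lt continuousAt_const (by simp)
    filter_upwards [hnhds] with p hp
    rw [annulusCutoff_eq_zero_of_le hp.le, Complex.ofReal_zero, zero_mul]
  · have h1 : ContDiff ℝ ∞ fun p : ℝ × V => (annulusCutoff p.2 : ℂ) :=
      Complex.ofRealCLM.contDiff.comp (contDiff_annulusCutoff.comp contDiff_snd)
    exact h1.contDiffAt.mul (hH τ η hη)

theorem contDiffAt_norm_rpow_snd (s c : ℝ) (τ : ℝ) {η : V} (hη : η ≠ 0) :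
    ContDiffAt ℝ ∞ (fun p : ℝ × V => (c * ‖p.2‖ ^ s : ℝ)) (τ, η) :=
  contDiffAt_const.mul
    ((ContDiffAt.norm ℝ contDiffAt_snd hη).rpow_const_of_ne (norm_ne_zero_iff.2 hη))

theorem contDiffAt_ofReal {X : Type*} [NormedAddCommGroup X] [NormedSpace ℝ X] {f : X → ℝ} {x : X}
    (hf : ContDiffAt ℝ ∞ f x) : ContDiffAt ℝ ∞ (fun x => (f x : ℂ)) x :=
  Complex.ofRealCLM.contDiff.contDiffAt.comp x hf

variable {s : ℝ} {z : ℂ}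

/-- The profile of the symbol at high frequencies, as a function of the scale as well. The scale
parameter enters through its square, which is nonnegative, so that the family is smooth on all of
`ℝ × V`; the parameter `0` is the limit of infinite frequency. -/
theorem contDiff_high_piece (hz : z ∉ (fun t : ℝ => (t : ℂ)) '' Set.Ici (0 : ℝ)) :
    ContDiff ℝ ∞ fun p : ℝ × V => (annulusCutoff p.2 : ℂ) *
      ((((2 * Real.pi) ^ s * ‖p.2‖ ^ s : ℝ) : ℂ) - ((p.1 ^ 2 : ℝ) : ℂ) * z)⁻¹ := by
  refine contDiff_annulusCutoff_mul fun τ η hη => ContDiffAt.inv ?_ ?_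
  · exact (contDiffAt_ofReal (contDiffAt_norm_rpow_snd s _ τ hη)).sub
      ((contDiffAt_ofReal (by fun_prop)).mul contDiffAt_const)
  · have := norm_pos_iff.2 hη
    exact ofReal_sub_mul_ne_zero hz (by positivity) (by positivity) (by positivity)

/-- The profile at low frequencies, where the value `-z⁻¹` of the symbol at the origin has been
subtracted. -/
theorem contDiff_low_piece (hz : z ∉ (fun t : ℝ => (t : ℂ)) '' Set.Ici (0 : ℝ)) :
    ContDiff ℝ ∞ fun p : ℝ × V => (annulusCutoff p.2 : ℂ) *
      ((((2 * Real.pi) ^ s * ‖p.2‖ ^ s : ℝ) : ℂ) *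
        (z * (((p.1 ^ 2 * ((2 * Real.pi) ^ s * ‖p.2‖ ^ s) : ℝ) : ℂ) - ((1 : ℝ) : ℂ) * z))⁻¹) := by
  have hz0 : z ≠ 0 := by
    rintro rfl
    exact hz ⟨0, by simp, by simp⟩
  refine contDiff_annulusCutoff_mul fun τ η hη => ?_
  have h1 := contDiffAt_norm_rpow_snd (V := V) s ((2 * Real.pi) ^ s) τ hη
  refine (contDiffAt_ofReal h1).mul (ContDiffAt.inv ?_ ?_)
  · refine contDiffAt_const.mul ((contDiffAt_ofReal (ContDiffAt.mul ?_ h1)).sub contDiffAt_const)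
    fun_prop
  · exact mul_ne_zero hz0 (ofReal_sub_mul_ne_zero hz (by positivity) (by positivity)
      (by positivity))

theorem two_rpow_sq (t : ℝ) : ((2 : ℝ) ^ (t / 2)) ^ 2 = 2 ^ t := by
  rw [← Real.rpow_natCast, ← Real.rpow_mul (by norm_num)]
  congr 1
  push_cast
  ring

/-- The piece of the symbol at frequency `2 ^ k` is `2 ^ (-s k)` times a rescaled profile from a
compact smooth family. -/
theorem high_piece_eq (k : ℝ) (ξ : V) :
    (annulusCutoff (((2 : ℝ) ^ (-k)) • ξ) : ℂ) * resolventSymbol s z ξ =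
      ((2 ^ (-(s * k)) : ℝ) : ℂ) * ((annulusCutoff (((2 : ℝ) ^ (-k)) • ξ) : ℂ) *
      ((((2 * Real.pi) ^ s * ‖((2 : ℝ) ^ (-k)) • ξ‖ ^ s : ℝ) : ℂ) -
        ((((2 : ℝ) ^ (-(s * k) / 2)) ^ 2 : ℝ) : ℂ) * z)⁻¹) := by
  rw [two_rpow_sq, resolventSymbol, norm_smul, Real.norm_of_nonneg (by positivity),
    Real.mul_rpow (by positivity) (norm_nonneg _), ← Real.rpow_mul (by norm_num),
    show -k * s = -(s * k) by ring]
  have h2 : (((2 : ℝ) ^ (-(s * k)) : ℝ) : ℂ) ≠ 0 := by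
    exact_mod_cast (Real.rpow_pos_of_pos two_pos _).ne'
  have e : (((2 * Real.pi) ^ s * (2 ^ (-(s * k)) * ‖ξ‖ ^ s) : ℝ) : ℂ) -
      ((2 ^ (-(s * k)) : ℝ) : ℂ) * z =
      ((2 ^ (-(s * k)) : ℝ) : ℂ) * ((((2 * Real.pi) ^ s * ‖ξ‖ ^ s : ℝ) : ℂ) - z) := by
    push_cast
    ring
  rw [e, mul_inv, mul_left_comm, mul_inv_cancel_left₀ h2]

/-- The piece at frequency `2 ^ (-k)` of the symbol minus its value at the origin also carries a
factor `2 ^ (-s k)`. -/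
theorem low_piece_eq (hz : z ∉ (fun t : ℝ => (t : ℂ)) '' Set.Ici (0 : ℝ)) (k : ℝ) (ξ : V) :
    (annulusCutoff (((2 : ℝ) ^ k) • ξ) : ℂ) * (resolventSymbol s z ξ + z⁻¹) =
      ((2 ^ (-(s * k)) : ℝ) : ℂ) * ((annulusCutoff (((2 : ℝ) ^ k) • ξ) : ℂ) *
      ((((2 * Real.pi) ^ s * ‖((2 : ℝ) ^ k) • ξ‖ ^ s : ℝ) : ℂ) *
        (z * (((((2 : ℝ) ^ (-(s * k) / 2)) ^ 2 *
          ((2 * Real.pi) ^ s * ‖((2 : ℝ) ^ k) • ξ‖ ^ s) : ℝ) : ℂ) - ((1 : ℝ) : ℂ) * z))⁻¹)) := by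
  have hz0 : z ≠ 0 := by
    rintro rfl
    exact hz ⟨0, by simp, by simp⟩
  have hne := ofReal_sub_mul_ne_zero hz (a := (2 * Real.pi) ^ s * ‖ξ‖ ^ s) (b := 1)
    (by positivity) zero_le_one (by positivity)
  rw [two_rpow_sq, resolventSymbol, norm_smul, Real.norm_of_nonneg (by positivity),
    Real.mul_rpow (by positivity) (norm_nonneg _), ← Real.rpow_mul (by norm_num),
    mul_comm k s]
  have h2 : (2 : ℝ) ^ (-(s * k)) * (2 : ℝ) ^ (s * k) = 1 := by
    rw [← Real.rpow_add two_pos, neg_add_cancel, Real.rpow_zero]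
  have e1 : (2 : ℝ) ^ (-(s * k)) * ((2 * Real.pi) ^ s * (2 ^ (s * k) * ‖ξ‖ ^ s)) =
      (2 * Real.pi) ^ s * ‖ξ‖ ^ s := by
    calc _ = (2 : ℝ) ^ (-(s * k)) * (2 : ℝ) ^ (s * k) * ((2 * Real.pi) ^ s * ‖ξ‖ ^ s) := by ring
      _ = _ := by rw [h2, one_mul]
  rw [e1]
  set a : ℝ := (2 * Real.pi) ^ s * ‖ξ‖ ^ s
  have e2 : ((2 ^ (-(s * k)) : ℝ) : ℂ) * (((2 * Real.pi) ^ s * (2 ^ (s * k) * ‖ξ‖ ^ s) : ℝ) : ℂ) =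
      (a : ℂ) := by
    rw [← Complex.ofReal_mul, e1]
  rw [mul_left_comm, ← mul_assoc (((2 ^ (-(s * k)) : ℝ) : ℂ)), e2]
  congr 1
  rw [Complex.ofReal_one, one_mul] at hne ⊢
  field_simp
  ring

theorem sum_high_annulusCutoff (n : ℕ) (ξ : V) :
    ∑ j ∈ Finset.range n, annulusCutoff (((2 : ℝ) ^ (-((j : ℝ) + 1))) • ξ) =
      lowCutoff V (((2 : ℝ) ^ (-(n : ℝ))) • ξ) - lowCutoff V ξ := by
  have h := Finset.sum_range_sub (fun j : ℕ => lowCutoff V (((2 : ℝ) ^ (-(j : ℝ))) • ξ)) n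
  simp only [Nat.cast_zero, neg_zero, Real.rpow_zero, one_smul] at h
  rw [← h]
  refine Finset.sum_congr rfl fun j _ => ?_
  rw [annulusCutoff, smul_smul]
  congr 3
  · push_cast
    rfl
  · conv_lhs => rw [← Real.rpow_one 2]
    rw [← Real.rpow_mul two_pos.le, ← Real.rpow_add two_pos]
    congr 2
    ring

theorem sum_low_annulusCutoff (n : ℕ) (ξ : V) :
    ∑ j ∈ Finset.range n, annulusCutoff (((2 : ℝ) ^ (j : ℝ)) • ξ) =
      lowCutoff V ξ - lowCutoff V (((2 : ℝ) ^ (n : ℝ)) • ξ) := by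
  have h := Finset.sum_range_sub' (fun j : ℕ => lowCutoff V (((2 : ℝ) ^ (j : ℝ)) • ξ)) n
  simp only [Nat.cast_zero, Real.rpow_zero, one_smul] at h
  rw [← h]
  refine Finset.sum_congr rfl fun j _ => ?_
  rw [annulusCutoff, smul_smul]
  congr 3
  conv_lhs => rw [← Real.rpow_one 2]
  rw [← Real.rpow_mul two_pos.le, ← Real.rpow_add two_pos]
  congr 2
  push_cast
  ring

/-- The resolvent symbol, cut off at frequencies above `2 ^ n` and, up to the constant `-z⁻¹`,
below `2 ^ (-n)`. -/
noncomputable def truncatedSymbol (s : ℝ) (z : ℂ) (n : ℕ) (ξ : V) : ℂ :=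
  (lowCutoff V (((2 : ℝ) ^ (-(n : ℝ))) • ξ) : ℂ) * resolventSymbol s z ξ -
    (lowCutoff V (((2 : ℝ) ^ (n : ℝ)) • ξ) : ℂ) * (resolventSymbol s z ξ + z⁻¹)

theorem truncatedSymbol_eq_sum (n : ℕ) (ξ : V) :
    truncatedSymbol s z n ξ =
      ∑ j ∈ Finset.range n,
        ((annulusCutoff (((2 : ℝ) ^ (-((j : ℝ) + 1))) • ξ) : ℂ) * resolventSymbol s z ξ +
          (annulusCutoff (((2 : ℝ) ^ (j : ℝ)) • ξ) : ℂ) * (resolventSymbol s z ξ + z⁻¹)) +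
        -z⁻¹ * (lowCutoff V ξ : ℂ) := by
  rw [Finset.sum_add_distrib, ← Finset.sum_mul, ← Finset.sum_mul, ← Complex.ofReal_sum,
    ← Complex.ofReal_sum, sum_high_annulusCutoff, sum_low_annulusCutoff, truncatedSymbol]
  push_cast
  ring

theorem continuous_truncatedSymbol (hs : 0 < s)
    (hz : z ∉ (fun t : ℝ => (t : ℂ)) '' Set.Ici (0 : ℝ)) (n : ℕ) :
    Continuous (truncatedSymbol s z n : V → ℂ) := by
  have h1 := continuous_resolventSymbol (V := V) hs hz
  have h2 : ∀ a : ℝ, Continuous fun ξ : V => (lowCutoff V (a • ξ) : ℂ) := fun a =>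
    Complex.continuous_ofReal.comp ((lowCutoff V).continuous.comp (continuous_const_smul a))
  exact ((h2 _).mul h1).sub ((h2 _).mul (h1.add continuous_const))

theorem tendsto_truncatedSymbol (hs : 0 < s) (z : ℂ) (ξ : V) :
    Filter.Tendsto (fun n => truncatedSymbol s z n ξ) Filter.atTop
      (nhds (resolventSymbol s z ξ)) := by
  refine tendsto_const_nhds.congr' ?_
  have hpow : Filter.Tendsto (fun n : ℕ => (2 : ℝ) ^ (n : ℝ)) Filter.atTop Filter.atTop := by
    simp_rw [Real.rpow_natCast]
    exact tendsto_pow_atTop_atTop_of_one_lt one_lt_two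
  have h1 : ∀ᶠ n : ℕ in Filter.atTop, lowCutoff V (((2 : ℝ) ^ (-(n : ℝ))) • ξ) = 1 := by
    filter_upwards [hpow.eventually_ge_atTop ‖ξ‖] with n hn
    refine lowCutoff_eq_one ?_
    rw [norm_smul, Real.norm_of_nonneg (by positivity), Real.rpow_neg two_pos.le,
      inv_mul_le_one₀ (by positivity)]
    exact hn
  have h2 : ∀ᶠ n : ℕ in Filter.atTop, (lowCutoff V (((2 : ℝ) ^ (n : ℝ)) • ξ) : ℂ) *
      (resolventSymbol s z ξ + z⁻¹) = 0 := by
    rcases eq_or_ne ξ 0 with rfl | hξ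
    -- at the origin the cutoff never vanishes, but the other factor does
    · refine Filter.Eventually.of_forall fun n => ?_
      simp [resolventSymbol, Real.zero_rpow hs.ne', inv_neg]
    · have hξ' := norm_pos_iff.2 hξ
      filter_upwards [hpow.eventually_ge_atTop (2 / ‖ξ‖)] with n hn
      rw [lowCutoff_eq_zero, Complex.ofReal_zero, zero_mul]
      rw [norm_smul, Real.norm_of_nonneg (by positivity)]
      rwa [div_le_iff₀ hξ'] at hn
  filter_upwards [h1, h2] with n hn1 hn2
  rw [truncatedSymbol, hn1, hn2, Complex.ofReal_one, one_mul, sub_zero]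

end Symbol

/-! ### Boundedness of the resolvent -/

/-- The `k`-th summand of `dyadicKernel`. -/
noncomputable def dyadicTerm (V : Type*) [NormedAddCommGroup V] [NormedSpace ℝ V]
    (s N : ℝ) (x : V) (k : ℤ) : ℝ≥0∞ :=
  ENNReal.ofReal (2 ^ (-(s * |(k : ℝ)|)) * 2 ^ ((Module.finrank ℝ V : ℝ) * k) *
    (1 + 2 ^ (k : ℝ) * ‖x‖) ^ (-N))

theorem sum_dyadicTerm_le {E : Type*} [NormedAddCommGroup E] [NormedSpace ℝ E] {s N : ℝ} (x : E)
    {g : ℕ → ℤ} (hg : Function.Injective g) (n : ℕ) :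
    ∑ j ∈ Finset.range n, dyadicTerm E s N x (g j) ≤ dyadicKernel E s N x :=
  (ENNReal.sum_le_tsum _).trans (ENNReal.tsum_comp_le_tsum_of_injective hg _)

section Kernel

open scoped ContDiff

variable {V : Type*} [NormedAddCommGroup V] [InnerProductSpace ℝ V] [FiniteDimensional ℝ V]
  [MeasurableSpace V] [BorelSpace V]

theorem integrable_slice_comp_smul {Φ : ℝ × V → ℂ} (hΦ : ContDiff ℝ ∞ Φ) {R : ℝ}
    (hR : ∀ τ η, R < ‖η‖ → Φ (τ, η) = 0) (τ : ℝ) {a : ℝ} (ha : 0 < a) (c : ℂ) :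
    Integrable fun ξ : V => c * Φ (τ, a • ξ) := by
  have hc : Continuous fun ξ : V => c * Φ (τ, a • ξ) :=
    continuous_const.mul (hΦ.continuous.comp (by fun_prop))
  refine hc.integrable_of_hasCompactSupport
    (HasCompactSupport.of_support_subset_isCompact (isCompact_closedBall 0 (R / a)) fun ξ hξ => ?_)
  rw [mem_closedBall_zero_iff]
  by_contra! h
  refine hξ ?_
  have : R < ‖a • ξ‖ := by
    rw [norm_smul, Real.norm_of_nonneg ha.le]
    rwa [div_lt_iff₀ ha, mul_comm] at h
  simp only [hR τ _ this, mul_zero]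

theorem exists_fourier_piece_le {Φ : ℝ × V → ℂ} (hΦ : ContDiff ℝ ∞ Φ) {R : ℝ}
    (hR : ∀ τ η, R < ‖η‖ → Φ (τ, η) = 0) (s : ℝ) (N : ℕ) :
    ∃ C : ℝ≥0∞, C ≠ ⊤ ∧ ∀ τ ∈ Set.Icc (0 : ℝ) 1, ∀ k : ℤ, ∀ x : V,
      ‖𝓕 (fun ξ => ((2 ^ (-(s * |(k : ℝ)|)) : ℝ) : ℂ) * Φ (τ, ((2 : ℝ) ^ (-(k : ℝ))) • ξ)) x‖ₑ ≤
        C * dyadicTerm V s N x k := by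
  obtain ⟨C, hC, h⟩ := exists_fourier_decay hΦ hR N
  refine ⟨ENNReal.ofReal C, ENNReal.ofReal_ne_top, fun τ hτ k x => ?_⟩
  rw [fourier_const_mul, fourier_comp_pos_smul (fun η => Φ (τ, η)) (by positivity), dyadicTerm,
    ← ENNReal.ofReal_mul hC, ← ofReal_norm]
  apply ENNReal.ofReal_le_ofReal
  rw [norm_mul, norm_mul, Complex.norm_real, Complex.norm_real, Real.norm_of_nonneg (by positivity),
    Real.norm_of_nonneg (by positivity), ← Real.rpow_mul two_pos.le, ← Real.rpow_neg two_pos.le,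
    neg_neg, neg_mul_neg]
  have h1 := h τ hτ ((2 : ℝ) ^ (k : ℝ) • x)
  rw [norm_smul, Real.norm_of_nonneg (by positivity)] at h1
  calc _ ≤ 2 ^ (-(s * |(k : ℝ)|)) * (2 ^ ((k : ℝ) * (Module.finrank ℝ V : ℝ)) *
        (C * (1 + 2 ^ (k : ℝ) * ‖x‖) ^ (-(N : ℝ)))) := by gcongr
    _ = _ := by rw [mul_comm (k : ℝ)]; ring

variable {s : ℝ} {z : ℂ}

/-- The kernels of the truncated resolvents are dominated by one dyadic kernel, uniformly in the
truncation: the pieces at frequencies `2 ^ k` and `2 ^ (-k)` both carry the weight `2 ^ (-s k)`. -/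
theorem integrable_and_exists_fourier_truncatedSymbol_le (hs : 0 < s)
    (hz : z ∉ (fun t : ℝ => (t : ℂ)) '' Set.Ici (0 : ℝ)) (N : ℕ) :
    (∀ n, Integrable (truncatedSymbol s z n : V → ℂ)) ∧
    ∃ C : ℝ≥0∞, C ≠ ⊤ ∧ ∀ (n : ℕ) (x : V),
      ‖𝓕 (truncatedSymbol s z n : V → ℂ) x‖ₑ ≤ C * dyadicKernel V s N x := by
  set ΦH : ℝ × V → ℂ := fun p => (annulusCutoff p.2 : ℂ) *
      ((((2 * Real.pi) ^ s * ‖p.2‖ ^ s : ℝ) : ℂ) - ((p.1 ^ 2 : ℝ) : ℂ) * z)⁻¹ with hΦH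
  set ΦL : ℝ × V → ℂ := fun p => (annulusCutoff p.2 : ℂ) *
      ((((2 * Real.pi) ^ s * ‖p.2‖ ^ s : ℝ) : ℂ) *
        (z * (((p.1 ^ 2 * ((2 * Real.pi) ^ s * ‖p.2‖ ^ s) : ℝ) : ℂ) - ((1 : ℝ) : ℂ) * z))⁻¹)
    with hΦL
  set ΦM : ℝ × V → ℂ := fun p => -z⁻¹ * (lowCutoff V p.2 : ℂ) with hΦM
  have sH : ContDiff ℝ ∞ ΦH := contDiff_high_piece hz
  have sL : ContDiff ℝ ∞ ΦL := contDiff_low_piece hz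
  have sM : ContDiff ℝ ∞ ΦM := contDiff_const.mul
    (Complex.ofRealCLM.contDiff.comp ((lowCutoff V).contDiff.comp contDiff_snd))
  have rH : ∀ τ η, 2 < ‖η‖ → ΦH (τ, η) = 0 := fun τ η h => by
    simp [hΦH, annulusCutoff_eq_zero_of_ge h.le]
  have rL : ∀ τ η, 2 < ‖η‖ → ΦL (τ, η) = 0 := fun τ η h => by
    simp [hΦL, annulusCutoff_eq_zero_of_ge h.le]
  have rM : ∀ τ η, 2 < ‖η‖ → ΦM (τ, η) = 0 := fun τ η h => by
    simp [hΦM, lowCutoff_eq_zero h.le]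
  obtain ⟨CH, hCH, bH⟩ := exists_fourier_piece_le sH rH s N
  obtain ⟨CL, hCL, bL⟩ := exists_fourier_piece_le sL rL s N
  obtain ⟨CM, hCM, bM⟩ := exists_fourier_piece_le sM rM s N
  have eH : ∀ j : ℕ, (fun ξ : V => (annulusCutoff (((2 : ℝ) ^ (-((j : ℝ) + 1))) • ξ) : ℂ) *
      resolventSymbol s z ξ) = fun ξ => ((2 ^ (-(s * |(((j : ℤ) + 1 : ℤ) : ℝ)|)) : ℝ) : ℂ) *
        ΦH (2 ^ (-(s * ((j : ℝ) + 1)) / 2), ((2 : ℝ) ^ (-((((j : ℤ) + 1 : ℤ)) : ℝ))) • ξ) := by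
    intro j
    ext ξ
    have h0 : (((j : ℤ) + 1 : ℤ) : ℝ) = (j : ℝ) + 1 := by push_cast; rfl
    rw [high_piece_eq, h0, abs_of_nonneg (by positivity)]
  have eL : ∀ j : ℕ, (fun ξ : V => (annulusCutoff (((2 : ℝ) ^ (j : ℝ)) • ξ) : ℂ) *
      (resolventSymbol s z ξ + z⁻¹)) = fun ξ => ((2 ^ (-(s * |((-(j : ℤ) : ℤ) : ℝ)|)) : ℝ) : ℂ) *
        ΦL (2 ^ (-(s * (j : ℝ)) / 2), ((2 : ℝ) ^ (-((-(j : ℤ) : ℤ) : ℝ))) • ξ) := by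
    intro j
    ext ξ
    have h0 : ((-(j : ℤ) : ℤ) : ℝ) = -(j : ℝ) := by push_cast; rfl
    rw [low_piece_eq hz, h0, abs_neg, neg_neg, abs_of_nonneg (by positivity)]
  have eM : (fun ξ : V => -z⁻¹ * (lowCutoff V ξ : ℂ)) =
      fun ξ => ((2 ^ (-(s * |((0 : ℤ) : ℝ)|)) : ℝ) : ℂ) *
        ΦM (0, ((2 : ℝ) ^ (-((0 : ℤ) : ℝ))) • ξ) := by
    ext ξ
    simp [hΦM]
  have iH : ∀ j : ℕ, Integrable fun ξ : V =>
      (annulusCutoff (((2 : ℝ) ^ (-((j : ℝ) + 1))) • ξ) : ℂ) * resolventSymbol s z ξ := fun j => by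
    rw [eH]; exact integrable_slice_comp_smul sH rH _ (by positivity) _
  have iL : ∀ j : ℕ, Integrable fun ξ : V =>
      (annulusCutoff (((2 : ℝ) ^ (j : ℝ)) • ξ) : ℂ) * (resolventSymbol s z ξ + z⁻¹) := fun j => by
    rw [eL]; exact integrable_slice_comp_smul sL rL _ (by positivity) _
  have iM : Integrable fun ξ : V => -z⁻¹ * (lowCutoff V ξ : ℂ) := by
    rw [eM]; exact integrable_slice_comp_smul sM rM _ (by positivity) _
  have iS : ∀ n : ℕ, Integrable fun ξ : V => ∑ j ∈ Finset.range n,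
        ((annulusCutoff (((2 : ℝ) ^ (-((j : ℝ) + 1))) • ξ) : ℂ) * resolventSymbol s z ξ +
          (annulusCutoff (((2 : ℝ) ^ (j : ℝ)) • ξ) : ℂ) * (resolventSymbol s z ξ + z⁻¹)) :=
    fun n => integrable_finsetSum _ fun j _ => (iH j).add (iL j)
  have eS : ∀ n : ℕ, (truncatedSymbol s z n : V → ℂ) = fun ξ => _ :=
    fun n => funext (truncatedSymbol_eq_sum n)
  refine ⟨fun n => by rw [eS]; exact (iS n).add iM, CH + CL + CM, by simp [hCH, hCL, hCM],
    fun n x => ?_⟩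
  have par : ∀ t : ℝ, 0 ≤ t → (2 : ℝ) ^ (-(s * t) / 2) ∈ Set.Icc (0 : ℝ) 1 := fun t ht =>
    ⟨by positivity, Real.rpow_le_one_of_one_le_of_nonpos one_le_two (by nlinarith)⟩
  have iA : ∀ j : ℕ, Integrable fun ξ : V =>
      (annulusCutoff (((2 : ℝ) ^ (-((j : ℝ) + 1))) • ξ) : ℂ) * resolventSymbol s z ξ +
        (annulusCutoff (((2 : ℝ) ^ (j : ℝ)) • ξ) : ℂ) * (resolventSymbol s z ξ + z⁻¹) :=
    fun j => (iH j).add (iL j)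
  rw [eS, fourier_add_apply (iS n) iM, fourier_finset_sum_apply _ fun j _ => iA j]
  have hj : ∀ j : ℕ, ‖𝓕 (fun ξ : V =>
      (annulusCutoff (((2 : ℝ) ^ (-((j : ℝ) + 1))) • ξ) : ℂ) * resolventSymbol s z ξ +
        (annulusCutoff (((2 : ℝ) ^ (j : ℝ)) • ξ) : ℂ) * (resolventSymbol s z ξ + z⁻¹)) x‖ₑ ≤
      CH * dyadicTerm V s N x ((j : ℤ) + 1) + CL * dyadicTerm V s N x (-(j : ℤ)) := by
    intro j
    rw [fourier_add_apply (iH j) (iL j), eH, eL]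
    exact (enorm_add_le _ _).trans (add_le_add (bH _ (par _ (by positivity)) _ x)
      (bL _ (par _ (by positivity)) _ x))
  have hM : ‖𝓕 (fun ξ : V => -z⁻¹ * (lowCutoff V ξ : ℂ)) x‖ₑ ≤ CM * dyadicKernel V s N x := by
    rw [eM]
    refine (bM 0 ⟨le_rfl, zero_le_one⟩ 0 x).trans ?_
    gcongr
    exact ENNReal.le_tsum (f := fun k => dyadicTerm V s N x k) 0
  calc _ ≤ ∑ j ∈ Finset.range n,
          (CH * dyadicTerm V s N x ((j : ℤ) + 1) + CL * dyadicTerm V s N x (-(j : ℤ))) +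
          CM * dyadicKernel V s N x := by
        refine (enorm_add_le _ _).trans (add_le_add ?_ hM)
        exact (enorm_sum_le _ _).trans (Finset.sum_le_sum fun j _ => hj j)
    _ ≤ CH * dyadicKernel V s N x + CL * dyadicKernel V s N x + CM * dyadicKernel V s N x := by
        rw [Finset.sum_add_distrib, ← Finset.mul_sum, ← Finset.mul_sum]
        gcongr
        · exact sum_dyadicTerm_le x (g := fun j : ℕ => (j : ℤ) + 1)
            (fun a b h => by simpa using h) n
        · exact sum_dyadicTerm_le x (g := fun j : ℕ => -(j : ℤ)) (fun a b h => by simpa using h) n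
    _ = _ := by ring

/-- The resolvent is dominated by convolution with a multiple of `dyadicKernel`. -/
theorem exists_enorm_resolvent_le (hs : 0 < s)
    (hz : z ∉ (fun t : ℝ => (t : ℂ)) '' Set.Ici (0 : ℝ)) (N : ℕ) :
    ∃ C : ℝ≥0∞, C ≠ ⊤ ∧ ∀ f : V → ℂ, Integrable f → Integrable (𝓕 f) → ∀ x,
      ‖𝓕⁻ (fun ξ => resolventSymbol s z ξ * 𝓕 f ξ) x‖ₑ ≤
        ∫⁻ y, C * dyadicKernel V s N (x - y) * ‖f y‖ₑ := by
  obtain ⟨hint, C, hC, hb⟩ := integrable_and_exists_fourier_truncatedSymbol_le (V := V) hs hz N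
  refine ⟨C, hC, fun f hf hFf x => ?_⟩
  obtain ⟨B, hB⟩ := norm_resolventSymbol_le (V := V) (s := s) hz
  have hlim : Filter.Tendsto (fun n : ℕ => 𝓕⁻ (fun ξ => truncatedSymbol s z n ξ * 𝓕 f ξ) x)
      Filter.atTop (nhds (𝓕⁻ (fun ξ => resolventSymbol s z ξ * 𝓕 f ξ) x)) := by
    simp_rw [Real.fourierInv_eq]
    refine tendsto_integral_of_dominated_convergence (fun ξ => (2 * B + ‖z⁻¹‖) * ‖𝓕 f ξ‖)
      (fun n => ?_) (hFf.norm.const_mul _) (fun n => ?_) ?_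
    · have hc : Continuous fun ξ : V => Real.fourierChar (inner ℝ ξ x) :=
        Real.continuous_fourierChar.comp (by fun_prop)
      exact hc.aestronglyMeasurable.smul
        ((continuous_truncatedSymbol hs hz n).aestronglyMeasurable.mul hFf.1)
    · refine Filter.Eventually.of_forall fun ξ => ?_
      rw [Circle.norm_smul, norm_mul]
      gcongr
      have hcut : ∀ η : V, ‖(lowCutoff V η : ℂ)‖ ≤ 1 := fun η => by
        rw [Complex.norm_real, Real.norm_of_nonneg (lowCutoff V).nonneg]
        exact (lowCutoff V).le_one
      calc ‖truncatedSymbol s z n ξ‖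
          ≤ 1 * ‖resolventSymbol s z ξ‖ + 1 * ‖resolventSymbol s z ξ + z⁻¹‖ := by
            rw [truncatedSymbol]
            refine (norm_sub_le _ _).trans ?_
            rw [norm_mul, norm_mul]
            gcongr <;> exact hcut _
        _ ≤ 1 * B + 1 * (B + ‖z⁻¹‖) := by
            gcongr
            · exact hB ξ
            · exact (norm_add_le _ _).trans (by gcongr; exact hB ξ)
        _ = _ := by ring
    · exact Filter.Eventually.of_forall fun ξ =>
        ((tendsto_truncatedSymbol hs z ξ).mul_const _).const_smul _
  refine le_of_tendsto (hlim.enorm) (Filter.Eventually.of_forall fun n => ?_)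
  rw [fourierInv_mul_fourier_eq (hint n) hf]
  refine (enorm_integral_le_lintegral_enorm _).trans (lintegral_mono fun y => ?_)
  rw [enorm_mul, mul_comm]
  gcongr
  refine (hb n (y - x)).trans (le_of_eq ?_)
  rw [dyadicKernel, dyadicKernel]
  simp_rw [norm_sub_rev y x]

end Kernel

/-- Comparison of the resolvent with the multiplier in the frequency normalization of `𝓕`. -/
theorem fracResolvent_eq {d : ℕ} (s : ℝ) (z : ℂ) (f : EuclideanSpace ℝ (Fin d) → ℂ) :
    fracResolvent s z f = 𝓕⁻ (fun ξ => resolventSymbol s z ξ * 𝓕 f ξ) := by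
  have e : ∀ ξ : EuclideanSpace ℝ (Fin d),
      (fracLaplacianSymbol s ((2 * Real.pi) • ξ) - z)⁻¹ = resolventSymbol s z ξ := by
    intro ξ
    rw [fracLaplacianSymbol, resolventSymbol, norm_smul, Real.norm_of_nonneg (by positivity),
      Real.mul_rpow (by positivity) (norm_nonneg _)]
  ext x
  rw [fracResolvent, multiplierOp_eq]
  simp_rw [e]

/-- Boundedness of the resolvent for exponents in the region. -/
theorem fracResolvent_bounded {d : ℕ} (hd : 0 < d) {s : ℝ} (hs : 0 < s) (hsd : s < d)
    {p q : ℝ≥0∞} (hp : 1 ≤ p) (hq : 1 ≤ q) {z : ℂ}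
    (hz : z ∉ (fun t : ℝ => (t : ℂ)) '' Set.Ici (0 : ℝ))
    (h : (p⁻¹.toReal, q⁻¹.toReal) ∈ resolventRegion d s) :
    ∃ D : ℝ≥0, ∀ f : SchwartzMap (EuclideanSpace ℝ (Fin d)) ℂ,
      eLpNorm (fracResolvent s z f) q volume ≤ D * eLpNorm f p volume := by
  obtain ⟨⟨⟨hx0, hx1⟩, ⟨hy0, hy1⟩, h1, h2⟩, h3⟩ := h
  simp only [Set.mem_insert_iff, Set.mem_singleton_iff, Prod.mk.injEq, not_or] at h3 hx0 hx1 hy0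
  simp only at h1 h2
  have hdim : (Module.finrank ℝ (EuclideanSpace ℝ (Fin d)) : ℝ) = d := by simp
  have hd' : (0 : ℝ) < d := by exact_mod_cast hd
  obtain ⟨C, hC, hb⟩ := exists_enorm_resolvent_le (V := EuclideanSpace ℝ (Fin d)) hs hz (d + 1)
  have hN : (Module.finrank ℝ (EuclideanSpace ℝ (Fin d)) : ℝ) < ((d + 1 : ℕ) : ℝ) := by
    rw [hdim]; push_cast; linarith
  obtain ⟨C', hC', hle⟩ := exists_dyadicKernel_le (E := EuclideanSpace ℝ (Fin d)) hs
    (by rw [hdim]; exact hsd) hN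
  obtain ⟨D, hD⟩ := exists_eLpNorm_le_of_le_riesz (E := EuclideanSpace ℝ (Fin d)) (μ := volume)
    (by simpa using hd) hs (by rw [hdim]; exact hsd.le)
    (L := fun x => C * dyadicKernel (EuclideanSpace ℝ (Fin d)) s ((d + 1 : ℕ) : ℝ) x)
    ((measurable_dyadicKernel _ _).const_mul C)
    (by
      rw [lintegral_const_mul' _ _ hC]
      exact ENNReal.mul_lt_top hC.lt_top (lintegral_dyadicKernel_lt_top hs hN))
    (C := C * C') (ENNReal.mul_ne_top hC hC')
    (fun x => by rw [mul_assoc]; gcongr; exact hle x) hp hq (by linarith)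
    (by rw [hdim]; exact h2)
    (by
      rw [hdim]
      intro heq
      refine ⟨lt_of_le_of_ne hp ?_, ?_⟩
      · rintro rfl
        refine h3.1 ⟨by simp, ?_⟩
        rw [sub_div, div_self hd'.ne', ← heq]
        simp
      · rintro rfl
        refine h3.2 ⟨?_, by simp⟩
        rw [← heq]
        simp)
  refine ⟨D, fun f => hD f _ f.continuous.measurable fun x => ?_⟩
  rw [fracResolvent_eq]
  have hF : Integrable (𝓕 (f : EuclideanSpace ℝ (Fin d) → ℂ)) := by
    rw [← SchwartzMap.fourier_coe]
    exact (𝓕 f).integrable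
  exact hb f f.integrable hF x

/-! ### Testing the resolvent on the frequency side -/

section Pairing

open scoped ContDiff

theorem eLpNorm_comp_pos_smul {E : Type*} [NormedAddCommGroup E] [NormedSpace ℝ E]
    [FiniteDimensional ℝ E] [MeasurableSpace E] [BorelSpace E] {μ : Measure E} [μ.IsAddHaarMeasure]
    (F : E → ℂ) {a : ℝ} (ha : 0 < a) (p : ℝ≥0∞) :
    eLpNorm (fun x => F (a • x)) p μ =
      ENNReal.ofReal (a ^ (-(Module.finrank ℝ E * p⁻¹.toReal))) * eLpNorm F p μ := by
  have h := (Homeomorph.smulOfNeZero a ha.ne').measurableEmbedding.eLpNorm_map_measure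
    (μ := μ) (g := F) (p := p)
  have h2 : Measure.map (Homeomorph.smulOfNeZero (α := E) a ha.ne') μ =
      ENNReal.ofReal (a ^ (-(Module.finrank ℝ E : ℝ))) • μ := by
    rw [Real.rpow_neg ha.le, Real.rpow_natCast, ← abs_of_pos (inv_pos.2 (pow_pos ha _))]
    exact Measure.map_addHaar_smul μ ha.ne'
  rw [h2, eLpNorm_smul_measure_of_ne_zero (ENNReal.ofReal_pos.2 (by positivity)).ne',
    ENNReal.ofReal_rpow_of_pos (by positivity), ← Real.rpow_mul ha.le, smul_eq_mul, one_div,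
    neg_mul] at h
  exact h.symm

variable {V : Type*} [NormedAddCommGroup V] [InnerProductSpace ℝ V] [FiniteDimensional ℝ V]
  [MeasurableSpace V] [BorelSpace V]

theorem eLpNorm_fourier_lt_top {ψ : V → ℂ} (h : ContDiff ℝ ∞ ψ) (hc : HasCompactSupport ψ)
    (p : ℝ≥0∞) : eLpNorm (𝓕 ψ) p volume < ⊤ :=
  ((𝓕 (hc.toSchwartzMap h)).memLp p volume).2

theorem eLpNorm_fourier_comp_pos_smul (ψ : V → ℂ) {a : ℝ} (ha : 0 < a) (p : ℝ≥0∞) :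
    eLpNorm (𝓕 fun ξ => ψ (a • ξ)) p volume =
      ENNReal.ofReal (a ^ (Module.finrank ℝ V * (p⁻¹.toReal - 1))) * eLpNorm (𝓕 ψ) p volume := by
  have e : (𝓕 fun ξ => ψ (a • ξ)) = ((a ^ (-(Module.finrank ℝ V : ℝ)) : ℝ) : ℂ) •
      fun x => 𝓕 ψ (a⁻¹ • x) := by
    ext x
    rw [fourier_comp_pos_smul ψ ha x, Pi.smul_apply, smul_eq_mul]
  rw [e, eLpNorm_const_smul, eLpNorm_comp_pos_smul (𝓕 ψ) (inv_pos.2 ha), ← mul_assoc,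
    ← ofReal_norm, Complex.norm_real, Real.norm_of_nonneg (by positivity),
    ← ENNReal.ofReal_mul (by positivity), Real.inv_rpow ha.le, ← Real.rpow_neg ha.le,
    ← Real.rpow_add ha]
  congr 3
  ring

/-- Boundedness of the resolvent from `Lᵖ` to `L^q` bounds its bilinear form on the frequency side
by the `Lᵖ` norm and the norm in the dual of `L^q`. -/
theorem enorm_integral_resolventSymbol_mul_le {s : ℝ} (hs : 0 < s) {z : ℂ}
    (hz : z ∉ (fun t : ℝ => (t : ℂ)) '' Set.Ici (0 : ℝ)) {p q q' : ℝ≥0∞}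
    (hqq : q.HolderConjugate q') {C : ℝ≥0}
    (hT : ∀ f : SchwartzMap V ℂ,
      eLpNorm (𝓕⁻ (fun ξ => resolventSymbol s z ξ * 𝓕 (f : V → ℂ) ξ)) q volume ≤
        C * eLpNorm f p volume)
    {ψ₁ ψ₂ : V → ℂ} (h₁ : ContDiff ℝ ∞ ψ₁) (c₁ : HasCompactSupport ψ₁)
    (h₂ : ContDiff ℝ ∞ ψ₂) (c₂ : HasCompactSupport ψ₂) :
    ‖∫ ξ, resolventSymbol s z ξ * ψ₁ ξ * ψ₂ ξ‖ₑ ≤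
      C * eLpNorm (𝓕 ψ₁) p volume * eLpNorm (𝓕 ψ₂) q' volume := by
  set f : SchwartzMap V ℂ := 𝓕⁻ (c₁.toSchwartzMap h₁) with hf
  set g : SchwartzMap V ℂ := 𝓕 (c₂.toSchwartzMap h₂) with hg
  have hFf : 𝓕 (f : V → ℂ) = ψ₁ := by
    have this : 𝓕 f = c₁.toSchwartzMap h₁ := FourierTransform.fourier_fourierInv_eq _
    rw [← SchwartzMap.fourier_coe, this]
    rfl
  have hgi : 𝓕⁻ (g : V → ℂ) = ψ₂ := by
    have this : 𝓕⁻ g = c₂.toSchwartzMap h₂ := FourierTransform.fourierInv_fourier_eq _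
    rw [← SchwartzMap.fourierInv_coe, this]
    rfl
  have hfn : eLpNorm f p volume = eLpNorm (𝓕 ψ₁) p volume := by
    have e : (f : V → ℂ) = 𝓕 ψ₁ ∘ fun x => -x := by
      ext x
      rw [hf, SchwartzMap.fourierInv_coe, Function.comp_apply, Real.fourierInv_eq_fourier_neg]
      rfl
    rw [e]
    exact eLpNorm_comp_measurePreserving
      (continuous_fourier_of_integrable
        (h₁.continuous.integrable_of_hasCompactSupport c₁)).aestronglyMeasurable
      (Measure.measurePreserving_neg volume)
  have hu : Integrable fun ξ => resolventSymbol s z ξ * ψ₁ ξ :=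
    ((continuous_resolventSymbol hs hz).mul h₁.continuous).integrable_of_hasCompactSupport
      c₁.mul_left
  have hTf := hT f
  rw [hFf, hfn] at hTf
  set u := 𝓕⁻ fun ξ => resolventSymbol s z ξ * ψ₁ ξ with hu'
  have hcont : Continuous u := by
    have e : u = 𝓕 (fun ξ => resolventSymbol s z ξ * ψ₁ ξ) ∘ fun x => -x := by
      ext x
      rw [hu', Function.comp_apply, Real.fourierInv_eq_fourier_neg]
    rw [e]
    exact (continuous_fourier_of_integrable hu).comp continuous_neg
  have key : ∫ x, u x * g x = ∫ ξ, resolventSymbol s z ξ * ψ₁ ξ * ψ₂ ξ := by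
    rw [hu', integral_fourierInv_mul_eq_flip hu g.integrable, hgi]
  rw [← key]
  calc ‖∫ x, u x * g x‖ₑ ≤ ∫⁻ x, ‖u x * g x‖ₑ := enorm_integral_le_lintegral_enorm _
    _ = eLpNorm (u • (g : V → ℂ)) 1 volume := by
        rw [eLpNorm_one_eq_lintegral_enorm]; rfl
    _ ≤ eLpNorm u q volume * eLpNorm g q' volume :=
        eLpNorm_smul_le_mul_eLpNorm g.continuous.aestronglyMeasurable
          hcont.aestronglyMeasurable
    _ ≤ _ := by
        gcongr
        exact le_of_eq rfl

variable {s : ℝ} {z : ℂ}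

/-- A bump supported in the annulus `1/2 ≤ |ξ| ≤ 2`, against which the symbol is tested. It is a
square so as to be nonnegative. -/
noncomputable def annulusBump (V : Type*) [NormedAddCommGroup V] [InnerProductSpace ℝ V]
    (ξ : V) : ℂ := (annulusCutoff ξ : ℂ) * (annulusCutoff ξ : ℂ)

theorem annulusBump_eq_zero_of_le {V : Type*} [NormedAddCommGroup V] [InnerProductSpace ℝ V]
    {ξ : V} (h : ‖ξ‖ ≤ 1 / 2) : annulusBump V ξ = 0 := by
  rw [annulusBump, annulusCutoff_eq_zero_of_le h, Complex.ofReal_zero, zero_mul]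

theorem annulusBump_eq_zero_of_ge {V : Type*} [NormedAddCommGroup V] [InnerProductSpace ℝ V]
    {ξ : V} (h : 2 ≤ ‖ξ‖) : annulusBump V ξ = 0 := by
  rw [annulusBump, annulusCutoff_eq_zero_of_ge h, Complex.ofReal_zero, zero_mul]

theorem contDiff_annulusBump {V : Type*} [NormedAddCommGroup V] [InnerProductSpace ℝ V] :
    ContDiff ℝ ∞ (annulusBump V) := by
  have h1 : ContDiff ℝ ∞ fun ξ : V => (annulusCutoff ξ : ℂ) :=
    Complex.ofRealCLM.contDiff.comp contDiff_annulusCutoff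
  exact h1.mul h1

theorem hasCompactSupport_of_eq_zero {V : Type*} [NormedAddCommGroup V] [NormedSpace ℝ V]
    [FiniteDimensional ℝ V] {F : V → ℂ} {R : ℝ} (h : ∀ ξ, R ≤ ‖ξ‖ → F ξ = 0) :
    HasCompactSupport F := by
  refine HasCompactSupport.of_support_subset_isCompact (isCompact_closedBall 0 R) fun ξ hξ => ?_
  rw [mem_closedBall_zero_iff]
  by_contra! hlt
  exact hξ (h ξ hlt.le)

theorem hasCompactSupport_annulusBump {V : Type*} [NormedAddCommGroup V] [InnerProductSpace ℝ V]
    [FiniteDimensional ℝ V] : HasCompactSupport (annulusBump V) :=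
  hasCompactSupport_of_eq_zero fun _ => annulusBump_eq_zero_of_ge

/-- Continuity of the test integral in the two homogeneous parameters of the symbol: `a₀ = 0` is the
low frequency and `b₀ = 0` the high frequency limit. -/
theorem tendsto_integral_annulusBump (hz : z ∉ (fun t : ℝ => (t : ℂ)) '' Set.Ici (0 : ℝ))
    (hs : 0 < s) {a b : ℕ → ℝ} {a₀ b₀ : ℝ} (ha : ∀ k, 0 ≤ a k) (hb : ∀ k, 0 ≤ b k)
    (hab : ∀ k, 1 ≤ a k + b k) (hab₀ : a₀ + b₀ = 1) (ha₀ : 0 ≤ a₀) (hb₀ : 0 ≤ b₀)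
    (hla : Filter.Tendsto a Filter.atTop (nhds a₀))
    (hlb : Filter.Tendsto b Filter.atTop (nhds b₀)) :
    Filter.Tendsto (fun k => ∫ η : V,
      (((a k * ((2 * Real.pi) ^ s * ‖η‖ ^ s) : ℝ) : ℂ) - (b k : ℂ) * z)⁻¹ * annulusBump V η)
      Filter.atTop (nhds (∫ η : V,
        (((a₀ * ((2 * Real.pi) ^ s * ‖η‖ ^ s) : ℝ) : ℂ) - (b₀ : ℂ) * z)⁻¹ * annulusBump V η)) := by
  obtain ⟨κ, hκ, hlow⟩ := exists_norm_sub_ge hz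
  have hns : Continuous fun ξ : V => ‖ξ‖ ^ s := continuous_norm.rpow_const fun _ => Or.inr hs.le
  set m : ℝ := min ((2 * Real.pi) ^ s * (1 / 2) ^ s) 1 with hm
  have hm0 : 0 < m := by positivity
  refine tendsto_integral_of_dominated_convergence (fun η => (κ * m)⁻¹ * ‖annulusBump V η‖)
    (fun k => ?_) ?_ (fun k => ?_) ?_
  · refine Measurable.aestronglyMeasurable ?_
    have hw := (contDiff_annulusBump (V := V)).continuous.measurable
    have hns' := hns.measurable
    fun_prop
  · exact ((contDiff_annulusBump.continuous.integrable_of_hasCompactSupport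
      hasCompactSupport_annulusBump).norm).const_mul _
  · refine Filter.Eventually.of_forall fun η => ?_
    rcases le_total ‖η‖ (1 / 2) with h | h
    · simp [annulusBump_eq_zero_of_le h]
    rw [norm_mul, norm_inv]
    gcongr
    have h1 := hlow (a k * ((2 * Real.pi) ^ s * ‖η‖ ^ s)) (b k)
      (mul_nonneg (ha k) (by positivity)) (hb k)
    refine le_trans ?_ h1
    gcongr
    have h2 : m ≤ (2 * Real.pi) ^ s * ‖η‖ ^ s :=
      (min_le_left _ _).trans (by gcongr)
    have h3 : m ≤ 1 := min_le_right _ _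
    calc m ≤ m * (a k + b k) := le_mul_of_one_le_right hm0.le (hab k)
      _ = a k * m + b k * m := by ring
      _ ≤ a k * ((2 * Real.pi) ^ s * ‖η‖ ^ s) + b k * 1 := by
          gcongr
          · exact ha k
          · exact hb k
      _ = _ := by rw [mul_one]
  · refine Filter.Eventually.of_forall fun η => ?_
    rcases le_or_gt ‖η‖ (1 / 2) with h | h
    · simp [annulusBump_eq_zero_of_le h]
    refine Filter.Tendsto.mul_const _ (Filter.Tendsto.inv₀ ?_ ?_)
    · exact ((Complex.continuous_ofReal.tendsto _).comp (hla.mul_const _)).sub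
        (((Complex.continuous_ofReal.tendsto _).comp hlb).mul_const z)
    · have hη : 0 < ‖η‖ := by linarith
      refine ofReal_sub_mul_ne_zero hz (by positivity) hb₀ ?_
      have hX : 0 < (2 * Real.pi) ^ s * ‖η‖ ^ s := by positivity
      rcases ha₀.eq_or_lt with h0 | h0
      · rw [← h0] at hab₀ ⊢
        linarith
      · positivity

theorem integral_annulusBump_ne_zero [Nontrivial V] : ∫ η : V, annulusBump V η ≠ 0 := by
  obtain ⟨v, hv⟩ := exists_norm_eq V zero_le_one
  have hcv : annulusCutoff v = 1 := by
    rw [annulusCutoff, lowCutoff_eq_one hv.le, lowCutoff_eq_zero, sub_zero]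
    rw [norm_smul, hv, Real.norm_of_nonneg zero_le_two, mul_one]
  have hc : Continuous fun η : V => annulusCutoff η * annulusCutoff η :=
    contDiff_annulusCutoff.continuous.mul contDiff_annulusCutoff.continuous
  have hs : HasCompactSupport fun η : V => annulusCutoff η * annulusCutoff η :=
    HasCompactSupport.of_support_subset_isCompact (isCompact_closedBall 0 2) fun ξ hξ => by
      rw [mem_closedBall_zero_iff]
      by_contra! hlt
      exact hξ (by simp [annulusCutoff_eq_zero_of_ge hlt.le])
  have h := hc.integral_pos_of_hasCompactSupport_nonneg_nonzero (μ := volume) hs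
    (fun η => mul_self_nonneg _) (x := v) (by simp [hcv])
  have e : ∫ η : V, annulusBump V η = ((∫ η : V, annulusCutoff η * annulusCutoff η : ℝ) : ℂ) := by
    rw [← integral_complex_ofReal]
    simp [annulusBump]
  rw [e]
  exact_mod_cast h.ne'

theorem integral_inv_mul_annulusBump_ne_zero [Nontrivial V]
    (hz : z ∉ (fun t : ℝ => (t : ℂ)) '' Set.Ici (0 : ℝ)) :
    ∫ η : V, ((((2 * Real.pi) ^ s * ‖η‖ ^ s : ℝ) : ℂ))⁻¹ * annulusBump V η ≠ 0 := by
  obtain ⟨v, hv⟩ := exists_norm_eq V zero_le_one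
  have hcv : annulusCutoff v = 1 := by
    rw [annulusCutoff, lowCutoff_eq_one hv.le, lowCutoff_eq_zero, sub_zero]
    rw [norm_smul, hv, Real.norm_of_nonneg zero_le_two, mul_one]
  set F : V → ℝ := fun η => ((2 * Real.pi) ^ s * ‖η‖ ^ s)⁻¹ * (annulusCutoff η * annulusCutoff η)
    with hF
  have e : ∀ η : V, ((((2 * Real.pi) ^ s * ‖η‖ ^ s : ℝ) : ℂ))⁻¹ * annulusBump V η = (F η : ℂ) := by
    intro η
    simp only [hF, annulusBump]
    push_cast
    ring
  have hc : Continuous F := by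
    have h1 : Continuous fun η : V => (annulusCutoff η : ℂ) *
        ((((2 * Real.pi) ^ s * ‖η‖ ^ s : ℝ) : ℂ) - (((0 : ℝ) ^ 2 : ℝ) : ℂ) * z)⁻¹ :=
      (contDiff_high_piece (V := V) (s := s) hz).continuous.comp
        (by fun_prop : Continuous fun η : V => ((0 : ℝ), η))
    have h2 := (Complex.continuous_re.comp h1).mul contDiff_annulusCutoff.continuous
    refine h2.congr fun η => ?_
    simp only [hF, Pi.mul_apply, Function.comp_apply]
    rw [show (((0 : ℝ) ^ 2 : ℝ) : ℂ) * z = 0 by simp, sub_zero, ← Complex.ofReal_inv,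
      ← Complex.ofReal_mul, Complex.ofReal_re]
    ring
  have hs : HasCompactSupport F :=
    HasCompactSupport.of_support_subset_isCompact (isCompact_closedBall 0 2) fun ξ hξ => by
      rw [mem_closedBall_zero_iff]
      by_contra! hlt
      exact hξ (by simp [hF, annulusCutoff_eq_zero_of_ge hlt.le])
  have h := hc.integral_pos_of_hasCompactSupport_nonneg_nonzero (μ := volume) hs
    (fun η => mul_nonneg (by positivity) (mul_self_nonneg _)) (x := v) (by
      simp only [hF, hv, hcv]
      positivity)
  simp_rw [e]
  rw [integral_complex_ofReal]
  exact_mod_cast h.ne'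

end Pairing

/-! ### Necessity of the scaling conditions -/

section Necessity

open scoped ContDiff

/-- A smooth cutoff equal to one on the ball of radius `2`, the ball containing the support of
`annulusBump`. -/
noncomputable def wideCutoff (V : Type*) [NormedAddCommGroup V] [InnerProductSpace ℝ V]
    (ξ : V) : ℂ := (lowCutoff V ((2⁻¹ : ℝ) • ξ) : ℂ)

section

variable {V : Type*} [NormedAddCommGroup V] [InnerProductSpace ℝ V]

theorem contDiff_wideCutoff : ContDiff ℝ ∞ (wideCutoff V) :=
  Complex.ofRealCLM.contDiff.comp ((lowCutoff V).contDiff.comp (contDiff_const_smul _))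

theorem wideCutoff_eq_one {ξ : V} (h : ‖ξ‖ ≤ 2) : wideCutoff V ξ = 1 := by
  rw [wideCutoff, lowCutoff_eq_one, Complex.ofReal_one]
  rw [norm_smul, Real.norm_of_nonneg (by positivity)]
  linarith

theorem hasCompactSupport_wideCutoff [FiniteDimensional ℝ V] :
    HasCompactSupport (wideCutoff V) := by
  refine hasCompactSupport_of_eq_zero (R := 4) fun ξ hξ => ?_
  rw [wideCutoff, lowCutoff_eq_zero, Complex.ofReal_zero]
  rw [norm_smul, Real.norm_of_nonneg (by positivity)]
  linarith

theorem hasCompactSupport_comp_pos_smul {ψ : V → ℂ} (hψ : HasCompactSupport ψ) {a : ℝ}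
    (ha : 0 < a) : HasCompactSupport fun ξ => ψ (a • ξ) :=
  hψ.comp_homeomorph (Homeomorph.smulOfNeZero a ha.ne')

end

variable {V : Type*} [NormedAddCommGroup V] [InnerProductSpace ℝ V] [FiniteDimensional ℝ V]
  [MeasurableSpace V] [BorelSpace V] {s : ℝ} {z : ℂ}

section Testing

variable {p q q' : ℝ≥0∞} {C : ℝ≥0}

/-- The bilinear form tested with a rescaled cutoff in the `Lᵖ` slot, where the other function `g`
lives in the region on which the cutoff is one. -/
theorem enorm_integral_resolventSymbol_le_of_cutoff_left (hs : 0 < s)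
    (hz : z ∉ (fun t : ℝ => (t : ℂ)) '' Set.Ici (0 : ℝ)) (hqq : q.HolderConjugate q')
    (hT : ∀ f : SchwartzMap V ℂ,
      eLpNorm (𝓕⁻ (fun ξ => resolventSymbol s z ξ * 𝓕 (f : V → ℂ) ξ)) q volume ≤
        C * eLpNorm f p volume)
    {g : V → ℂ} (hg : ContDiff ℝ ∞ g) (cg : HasCompactSupport g) {a : ℝ} (ha : 0 < a)
    (hga : ∀ ξ, 2 ≤ ‖a • ξ‖ → g ξ = 0) :
    ‖∫ ξ, resolventSymbol s z ξ * g ξ‖ₑ ≤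
      C * (ENNReal.ofReal (a ^ (Module.finrank ℝ V * (p⁻¹.toReal - 1))) *
        eLpNorm (𝓕 (wideCutoff V)) p volume) * eLpNorm (𝓕 g) q' volume := by
  have h := enorm_integral_resolventSymbol_mul_le hs hz hqq hT
    (contDiff_wideCutoff.comp (contDiff_const_smul a))
    (hasCompactSupport_comp_pos_smul hasCompactSupport_wideCutoff ha) hg cg
  refine le_trans (le_of_eq ?_) (h.trans (le_of_eq ?_))
  · congr 2
    ext ξ
    rcases le_total 2 ‖a • ξ‖ with h2 | h2
    · simp [hga ξ h2]
    · simp [wideCutoff_eq_one h2]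
  · rw [← eLpNorm_fourier_comp_pos_smul _ ha]
    rfl

/-- The bilinear form tested with a rescaled cutoff in the slot dual to `L^q`. -/
theorem enorm_integral_resolventSymbol_le_of_cutoff_right (hs : 0 < s)
    (hz : z ∉ (fun t : ℝ => (t : ℂ)) '' Set.Ici (0 : ℝ)) (hqq : q.HolderConjugate q')
    (hT : ∀ f : SchwartzMap V ℂ,
      eLpNorm (𝓕⁻ (fun ξ => resolventSymbol s z ξ * 𝓕 (f : V → ℂ) ξ)) q volume ≤
        C * eLpNorm f p volume)
    {g : V → ℂ} (hg : ContDiff ℝ ∞ g) (cg : HasCompactSupport g) {a : ℝ} (ha : 0 < a)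
    (hga : ∀ ξ, 2 ≤ ‖a • ξ‖ → g ξ = 0) :
    ‖∫ ξ, resolventSymbol s z ξ * g ξ‖ₑ ≤
      C * eLpNorm (𝓕 g) p volume *
        (ENNReal.ofReal (a ^ (Module.finrank ℝ V * (q'⁻¹.toReal - 1))) *
          eLpNorm (𝓕 (wideCutoff V)) q' volume) := by
  have h := enorm_integral_resolventSymbol_mul_le hs hz hqq hT hg cg
    (contDiff_wideCutoff.comp (contDiff_const_smul a))
    (hasCompactSupport_comp_pos_smul hasCompactSupport_wideCutoff ha)
  refine le_trans (le_of_eq ?_) (h.trans (le_of_eq ?_))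
  · congr 2
    ext ξ
    rcases le_total 2 ‖a • ξ‖ with h2 | h2
    · simp [hga ξ h2]
    · simp [wideCutoff_eq_one h2]
  · rw [← eLpNorm_fourier_comp_pos_smul _ ha]
    rfl

end Testing

/-- The integral of the bump against the symbol `(a |2πξ|^s - b z)⁻¹`. -/
noncomputable def bumpPairing (V : Type*) [NormedAddCommGroup V] [InnerProductSpace ℝ V]
    [FiniteDimensional ℝ V] [MeasurableSpace V] [BorelSpace V] (s : ℝ) (z : ℂ) (a b : ℝ) : ℂ :=
  ∫ η : V, (((a * ((2 * Real.pi) ^ s * ‖η‖ ^ s) : ℝ) : ℂ) - (b : ℂ) * z)⁻¹ * annulusBump V η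

theorem bumpPairing_mul_mul (c a b : ℝ) :
    bumpPairing V s z (c * a) (c * b) = (c : ℂ)⁻¹ * bumpPairing V s z a b := by
  rw [bumpPairing, bumpPairing, ← integral_const_mul]
  congr 1
  ext η
  rw [← mul_assoc (c : ℂ)⁻¹, ← mul_inv]
  congr 2
  push_cast
  ring

theorem integral_resolventSymbol_mul_bump {a : ℝ} (ha : 0 < a) :
    ∫ ξ : V, resolventSymbol s z ξ * annulusBump V (a • ξ) =
      ((a ^ (-(Module.finrank ℝ V : ℝ)) : ℝ) : ℂ) * bumpPairing V s z (a ^ (-s)) 1 := by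
  have h := Measure.integral_comp_smul (volume : Measure V)
    (fun η => (((a ^ (-s) * ((2 * Real.pi) ^ s * ‖η‖ ^ s) : ℝ) : ℂ) - ((1 : ℝ) : ℂ) * z)⁻¹ *
      annulusBump V η) a
  rw [abs_of_pos (inv_pos.2 (pow_pos ha _)), Complex.real_smul, ← Real.rpow_natCast,
    ← Real.rpow_neg ha.le] at h
  rw [bumpPairing, ← h]
  congr 1
  ext ξ
  rw [resolventSymbol, norm_smul, Real.norm_of_nonneg ha.le, Real.mul_rpow ha.le (norm_nonneg _),
    Complex.ofReal_one, one_mul, Real.rpow_neg ha.le]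
  congr 4
  have := (Real.rpow_pos_of_pos ha s).ne'
  field_simp

theorem integral_resolventSymbol_mul_bump_two_rpow (k : ℝ) :
    ∫ ξ : V, resolventSymbol s z ξ * annulusBump V (((2 : ℝ) ^ (-k)) • ξ) =
      ((2 ^ ((Module.finrank ℝ V - s) * k) : ℝ) : ℂ) *
        bumpPairing V s z 1 ((2 : ℝ) ^ (-(s * k))) := by
  rw [integral_resolventSymbol_mul_bump (by positivity), ← Real.rpow_mul zero_le_two,
    ← Real.rpow_mul zero_le_two]
  have h := bumpPairing_mul_mul (V := V) (s := s) (z := z) (2 ^ (s * k)) 1 (2 ^ (-(s * k)))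
  rw [mul_one, ← Real.rpow_add two_pos, add_neg_cancel, Real.rpow_zero] at h
  rw [show -k * -s = s * k by ring, h, ← mul_assoc, ← Complex.ofReal_inv, ← Complex.ofReal_mul,
    ← Real.rpow_neg zero_le_two, ← Real.rpow_add two_pos]
  congr 3
  ring

theorem tendsto_two_rpow_neg_mul (hs : 0 < s) :
    Filter.Tendsto (fun k : ℕ => (2 : ℝ) ^ (-(s * k))) Filter.atTop (nhds 0) := by
  have e : (fun k : ℕ => (2 : ℝ) ^ (-(s * k))) = fun k => ((2 : ℝ) ^ (-s)) ^ k := by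
    ext k
    rw [← Real.rpow_natCast, ← Real.rpow_mul zero_le_two, neg_mul]
  rw [e]
  exact tendsto_pow_atTop_nhds_zero_of_lt_one (by positivity)
    (Real.rpow_lt_one_of_one_lt_of_neg one_lt_two (by linarith))

theorem tendsto_bumpPairing_low (hz : z ∉ (fun t : ℝ => (t : ℂ)) '' Set.Ici (0 : ℝ))
    (hs : 0 < s) : Filter.Tendsto (fun k : ℕ => bumpPairing V s z ((2 : ℝ) ^ (-(s * k))) 1)
      Filter.atTop (nhds (bumpPairing V s z 0 1)) :=
  tendsto_integral_annulusBump (b := fun _ => 1) hz hs (fun _ => by positivity)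
    (fun _ => zero_le_one) (fun _ => le_add_of_nonneg_left (by positivity)) (zero_add 1) le_rfl
    zero_le_one (tendsto_two_rpow_neg_mul hs) tendsto_const_nhds

theorem tendsto_bumpPairing_high (hz : z ∉ (fun t : ℝ => (t : ℂ)) '' Set.Ici (0 : ℝ))
    (hs : 0 < s) : Filter.Tendsto (fun k : ℕ => bumpPairing V s z 1 ((2 : ℝ) ^ (-(s * k))))
      Filter.atTop (nhds (bumpPairing V s z 1 0)) :=
  tendsto_integral_annulusBump (a := fun _ => 1) hz hs (fun _ => zero_le_one)
    (fun _ => by positivity) (fun _ => le_add_of_nonneg_right (by positivity)) (add_zero 1)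
    zero_le_one le_rfl tendsto_const_nhds (tendsto_two_rpow_neg_mul hs)

theorem bumpPairing_zero_one_ne_zero [Nontrivial V]
    (hz : z ∉ (fun t : ℝ => (t : ℂ)) '' Set.Ici (0 : ℝ)) : bumpPairing V s z 0 1 ≠ 0 := by
  have hz0 : z ≠ 0 := by
    rintro rfl
    exact hz ⟨0, by simp, by simp⟩
  simp only [bumpPairing, zero_mul, Complex.ofReal_zero, zero_sub, Complex.ofReal_one, one_mul]
  rw [integral_const_mul]
  exact mul_ne_zero (inv_ne_zero (neg_ne_zero.2 hz0)) integral_annulusBump_ne_zero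

theorem bumpPairing_one_zero_ne_zero [Nontrivial V]
    (hz : z ∉ (fun t : ℝ => (t : ℂ)) '' Set.Ici (0 : ℝ)) : bumpPairing V s z 1 0 ≠ 0 := by
  simp only [bumpPairing, one_mul, Complex.ofReal_zero, zero_mul, sub_zero]
  exact integral_inv_mul_annulusBump_ne_zero hz

/-- A sequence with nonzero limit cannot decay geometrically. -/
theorem nonneg_of_tendsto_of_enorm_le {u : ℕ → ℂ} {l : ℂ} (hl : l ≠ 0)
    (hu : Filter.Tendsto u Filter.atTop (nhds l)) {K : ℝ≥0∞} (hK : K ≠ ⊤) {e : ℝ}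
    (h : ∀ k : ℕ, ‖u k‖ₑ ≤ K * ENNReal.ofReal (2 ^ (e * k))) : 0 ≤ e := by
  by_contra! he
  have h1 := tendsto_two_rpow_neg_mul (s := -e) (by linarith)
  have h2 : Filter.Tendsto (fun k : ℕ => K * ENNReal.ofReal (2 ^ (e * k))) Filter.atTop
      (nhds (K * ENNReal.ofReal 0)) := by
    refine ENNReal.Tendsto.const_mul (ENNReal.tendsto_ofReal ?_) (Or.inr hK)
    simpa using h1
  have h3 := le_of_tendsto_of_tendsto' hu.enorm h2 h
  simp [hl] at h3

section Dilation

variable {p q : ℝ≥0∞} {C : ℝ≥0}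

/-- Testing the bound on the dilates of a fixed bump. -/
theorem exists_enorm_bumpPairing_le (hs : 0 < s)
    (hz : z ∉ (fun t : ℝ => (t : ℂ)) '' Set.Ici (0 : ℝ)) (hq : 1 ≤ q)
    (hT : ∀ f : SchwartzMap V ℂ,
      eLpNorm (𝓕⁻ (fun ξ => resolventSymbol s z ξ * 𝓕 (f : V → ℂ) ξ)) q volume ≤
        C * eLpNorm f p volume) :
    ∃ K : ℝ≥0∞, K ≠ ⊤ ∧ ∀ a : ℝ, 0 < a → ‖bumpPairing V s z (a ^ (-s)) 1‖ₑ ≤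
      K * ENNReal.ofReal (a ^ (Module.finrank ℝ V * (p⁻¹.toReal - q⁻¹.toReal))) := by
  have hqq := ENNReal.HolderConjugate.inv_one_sub_inv' hq
  set q' : ℝ≥0∞ := (1 - q⁻¹)⁻¹ with hq'
  have hx' : q'⁻¹.toReal = 1 - q⁻¹.toReal := by
    rw [hq', inv_inv, ENNReal.toReal_sub_of_le (ENNReal.inv_le_one.2 hq) ENNReal.one_ne_top,
      ENNReal.toReal_one]
  refine ⟨C * eLpNorm (𝓕 (wideCutoff V)) p volume * eLpNorm (𝓕 (annulusBump V)) q' volume,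
    ENNReal.mul_ne_top (ENNReal.mul_ne_top ENNReal.coe_ne_top
      (eLpNorm_fourier_lt_top contDiff_wideCutoff hasCompactSupport_wideCutoff p).ne)
      (eLpNorm_fourier_lt_top contDiff_annulusBump hasCompactSupport_annulusBump q').ne,
    fun a ha => ?_⟩
  have h := enorm_integral_resolventSymbol_le_of_cutoff_left hs hz hqq hT
    (contDiff_annulusBump.comp (contDiff_const_smul a))
    (hasCompactSupport_comp_pos_smul hasCompactSupport_annulusBump ha) ha
    (fun ξ hξ => annulusBump_eq_zero_of_ge hξ)
  have e1 := eLpNorm_fourier_comp_pos_smul (annulusBump V) ha q'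
  simp only [Function.comp_def] at h
  rw [integral_resolventSymbol_mul_bump ha, e1, enorm_mul, ← ofReal_norm, Complex.norm_real,
    Real.norm_of_nonneg (by positivity)] at h
  set n : ℝ := (Module.finrank ℝ V : ℝ) with hn
  calc ‖bumpPairing V s z (a ^ (-s)) 1‖ₑ
      = ENNReal.ofReal (a ^ n) *
          (ENNReal.ofReal (a ^ (-n)) * ‖bumpPairing V s z (a ^ (-s)) 1‖ₑ) := by
        rw [← mul_assoc, ← ENNReal.ofReal_mul (by positivity), ← Real.rpow_add ha, add_neg_cancel,
          Real.rpow_zero, ENNReal.ofReal_one, one_mul]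
    _ ≤ ENNReal.ofReal (a ^ n) * _ := mul_le_mul' le_rfl h
    _ = C * eLpNorm (𝓕 (wideCutoff V)) p volume * eLpNorm (𝓕 (annulusBump V)) q' volume *
          (ENNReal.ofReal (a ^ n) * ENNReal.ofReal (a ^ (n * (p⁻¹.toReal - 1))) *
            ENNReal.ofReal (a ^ (n * (q'⁻¹.toReal - 1)))) := by ring
    _ = _ := by
        rw [← ENNReal.ofReal_mul (by positivity), ← ENNReal.ofReal_mul (by positivity),
          ← Real.rpow_add ha, ← Real.rpow_add ha, hx']
        congr 3
        ring

/-- Bumps at low frequencies, where the symbol is nearly the constant `-z⁻¹`, force `p ≤ q`. -/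
theorem inv_toReal_sub_nonneg_of_bound [Nontrivial V] (hs : 0 < s)
    (hz : z ∉ (fun t : ℝ => (t : ℂ)) '' Set.Ici (0 : ℝ)) (hq : 1 ≤ q)
    (hT : ∀ f : SchwartzMap V ℂ,
      eLpNorm (𝓕⁻ (fun ξ => resolventSymbol s z ξ * 𝓕 (f : V → ℂ) ξ)) q volume ≤
        C * eLpNorm f p volume) : 0 ≤ p⁻¹.toReal - q⁻¹.toReal := by
  obtain ⟨K, hK, h⟩ := exists_enorm_bumpPairing_le hs hz hq hT
  have h0 := nonneg_of_tendsto_of_enorm_le (bumpPairing_zero_one_ne_zero hz)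
    (tendsto_bumpPairing_low (V := V) hz hs) hK
    (e := Module.finrank ℝ V * (p⁻¹.toReal - q⁻¹.toReal)) fun k => by
      have := h (2 ^ (k : ℝ)) (by positivity)
      rw [← Real.rpow_mul zero_le_two, ← Real.rpow_mul zero_le_two] at this
      rwa [show -(s * k) = (k : ℝ) * -s by ring, mul_comm _ (k : ℝ)]
  exact nonneg_of_mul_nonneg_right h0 (by exact_mod_cast Module.finrank_pos)

/-- Bumps at high frequencies, where the symbol is nearly homogeneous of degree `-s`, bound the gain
of integrability. -/
theorem inv_toReal_sub_le_of_bound [Nontrivial V] (hs : 0 < s)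
    (hz : z ∉ (fun t : ℝ => (t : ℂ)) '' Set.Ici (0 : ℝ)) (hq : 1 ≤ q)
    (hT : ∀ f : SchwartzMap V ℂ,
      eLpNorm (𝓕⁻ (fun ξ => resolventSymbol s z ξ * 𝓕 (f : V → ℂ) ξ)) q volume ≤
        C * eLpNorm f p volume) :
    p⁻¹.toReal - q⁻¹.toReal ≤ s / Module.finrank ℝ V := by
  obtain ⟨K, hK, h⟩ := exists_enorm_bumpPairing_le hs hz hq hT
  have h0 := nonneg_of_tendsto_of_enorm_le (bumpPairing_one_zero_ne_zero hz)
    (tendsto_bumpPairing_high (V := V) hz hs) hK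
    (e := s - Module.finrank ℝ V * (p⁻¹.toReal - q⁻¹.toReal)) fun k => by
      have h1 := h (2 ^ (-(k : ℝ))) (by positivity)
      rw [← Real.rpow_mul zero_le_two, ← Real.rpow_mul zero_le_two] at h1
      have h2 := bumpPairing_mul_mul (V := V) (s := s) (z := z) (2 ^ (-(s * k))) (2 ^ (s * k)) 1
      rw [mul_one, ← Real.rpow_add two_pos, neg_add_cancel, Real.rpow_zero] at h2
      rw [h2, ← Complex.ofReal_inv, ← Real.rpow_neg zero_le_two, neg_neg, enorm_mul,
        ← ofReal_norm, Complex.norm_real, Real.norm_of_nonneg (by positivity)]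
      rw [show -(k : ℝ) * -s = s * k by ring] at h1
      calc _ ≤ ENNReal.ofReal (2 ^ (s * k)) * _ := mul_le_mul' le_rfl h1
        _ = _ := by
          rw [mul_left_comm, ← ENNReal.ofReal_mul (by positivity), ← Real.rpow_add two_pos]
          congr 3
          ring
  have hn : (0 : ℝ) < Module.finrank ℝ V := by exact_mod_cast Module.finrank_pos
  rw [le_div_iff₀ hn]
  linarith

end Dilation

end Necessity

/-! ### Failure at the two endpoints -/

section Endpoint

open scoped ContDiff

variable {V : Type*} [NormedAddCommGroup V] [InnerProductSpace ℝ V]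

/-- The sum of `N` dyadic bumps, weighted like the homogeneous symbol `|ξ|^(s - n)`, with `n` the
dimension. It is the test function at the endpoints: its Fourier transform behaves like `|x|^(-s)`
on a range of `N` dyadic annuli. -/
noncomputable def bumpSum (V : Type*) [NormedAddCommGroup V] [InnerProductSpace ℝ V] (s : ℝ)
    (N : ℕ) (ξ : V) : ℂ :=
  ∑ k ∈ Finset.range N, ((2 ^ ((s - Module.finrank ℝ V) * k) : ℝ) : ℂ) *
    annulusBump V (((2 : ℝ) ^ (-(k : ℝ))) • ξ)

theorem contDiff_bumpSum (s : ℝ) (N : ℕ) : ContDiff ℝ ∞ (bumpSum V s N) :=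
  ContDiff.sum fun _ _ => contDiff_const.mul (contDiff_annulusBump.comp (contDiff_const_smul _))

theorem bumpSum_eq_zero {s : ℝ} {N : ℕ} {ξ : V} (h : 2 ≤ ‖((2 : ℝ) ^ (-(N : ℝ))) • ξ‖) :
    bumpSum V s N ξ = 0 := by
  refine Finset.sum_eq_zero fun k hk => ?_
  rw [annulusBump_eq_zero_of_ge, mul_zero]
  refine h.trans ?_
  rw [norm_smul, norm_smul, Real.norm_of_nonneg (by positivity),
    Real.norm_of_nonneg (by positivity)]
  gcongr
  · exact one_le_two
  · exact (Finset.mem_range.1 hk).le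

theorem hasCompactSupport_bumpSum [FiniteDimensional ℝ V] (s : ℝ) (N : ℕ) :
    HasCompactSupport (bumpSum V s N) := by
  refine hasCompactSupport_of_eq_zero (R := 2 * 2 ^ (N : ℝ)) fun ξ hξ => bumpSum_eq_zero ?_
  rw [norm_smul, Real.norm_of_nonneg (by positivity), Real.rpow_neg zero_le_two,
    inv_mul_eq_div, le_div_iff₀ (by positivity)]
  exact hξ

variable [FiniteDimensional ℝ V] [MeasurableSpace V] [BorelSpace V] {s : ℝ} {z : ℂ}

theorem integrable_bump_comp_smul {a : ℝ} (ha : 0 < a) :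
    Integrable fun ξ : V => annulusBump V (a • ξ) :=
  (contDiff_annulusBump.comp (contDiff_const_smul a)).continuous.integrable_of_hasCompactSupport
    (hasCompactSupport_comp_pos_smul hasCompactSupport_annulusBump ha)

theorem integral_resolventSymbol_mul_bumpSum (hs : 0 < s)
    (hz : z ∉ (fun t : ℝ => (t : ℂ)) '' Set.Ici (0 : ℝ)) (N : ℕ) :
    ∫ ξ : V, resolventSymbol s z ξ * bumpSum V s N ξ =
      ∑ k ∈ Finset.range N, bumpPairing V s z 1 ((2 : ℝ) ^ (-(s * k))) := by
  simp only [bumpSum, Finset.mul_sum]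
  rw [integral_finsetSum]
  · refine Finset.sum_congr rfl fun k _ => ?_
    have h := integral_resolventSymbol_mul_bump_two_rpow (V := V) (s := s) (z := z) k
    simp_rw [mul_left_comm (resolventSymbol s z _)]
    rw [integral_const_mul, h, ← mul_assoc, ← Complex.ofReal_mul, ← Real.rpow_add two_pos,
      ← add_mul, sub_add_sub_cancel, sub_self, zero_mul, Real.rpow_zero, Complex.ofReal_one,
      one_mul]
  · intro k _
    have hc : HasCompactSupport fun ξ : V => annulusBump V (((2 : ℝ) ^ (-(k : ℝ))) • ξ) :=
      hasCompactSupport_comp_pos_smul hasCompactSupport_annulusBump (by positivity)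
    refine Continuous.integrable_of_hasCompactSupport ?_ (hc.mul_left.mul_left)
    exact (continuous_resolventSymbol hs hz).mul (continuous_const.mul
      (contDiff_annulusBump.comp (contDiff_const_smul _)).continuous)

theorem fourier_bumpSum (s : ℝ) (N : ℕ) (x : V) :
    𝓕 (bumpSum V s N) x = ∑ k ∈ Finset.range N,
      ((2 ^ (s * k) : ℝ) : ℂ) * 𝓕 (annulusBump V) (((2 : ℝ) ^ (k : ℝ)) • x) := by
  have h := fourier_finset_sum_apply (V := V) (Finset.range N)
    (F := fun k ξ => ((2 ^ ((s - Module.finrank ℝ V) * k) : ℝ) : ℂ) *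
      annulusBump V (((2 : ℝ) ^ (-(k : ℝ))) • ξ))
    (fun k _ => (integrable_bump_comp_smul (by positivity)).const_mul _) x
  refine h.trans (Finset.sum_congr rfl fun k _ => ?_)
  rw [fourier_const_mul, fourier_comp_pos_smul _ (by positivity), ← mul_assoc,
    ← Complex.ofReal_mul, ← Real.rpow_mul zero_le_two, ← Real.rpow_add two_pos,
    ← Real.rpow_neg zero_le_two, neg_neg]
  congr 4
  ring

/-- The `k`-th summand of the majorant of the Fourier transform of `bumpSum`. -/
noncomputable def bumpTail (V : Type*) [NormedAddCommGroup V] [InnerProductSpace ℝ V] (s : ℝ)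
    (k : ℤ) (x : V) : ℝ≥0∞ :=
  ENNReal.ofReal (2 ^ (s * k) * (1 + 2 ^ (k : ℝ) * ‖x‖) ^ (-(Module.finrank ℝ V + 1 : ℝ)))

theorem exists_enorm_fourier_bumpSum_le (V : Type*) [NormedAddCommGroup V] [InnerProductSpace ℝ V]
    [FiniteDimensional ℝ V] [MeasurableSpace V] [BorelSpace V] (s : ℝ) :
    ∃ C : ℝ≥0, ∀ (N : ℕ) (x : V), ‖𝓕 (bumpSum V s N) x‖ₑ ≤
      C * ∑ k ∈ Finset.range N, bumpTail V s k x := by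
  obtain ⟨C, hC, h⟩ := exists_fourier_decay (V := V) (Φ := fun τ => annulusBump V τ.2)
    (contDiff_annulusBump.comp contDiff_snd) (R := 2)
    (fun _ _ hη => annulusBump_eq_zero_of_ge hη.le) (Module.finrank ℝ V + 1)
  refine ⟨C.toNNReal, fun N x => ?_⟩
  rw [fourier_bumpSum, Finset.mul_sum]
  refine (enorm_sum_le _ _).trans (Finset.sum_le_sum fun k _ => ?_)
  have h1 := h 0 (by simp) (((2 : ℝ) ^ (k : ℝ)) • x)
  rw [norm_smul, Real.norm_of_nonneg (by positivity)] at h1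
  rw [bumpTail, ← ofReal_norm, norm_mul, Complex.norm_real, Real.norm_of_nonneg (by positivity),
    ← ENNReal.ofReal, ← ENNReal.ofReal_mul hC]
  refine ENNReal.ofReal_le_ofReal ?_
  push_cast at h1 ⊢
  calc _ ≤ (2 : ℝ) ^ (s * k) * _ := mul_le_mul_of_nonneg_left h1 (by positivity)
    _ = _ := by ring

theorem lintegral_enorm_rpow_mul_tail_lt_top [Nontrivial V] (hs : 0 < s)
    (hsn : s < Module.finrank ℝ V) :
    ∫⁻ x : V, ‖x‖ₑ ^ (s - Module.finrank ℝ V) * bumpTail V s 0 x < ⊤ := by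
  have e : ∀ x : V, bumpTail V s 0 x =
      ENNReal.ofReal ((1 + ‖x‖) ^ (-(Module.finrank ℝ V + 1 : ℝ))) := fun x => by
    simp [bumpTail]
  rw [← lintegral_add_compl _ (measurableSet_ball (x := (0 : V)) (ε := 1))]
  refine ENNReal.add_lt_top.2 ⟨?_, ?_⟩
  · refine lt_of_le_of_lt (lintegral_mono fun x => ?_) (setLIntegral_ball_enorm_rpow_lt_top
      (μ := (volume : Measure V)) Module.finrank_pos (α := s - Module.finrank ℝ V) (by linarith))
    refine mul_le_of_le_one_right' ?_
    rw [e, ENNReal.ofReal_le_one]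
    exact Real.rpow_le_one_of_one_le_of_nonpos (by linarith [norm_nonneg x])
      (neg_nonpos.2 (by positivity))
  · refine lt_of_le_of_lt ?_ (finite_integral_one_add_norm (E := V) (μ := volume)
      (r := Module.finrank ℝ V + 1) (by linarith))
    refine le_trans (setLIntegral_mono_ae' measurableSet_ball.compl
      (Filter.Eventually.of_forall fun x hx => ?_)) (setLIntegral_le_lintegral _ _)
    have hx1 : 1 ≤ ‖x‖ := by simpa using hx
    have hx0 : x ≠ 0 := norm_pos_iff.1 (by linarith)
    rw [e, enorm_rpow_eq_ofReal hx0]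
    refine mul_le_of_le_one_left' (ENNReal.ofReal_le_one.2 ?_)
    exact Real.rpow_le_one_of_one_le_of_nonpos hx1 (by linarith)

/-- By homogeneity every dyadic scale contributes the same amount. -/
theorem lintegral_enorm_rpow_mul_bumpTail [Nontrivial V] (k : ℤ) :
    ∫⁻ x : V, ‖x‖ₑ ^ (s - Module.finrank ℝ V) * bumpTail V s k x =
      ∫⁻ x : V, ‖x‖ₑ ^ (s - Module.finrank ℝ V) * bumpTail V s 0 x := by
  have h := lintegral_comp_pos_smul (μ := (volume : Measure V))
    (fun x => ‖x‖ₑ ^ (s - Module.finrank ℝ V) * bumpTail V s 0 x)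
    (Real.rpow_pos_of_pos two_pos (k : ℝ))
  have h2 : ∀ᵐ x : V, ‖x‖ₑ ^ (s - Module.finrank ℝ V) * bumpTail V s k x =
      ENNReal.ofReal ((2 ^ (k : ℝ)) ^ (Module.finrank ℝ V : ℝ)) *
        (‖((2 : ℝ) ^ (k : ℝ)) • x‖ₑ ^ (s - Module.finrank ℝ V) *
          bumpTail V s 0 (((2 : ℝ) ^ (k : ℝ)) • x)) := by
    filter_upwards [ae_ne_zero_of_finrank_pos Module.finrank_pos] with x hx
    have hx' : ((2 : ℝ) ^ (k : ℝ)) • x ≠ 0 := smul_ne_zero (by positivity) hx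
    rw [enorm_rpow_eq_ofReal hx, enorm_rpow_eq_ofReal hx', bumpTail, bumpTail, norm_smul,
      Real.norm_of_nonneg (by positivity), ← ENNReal.ofReal_mul (by positivity),
      ← ENNReal.ofReal_mul (by positivity), ← ENNReal.ofReal_mul (by positivity),
      Real.mul_rpow (by positivity) (norm_nonneg _), ← Real.rpow_mul zero_le_two,
      ← Real.rpow_mul zero_le_two]
    congr 1
    have e : (2 : ℝ) ^ (s * k) = 2 ^ ((k : ℝ) * Module.finrank ℝ V) *
        2 ^ ((k : ℝ) * (s - Module.finrank ℝ V)) := by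
      rw [← Real.rpow_add two_pos]
      congr 1
      ring
    rw [e]
    simp only [Int.cast_zero, mul_zero, Real.rpow_zero, one_mul]
    ring
  rw [lintegral_congr_ae h2, lintegral_const_mul' _ _ ENNReal.ofReal_ne_top, h, ← mul_assoc,
    ← ENNReal.ofReal_mul (by positivity), ← Real.rpow_add (by positivity), add_neg_cancel,
    Real.rpow_zero, ENNReal.ofReal_one, one_mul]

/-- The Fourier transforms of the test functions are `O(|x|^(-s))` uniformly in `N`, which is just
not in the Lebesgue space with exponent `n / s`: the norm there grows like `N ^ (s / n)`. -/
theorem exists_eLpNorm_fourier_bumpSum_le [Nontrivial V] (hs : 0 < s)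
    (hsn : s < Module.finrank ℝ V) {r : ℝ≥0∞} (hr : r⁻¹.toReal = s / Module.finrank ℝ V) :
    ∃ K : ℝ≥0∞, K ≠ ⊤ ∧ ∀ N : ℕ, eLpNorm (𝓕 (bumpSum V s N)) r volume ≤
      K * (N : ℝ≥0∞) ^ (s / Module.finrank ℝ V) := by
  have hn : (0 : ℝ) < Module.finrank ℝ V := hs.trans hsn
  set n : ℝ := (Module.finrank ℝ V : ℝ) with hnd
  have hr' : r.toReal = n / s := by
    rw [ENNReal.toReal_inv] at hr
    rw [← inv_inv r.toReal, hr, inv_div]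
  have hr0 : r ≠ 0 := by
    rintro rfl
    rw [ENNReal.toReal_zero] at hr'
    exact (div_pos hn hs).ne hr'
  have hrt : r ≠ ⊤ := by
    rintro rfl
    rw [ENNReal.toReal_top] at hr'
    exact (div_pos hn hs).ne hr'
  set ρ : ℝ := n / s with hρ
  have hρ1 : 1 < ρ := (one_lt_div hs).2 hsn
  obtain ⟨C₀, h₀⟩ := exists_enorm_fourier_bumpSum_le V s
  obtain ⟨C₁, hC₁, h₁⟩ := exists_tsum_lacunary_norm_le (F := V) (a := s) (N := n + 1) hs
    (by linarith)
  set I : ℝ≥0∞ := ∫⁻ x : V, ‖x‖ₑ ^ (s - n) * bumpTail V s 0 x with hI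
  have hIt : I ≠ ⊤ := (lintegral_enorm_rpow_mul_tail_lt_top hs hsn).ne
  have hG : ∀ (N : ℕ) (x : V), ∑ k ∈ Finset.range N, bumpTail V s k x ≤ C₁ * ‖x‖ₑ ^ (-s) := by
    intro N x
    refine le_trans ?_ (h₁ x)
    have := ENNReal.sum_le_tsum (f := fun k : ℤ => bumpTail V s k x)
      ((Finset.range N).map Nat.castEmbedding)
    rw [Finset.sum_map] at this
    exact this
  refine ⟨C₀ * (C₁ ^ (ρ - 1) * I) ^ (1 / ρ), ENNReal.mul_ne_top ENNReal.coe_ne_top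
    (ENNReal.rpow_ne_top_of_nonneg (by positivity) (ENNReal.mul_ne_top
      (ENNReal.rpow_ne_top_of_nonneg (by linarith) hC₁) hIt)), fun N => ?_⟩
  rw [eLpNorm_eq_lintegral_rpow_enorm_toReal hr0 hrt, hr']
  have hmain : ∫⁻ x : V, ‖𝓕 (bumpSum V s N) x‖ₑ ^ ρ ≤
      (C₀ : ℝ≥0∞) ^ ρ * (C₁ ^ (ρ - 1) * I * N) := by
    calc ∫⁻ x : V, ‖𝓕 (bumpSum V s N) x‖ₑ ^ ρ
        ≤ ∫⁻ x : V, (C₀ : ℝ≥0∞) ^ ρ * C₁ ^ (ρ - 1) *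
          ∑ k ∈ Finset.range N, ‖x‖ₑ ^ (s - n) * bumpTail V s k x := by
          refine lintegral_mono fun x => ?_
          set G := ∑ k ∈ Finset.range N, bumpTail V s k x with hGd
          -- the homogeneous bound is used for all but one of the `ρ` powers of `G`, so that the
          -- remaining integral is linear in the summands
          calc ‖𝓕 (bumpSum V s N) x‖ₑ ^ ρ ≤ (C₀ * G) ^ ρ := by
                gcongr
                exact h₀ N x
            _ = (C₀ : ℝ≥0∞) ^ ρ * (G ^ (ρ - 1) * G) := by
                rw [ENNReal.mul_rpow_of_nonneg _ _ (by linarith)]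
                congr 1
                conv_rhs => rw [← ENNReal.rpow_one G, ← ENNReal.rpow_mul, one_mul]
                rw [← ENNReal.rpow_add_of_nonneg _ _ (by linarith) zero_le_one, sub_add_cancel]
            _ ≤ (C₀ : ℝ≥0∞) ^ ρ * ((C₁ * ‖x‖ₑ ^ (-s)) ^ (ρ - 1) * G) := by
                gcongr
                exact hG N x
            _ = _ := by
                rw [ENNReal.mul_rpow_of_nonneg _ _ (by linarith), ← ENNReal.rpow_mul,
                  ← Finset.mul_sum, ← hGd, show -s * (ρ - 1) = s - n by rw [hρ]; field_simp; ring]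
                ring
      _ = (C₀ : ℝ≥0∞) ^ ρ * (C₁ ^ (ρ - 1) * I * N) := by
          rw [lintegral_const_mul' _ _ (ENNReal.mul_ne_top
            (ENNReal.rpow_ne_top_of_nonneg (by linarith) ENNReal.coe_ne_top)
            (ENNReal.rpow_ne_top_of_nonneg (by linarith) hC₁)), lintegral_finsetSum']
          · have hc : ∀ k ∈ Finset.range N,
                ∫⁻ x : V, ‖x‖ₑ ^ (s - n) * bumpTail V s k x = I := fun k _ =>
              lintegral_enorm_rpow_mul_bumpTail (k : ℤ)
            rw [Finset.sum_congr rfl hc, Finset.sum_const, Finset.card_range, nsmul_eq_mul]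
            ring
          · intro k _
            unfold bumpTail
            fun_prop
  calc _ ≤ ((C₀ : ℝ≥0∞) ^ ρ * (C₁ ^ (ρ - 1) * I * N)) ^ (1 / ρ) := by gcongr
    _ = _ := by
        have hρ' : 0 ≤ 1 / ρ := by positivity
        rw [ENNReal.mul_rpow_of_nonneg _ _ hρ', ENNReal.mul_rpow_of_nonneg _ _ hρ',
          ← ENNReal.rpow_mul, mul_one_div_cancel (by positivity), ENNReal.rpow_one, mul_assoc,
          show 1 / ρ = s / n by rw [hρ, one_div_div]]

/-- A growth bound of order less than one on the pairings with the test functions is impossible,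
as all the bumps contribute about the same amount to them. -/
theorem not_exists_enorm_integral_bumpSum_le [Nontrivial V] (hs : 0 < s)
    (hsn : s < Module.finrank ℝ V) (hz : z ∉ (fun t : ℝ => (t : ℂ)) '' Set.Ici (0 : ℝ))
    {K : ℝ≥0∞} (hK : K ≠ ⊤) (h : ∀ N : ℕ, ‖∫ ξ : V, resolventSymbol s z ξ * bumpSum V s N ξ‖ₑ ≤
      K * (N : ℝ≥0∞) ^ (s / Module.finrank ℝ V)) : False := by
  have hlt : s / Module.finrank ℝ V - 1 < 0 := by
    rw [sub_neg, div_lt_one (hs.trans hsn)]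
    exact hsn
  set σ : ℝ := s / Module.finrank ℝ V with hσ
  have h1 := ((tendsto_bumpPairing_high (V := V) hz hs).cesaro_smul).enorm
  have h2 : Filter.Tendsto (fun N : ℕ => K * ENNReal.ofReal ((N : ℝ) ^ (σ - 1))) Filter.atTop
      (nhds (K * ENNReal.ofReal 0)) := by
    refine ENNReal.Tendsto.const_mul (ENNReal.tendsto_ofReal ?_) (Or.inr hK)
    have := (tendsto_rpow_neg_atTop (y := 1 - σ) (by linarith)).comp tendsto_natCast_atTop_atTop
    simpa [Function.comp_def] using this
  have h3 := le_of_tendsto_of_tendsto h1 h2 (by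
    filter_upwards [Filter.eventually_gt_atTop 0] with N hN
    have hN' : (0 : ℝ) < N := by exact_mod_cast hN
    have h4 := h N
    rw [integral_resolventSymbol_mul_bumpSum hs hz] at h4
    rw [enorm_smul]
    calc _ ≤ ‖(N : ℝ)⁻¹‖ₑ * (K * (N : ℝ≥0∞) ^ σ) := mul_le_mul' le_rfl h4
      _ = _ := by
        rw [← ofReal_norm, Real.norm_of_nonneg (by positivity), ← ENNReal.ofReal_natCast N,
          ENNReal.ofReal_rpow_of_pos hN', mul_left_comm, ← ENNReal.ofReal_mul (by positivity),
          Real.rpow_sub_one hN'.ne', inv_mul_eq_div])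
  have h5 := bumpPairing_one_zero_ne_zero (V := V) (s := s) hz
  simp [h5] at h3

variable {p q : ℝ≥0∞} {C : ℝ≥0}

/-- Failure at the endpoint from `L¹`. The Fourier transforms of the rescaled cutoffs, which occupy
the `L¹` slot, all have the same norm there. -/
theorem not_bound_one_left [Nontrivial V] (hs : 0 < s) (hsn : s < Module.finrank ℝ V)
    (hz : z ∉ (fun t : ℝ => (t : ℂ)) '' Set.Ici (0 : ℝ)) (hq : 1 ≤ q)
    (hT : ∀ f : SchwartzMap V ℂ,
      eLpNorm (𝓕⁻ (fun ξ => resolventSymbol s z ξ * 𝓕 (f : V → ℂ) ξ)) q volume ≤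
        C * eLpNorm f p volume)
    (hp : p⁻¹.toReal = 1) (hqs : 1 - q⁻¹.toReal = s / Module.finrank ℝ V) : False := by
  have hqq := ENNReal.HolderConjugate.inv_one_sub_inv' hq
  set q' : ℝ≥0∞ := (1 - q⁻¹)⁻¹ with hq'
  have hx' : q'⁻¹.toReal = s / Module.finrank ℝ V := by
    rw [hq', inv_inv, ENNReal.toReal_sub_of_le (ENNReal.inv_le_one.2 hq) ENNReal.one_ne_top,
      ENNReal.toReal_one, hqs]
  obtain ⟨K, hK, hN⟩ := exists_eLpNorm_fourier_bumpSum_le (V := V) hs hsn hx'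
  refine not_exists_enorm_integral_bumpSum_le (V := V) hs hsn hz
    (K := C * eLpNorm (𝓕 (wideCutoff V)) p volume * K)
    (ENNReal.mul_ne_top (ENNReal.mul_ne_top ENNReal.coe_ne_top (eLpNorm_fourier_lt_top
      contDiff_wideCutoff hasCompactSupport_wideCutoff p).ne) hK) fun N => ?_
  refine (enorm_integral_resolventSymbol_le_of_cutoff_left hs hz hqq hT (contDiff_bumpSum s N)
    (hasCompactSupport_bumpSum s N) (a := 2 ^ (-(N : ℝ))) (by positivity)
    (fun ξ hξ => bumpSum_eq_zero hξ)).trans ?_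
  rw [hp, sub_self, mul_zero, Real.rpow_zero, ENNReal.ofReal_one, one_mul, mul_assoc _ K]
  exact mul_le_mul' le_rfl (hN N)

/-- Failure at the endpoint to `L^∞`. -/
theorem not_bound_top_right [Nontrivial V] (hs : 0 < s) (hsn : s < Module.finrank ℝ V)
    (hz : z ∉ (fun t : ℝ => (t : ℂ)) '' Set.Ici (0 : ℝ)) (hq : 1 ≤ q)
    (hT : ∀ f : SchwartzMap V ℂ,
      eLpNorm (𝓕⁻ (fun ξ => resolventSymbol s z ξ * 𝓕 (f : V → ℂ) ξ)) q volume ≤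
        C * eLpNorm f p volume)
    (hp : p⁻¹.toReal = s / Module.finrank ℝ V) (hqs : q⁻¹.toReal = 0) : False := by
  have hqq := ENNReal.HolderConjugate.inv_one_sub_inv' hq
  set q' : ℝ≥0∞ := (1 - q⁻¹)⁻¹ with hq'
  have hx' : q'⁻¹.toReal = 1 := by
    rw [hq', inv_inv, ENNReal.toReal_sub_of_le (ENNReal.inv_le_one.2 hq) ENNReal.one_ne_top,
      ENNReal.toReal_one, hqs, sub_zero]
  obtain ⟨K, hK, hN⟩ := exists_eLpNorm_fourier_bumpSum_le (V := V) hs hsn hp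
  refine not_exists_enorm_integral_bumpSum_le (V := V) hs hsn hz
    (K := C * eLpNorm (𝓕 (wideCutoff V)) q' volume * K)
    (ENNReal.mul_ne_top (ENNReal.mul_ne_top ENNReal.coe_ne_top (eLpNorm_fourier_lt_top
      contDiff_wideCutoff hasCompactSupport_wideCutoff q').ne) hK) fun N => ?_
  refine (enorm_integral_resolventSymbol_le_of_cutoff_right hs hz hqq hT (contDiff_bumpSum s N)
    (hasCompactSupport_bumpSum s N) (a := 2 ^ (-(N : ℝ))) (by positivity)
    (fun ξ hξ => bumpSum_eq_zero hξ)).trans ?_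
  rw [hx', sub_self, mul_zero, Real.rpow_zero, ENNReal.ofReal_one, one_mul, mul_assoc _ K,
    mul_right_comm]
  exact mul_le_mul' le_rfl (hN N)

end Endpoint

/-! ### The operator norm and the region -/

section OperatorNorm

theorem opNormLpLq_lt_top_iff {d : ℕ}
    (T : (EuclideanSpace ℝ (Fin d) → ℂ) → (EuclideanSpace ℝ (Fin d) → ℂ)) (p q : ℝ≥0∞) :
    opNormLpLq T p q < ∞ ↔ ∃ C : ℝ≥0, ∀ f : SchwartzMap (EuclideanSpace ℝ (Fin d)) ℂ,
      eLpNorm (T f) q volume ≤ C * eLpNorm f p volume := by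
  simp only [opNormLpLq, iInf_lt_iff, ENNReal.coe_lt_top, exists_prop, and_true]

theorem toReal_inv_mem_Icc {p : ℝ≥0∞} (hp : 1 ≤ p) : 0 ≤ p⁻¹.toReal ∧ p⁻¹.toReal ≤ 1 :=
  ⟨ENNReal.toReal_nonneg,
    ENNReal.toReal_le_of_le_ofReal zero_le_one (by simpa using ENNReal.inv_le_one.2 hp)⟩

/-- Necessity of the region. -/
theorem mem_resolventRegion_of_bound {d : ℕ} (hd : 0 < d) {s : ℝ} (hs : 0 < s) (hsd : s < d)
    {p q : ℝ≥0∞} (hp : 1 ≤ p) (hq : 1 ≤ q) {z : ℂ}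
    (hz : z ∉ (fun t : ℝ => (t : ℂ)) '' Set.Ici (0 : ℝ)) {C : ℝ≥0}
    (hC : ∀ f : SchwartzMap (EuclideanSpace ℝ (Fin d)) ℂ,
      eLpNorm (fracResolvent s z f) q volume ≤ C * eLpNorm f p volume) :
    (p⁻¹.toReal, q⁻¹.toReal) ∈ resolventRegion d s := by
  have hdim : Module.finrank ℝ (EuclideanSpace ℝ (Fin d)) = d := finrank_euclideanSpace_fin
  have hnt : Nontrivial (EuclideanSpace ℝ (Fin d)) :=
    Module.nontrivial_of_finrank_pos (R := ℝ) (by rwa [hdim])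
  have hd' : (d : ℝ) ≠ 0 := by exact_mod_cast hd.ne'
  simp_rw [fracResolvent_eq] at hC
  have h1 := inv_toReal_sub_nonneg_of_bound hs hz hq hC
  have h2 := inv_toReal_sub_le_of_bound hs hz hq hC
  rw [hdim] at h2
  refine ⟨⟨toReal_inv_mem_Icc hp, toReal_inv_mem_Icc hq, h1, h2⟩, ?_⟩
  rintro (h | h)
  · obtain ⟨h3, h4⟩ := Prod.mk.inj h
    refine not_bound_one_left hs (by rwa [hdim]) hz hq hC h3 ?_
    rw [h4, hdim, sub_div, div_self hd', sub_sub_cancel]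
  · obtain ⟨h3, h4⟩ := Prod.mk.inj h
    exact not_bound_top_right hs (by rwa [hdim]) hz hq hC (by rw [h3, hdim]) h4

end OperatorNorm

theorem proposition6p1 (d : ℕ) (hd : 2 ≤ d) (s : ℝ) (hs0 : 0 < s) (hsd : s < d)
    (p q : ℝ≥0∞) (hp : 1 ≤ p) (hq : 1 ≤ q)
    (z : ℂ) (hz : z ∉ (fun t : ℝ => (t : ℂ)) '' Set.Ici (0 : ℝ)) :
    opNormLpLq (d := d) (fracResolvent s z) p q < ∞ ↔
      (p⁻¹.toReal, q⁻¹.toReal) ∈ resolventRegion d s := by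
  have hd0 : 0 < d := two_pos.trans_le hd
  rw [opNormLpLq_lt_top_iff]
  exact ⟨fun ⟨_, hC⟩ => mem_resolventRegion_of_bound hd0 hs0 hsd hp hq hz hC,
    fun h => fracResolvent_bounded hd0 hs0 hsd hp hq hz h⟩
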